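/- **Theorem ($m$-dimensional $k$-matching counting).** There are a deterministic algorithm and a polynomial $p$ with the following property. Given integers $m\ge 1$ and $k\ge 0$, mutually disjoint finite sets $U_1,\dots,U_m$ (given as lists of their elements, which are named by natural numbers) and a set $C\subseteq U_1\times\cdots\times U_m$ of $m$-tuples (given as a list of tuples), the algorithm computes exactly the number of sub-collections $S\subseteq C$ that consist of $k$ mutually disjoint $m$-tuples (two tuples being disjoint if they have no element in common), in time at most $$p(L)\cdot\binom{n}{\downarrow (m-1)k/2},\qquad \binom{n}{\downarrow r}:=\sum_{i=0}^{\lfloor r\rfloor}\binom{n}{i},$$ that is, in $O^*\!\left(\binom{n}{\downarrow (m-1)k/2}\right)$ time. Here $n=|U_2|+\cdots+|U_m|$ and $L$ is the size of the input (its numbers written in binary, each counted with its bit length plus one). Time is measured on a random access machine with logarithmic cost, that is, every number handled by the machine, addresses included, is charged by its bit length. The algorithm and the polynomial $p$ do not depend on $m$, $k$, the sets or $C$. -/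

import Mathlib

/-!
# A random access machine with logarithmic cost

Programs are structured RAM programs.  The machine has a read-only input, which is a list of
natural numbers, and a memory of cells `0, 1, 2, …`, each holding a natural number and initially
holding `0`.  Both can be accessed at computed addresses.  Every number the machine handles,
addresses included, is charged by its bit length.
-/

namespace RAM

/-- The logarithmic cost of handling the number `x`. -/
def bitCost (x : ℕ) : ℕ := Nat.size x + 1

/-- The contents of the memory cells. -/
abbrev Mem : Type := ℕ → ℕ

/-- The expressions that a program can evaluate. -/
inductive Term : Type
  /-- a constant -/
  | lit (c : ℕ) : Term
  /-- the word of the input at a computed position (`0` beyond the end of the input) -/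
  | input (a : Term) : Term
  /-- the content of the memory cell at a computed address -/
  | cell (a : Term) : Term
  | add (a b : Term) : Term
  /-- truncated subtraction -/
  | sub (a b : Term) : Term
  | mul (a b : Term) : Term
  /-- integer division, with `x / 0 = 0` -/
  | div (a b : Term) : Term

/-- The value of an expression. -/
def Term.val (inp : List ℕ) (M : Mem) : Term → ℕ
  | .lit c => c
  | .input a => inp.getD (a.val inp M) 0
  | .cell a => M (a.val inp M)
  | .add a b => a.val inp M + b.val inp M
  | .sub a b => a.val inp M - b.val inp M
  | .mul a b => a.val inp M * b.val inp M
  | .div a b => a.val inp M / b.val inp M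

/-- The time needed to evaluate an expression: the sum, over all its subexpressions, of the
logarithmic cost of their values. -/
def Term.cost (inp : List ℕ) (M : Mem) : Term → ℕ
  | .lit c => bitCost c
  | .input a => a.cost inp M + bitCost ((Term.input a).val inp M)
  | .cell a => a.cost inp M + bitCost ((Term.cell a).val inp M)
  | .add a b => a.cost inp M + b.cost inp M + bitCost ((Term.add a b).val inp M)
  | .sub a b => a.cost inp M + b.cost inp M + bitCost ((Term.sub a b).val inp M)
  | .mul a b => a.cost inp M + b.cost inp M + bitCost ((Term.mul a b).val inp M)
  | .div a b => a.cost inp M + b.cost inp M + bitCost ((Term.div a b).val inp M)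

/-- Programs. -/
inductive Program : Type
  /-- do nothing -/
  | skip : Program
  /-- write the value of `v` into the memory cell whose address is the value of `a` -/
  | assign (a v : Term) : Program
  /-- run `p`, then `q` -/
  | seq (p q : Program) : Program
  /-- run `p` if the value of `c` is nonzero, and `q` otherwise -/
  | cond (c : Term) (p q : Program) : Program
  /-- run `p` again and again as long as the value of `c` is nonzero -/
  | loop (c : Term) (p : Program) : Program

/-- `Runs inp p M M' t`: on the input `inp`, the program `p`, started with memory `M`, halts after
time exactly `t`, with memory `M'`. -/
inductive Runs (inp : List ℕ) : Program → Mem → Mem → ℕ → Prop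
  | skip (M : Mem) : Runs inp .skip M M 1
  | assign (a v : Term) (M : Mem) :
      Runs inp (.assign a v) M (Function.update M (a.val inp M) (v.val inp M))
        (a.cost inp M + v.cost inp M + 1)
  | seq {p q : Program} {M M' M'' : Mem} {s t : ℕ} :
      Runs inp p M M' s → Runs inp q M' M'' t → Runs inp (.seq p q) M M'' (s + t + 1)
  | cond_true {c : Term} {p q : Program} {M M' : Mem} {t : ℕ} :
      c.val inp M ≠ 0 → Runs inp p M M' t → Runs inp (.cond c p q) M M' (c.cost inp M + t + 1)
  | cond_false {c : Term} {p q : Program} {M M' : Mem} {t : ℕ} :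
      c.val inp M = 0 → Runs inp q M M' t → Runs inp (.cond c p q) M M' (c.cost inp M + t + 1)
  | loop_done {c : Term} {p : Program} {M : Mem} :
      c.val inp M = 0 → Runs inp (.loop c p) M M (c.cost inp M + 1)
  | loop_step {c : Term} {p : Program} {M M' M'' : Mem} {s t : ℕ} :
      c.val inp M ≠ 0 → Runs inp p M M' s → Runs inp (.loop c p) M' M'' t →
        Runs inp (.loop c p) M M'' (c.cost inp M + s + t + 1)

/-- On the input `inp`, the program `p` halts with output `out` (the content of cell `0`) within
time `T`. -/
def ComputesWithin (p : Program) (inp : List ℕ) (out T : ℕ) : Prop :=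
  ∃ (M : Mem) (t : ℕ), Runs inp p (fun _ => 0) M t ∧ M 0 = out ∧ t ≤ T

/-- The size of an input: its number of bits, plus one for each of its words. -/
def inputSize (inp : List ℕ) : ℕ := (inp.map bitCost).sum

end RAM

/-- An instance of the `m`-dimensional `k`-matching problem: mutually disjoint finite sets
`U 0, …, U (m - 1)`, and a set `C` of tuples from their product, all given as lists without
repetitions in an arbitrary order.  The elements are named by natural numbers. -/
structure MatchingInstance where
  m : ℕ
  m_pos : 1 ≤ m
  U : Fin m → List ℕ
  U_nodup : ∀ i, (U i).Nodup
  U_disjoint : ∀ i j, i ≠ j → (U i).Disjoint (U j)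
  C : List (Fin m → ℕ)
  C_nodup : C.Nodup
  C_mem : ∀ t ∈ C, ∀ i, t i ∈ U i
  k : ℕ

namespace MatchingInstance

/-- The input given to the machine: `m` and `k`, then each `U i` preceded by its size, then the
number of tuples, and then the tuples, coordinate by coordinate. -/
def encode (I : MatchingInstance) : List ℕ :=
  [I.m, I.k] ++ (List.ofFn fun i => (I.U i).length :: I.U i).flatten ++
    (I.C.length :: (I.C.map fun t => List.ofFn t).flatten)

/-- The number of elements of all the sets except the first one. -/
def numElements (I : MatchingInstance) : ℕ :=
  ∑ i ∈ Finset.univ.filter (fun i : Fin I.m => i.val ≠ 0), (I.U i).length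

/-- The number of sub-collections of `C` consisting of `k` mutually disjoint tuples, where two
tuples are disjoint if they have no element in common. -/
noncomputable def numMatchings (I : MatchingInstance) : ℕ :=
  {S : Finset (Fin I.m → ℕ) | (∀ t ∈ S, t ∈ I.C) ∧ S.card = I.k ∧
    (S : Set (Fin I.m → ℕ)).PairwiseDisjoint (fun t => Finset.univ.image t)}.ncard

end MatchingInstance

/-- The number of subsets of size at most `r` of an `n`-element set,
`∑_{i = 0}^{r} binom(n, i)`. -/
def chooseDown (n r : ℕ) : ℕ := ∑ i ∈ Finset.range (r + 1), n.choose i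

/-! A matching is a set of `k` tuples with distinct first coordinates ("keys") and pairwise disjoint
remaining parts ("masks", `mu`), each mask having at most `m - 1` of the `n` elements. Sorted by
key, a nonempty matching has exactly one tuple `c` with `a = ⌊(k-1)/2⌋` predecessors, and then `b =
⌊k/2⌋` successors. Let `X` and `Y` be the unions of the masks before and after `c`. They are
disjoint, avoid the mask of `c`, and have at most `R = ⌊(m-1)k/2⌋` elements each, because `a, b ≤
k/2`; setting the middle tuple aside is what makes this true for odd `k`. So the matchings are
counted by a sum over `c` and over disjoint pairs `X, Y` of small sets (`card_okSets`), and there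
are at most `chooseDown n R` small sets (`length_famList_le`).

For fixed `c` the sets of `a` tuples below `c` with union `X` are counted by dynamic programming
along chains of decreasing keys (`chainCount_eq_card`). Monotone keys are automatically distinct, so
it suffices to remember the last tuple and the remaining union; this is why the first set does not
contribute to `n`. The tuples above `c` are treated by the same recursion for the reversed order.

Running over all disjoint pairs would square the time. Instead, with `ζf(X) = ∑_{Y ⊇ X} f(Y)`,
inclusion–exclusion gives `∑_{Y ∩ Z = ∅} f(Y) g(Z) = ∑_X (-1)^|X| ζf(X) ζg(X)`
(`sum_zeta_mul_zeta`), and on a family closed under subsets `ζ` is computed element by element in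
`n` passes (`zeta_eq_sum`). All of this costs a polynomial times the size of the family.

On the machine a set is a number with ternary digits `0` and `1`. Two codes add without carries, so
a sum of two codes is again a code only for disjoint sets (`code_add_eq_iff`), and one arithmetic
operation replaces a test for inclusion. Tables are addressed by codes. Their address range is
exponential but only listed sets are written, and no row is ever reused, so all other entries keep
the initial `0`, which is the right value there. Sums are taken modulo `W = 2^(q+1)`, where `q` is
the number of tuples; this exceeds the result and keeps all numbers short.

The program is written in a small language with named arrays and bounded loops. The triple `Tri`
proves correctness, a bound on the number of steps and a bound on the bit length of every stored
number simultaneously; the last bound makes each step polynomially cheap. -/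

open Finset

namespace KMatching

/-! ### Coding finite sets by numbers with ternary digits `0` and `1` -/

/-- The number whose ternary digits are given by the indicator function of `S`. -/
def code (S : Finset ℕ) : ℕ := ∑ i ∈ S, 3 ^ i

theorem sum_digits_lt (f : ℕ → ℕ) (hf : ∀ i, f i ≤ 2) (n : ℕ) :
    ∑ i ∈ range n, f i * 3 ^ i < 3 ^ n := by
  induction n with
  | zero => simp
  | succ n ih =>
    rw [sum_range_succ, pow_succ]
    have := Nat.mul_le_mul_right (3 ^ n) (hf n)
    omega

/-- Digits up to `2` are allowed, not just `0` and `1`: this covers the digitwise sum of two codes.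
-/
theorem sum_digits_div_mod (f : ℕ → ℕ) (hf : ∀ i, f i ≤ 2) {n v : ℕ} (hv : v < n) :
    (∑ i ∈ range n, f i * 3 ^ i) / 3 ^ v % 3 = f v := by
  induction n with
  | zero => omega
  | succ n ih =>
    rw [sum_range_succ]
    rcases Nat.lt_succ_iff_lt_or_eq.1 hv with h | rfl
    · obtain ⟨e, rfl⟩ := Nat.exists_eq_add_of_lt h
      have : f (v + e + 1) * 3 ^ (v + e + 1) = 3 ^ v * (3 * (f (v + e + 1) * 3 ^ e)) := by ring
      rw [this, Nat.add_mul_div_left _ _ (by positivity), Nat.add_mul_mod_self_left]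
      exact ih h
    · rw [Nat.add_mul_div_right _ _ (by positivity), Nat.div_eq_of_lt (sum_digits_lt f hf v),
        zero_add]
      have := hf v
      omega

theorem code_eq_sum_range {S : Finset ℕ} {n : ℕ} (h : S ⊆ range n) :
    code S = ∑ i ∈ range n, (if i ∈ S then 1 else 0) * 3 ^ i := by
  simp only [ite_mul, one_mul, zero_mul]
  rw [← sum_filter, filter_mem_eq_inter, inter_eq_right.2 h, code]

theorem code_lt {S : Finset ℕ} {n : ℕ} (h : S ⊆ range n) : code S < 3 ^ n := by
  rw [code_eq_sum_range h]
  exact sum_digits_lt _ (fun i => by split <;> omega) n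

theorem exists_subset_range (S : Finset ℕ) (v : ℕ) : ∃ n, S ⊆ range n ∧ v < n :=
  ⟨S.sup id + v + 1, fun i hi => by
    have : i ≤ S.sup id := le_sup (f := id) hi
    rw [mem_range]; omega, by omega⟩

theorem code_digit (S : Finset ℕ) (v : ℕ) : code S / 3 ^ v % 3 = if v ∈ S then 1 else 0 := by
  obtain ⟨n, hS, hv⟩ := exists_subset_range S v
  rw [code_eq_sum_range hS]
  exact sum_digits_div_mod _ (fun i => by split <;> omega) hv

/-- Digitwise sums of two indicators are at most `2`, so there is no carry in base `3` and the
equation can be compared digit by digit. A digit `2` on the left, from a common element, matches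
nothing on the right. In base `2` this would fail. -/
theorem code_add_eq_iff {X Y Z : Finset ℕ} :
    code X + code Y = code Z ↔ Disjoint X Y ∧ X ∪ Y = Z := by
  constructor
  · intro h
    have key : ∀ v, (if v ∈ X then 1 else 0) + (if v ∈ Y then 1 else 0)
        = if v ∈ Z then 1 else 0 := by
      intro v
      obtain ⟨n, hS, hv⟩ := exists_subset_range (X ∪ Y ∪ Z) v
      have hX : X ⊆ range n := fun i hi => hS (by simp [hi])
      have hY : Y ⊆ range n := fun i hi => hS (by simp [hi])
      have hZ : Z ⊆ range n := fun i hi => hS (by simp [hi])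
      rw [code_eq_sum_range hX, code_eq_sum_range hY, code_eq_sum_range hZ,
        ← sum_add_distrib] at h
      simp only [← add_mul] at h
      have h1 := sum_digits_div_mod
        (fun v => (if v ∈ X then 1 else 0) + (if v ∈ Y then 1 else 0))
        (fun i => by split <;> split <;> omega) hv
      have h2 := sum_digits_div_mod (fun v => if v ∈ Z then 1 else 0)
        (fun i => by split <;> omega) hv
      rw [h, h2] at h1
      exact h1.symm
    constructor
    · rw [disjoint_left]
      intro v hX hY
      have := key v
      simp only [hX, hY, if_true] at this
      split at this <;> omega
    · ext v
      have := key v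
      rw [mem_union]
      by_cases hX : v ∈ X <;> by_cases hY : v ∈ Y <;> by_cases hZ : v ∈ Z <;>
        simp_all
  · rintro ⟨h, rfl⟩
    rw [code, code, code, sum_union h]

@[simp] theorem code_empty : code ∅ = 0 := by simp [code]

@[simp] theorem code_singleton (v : ℕ) : code {v} = 3 ^ v := by simp [code]

theorem code_injective : Function.Injective code := by
  intro X Y h
  have := (code_add_eq_iff (X := X) (Y := ∅) (Z := Y)).1 (by simpa using h)
  simpa using this.2

@[simp] theorem code_eq_zero {X : Finset ℕ} : code X = 0 ↔ X = ∅ := by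
  rw [← code_empty, code_injective.eq_iff]

theorem code_insert {X : Finset ℕ} {v : ℕ} (h : v ∉ X) : code (insert v X) = code X + 3 ^ v := by
  rw [code, sum_insert h, add_comm, code]

/-! ### The family of small sets that avoid a given set -/

/-- The sets of at most `R` numbers below `v`, none of them in `F`. -/
def famList (R : ℕ) (F : Finset ℕ) : ℕ → List (Finset ℕ)
  | 0 => [∅]
  | v + 1 => famList R F v ++
      if v ∈ F then [] else ((famList R F v).filter (fun X => X.card < R)).map (insert v)

/-- Every nonempty set in the list arises from inserting its largest element. Enumerating in this
way only ever visits members of the family. -/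
theorem mem_famList {R : ℕ} {F : Finset ℕ} {v : ℕ} {X : Finset ℕ} :
    X ∈ famList R F v ↔ X ⊆ range v ∧ Disjoint X F ∧ X.card ≤ R := by
  induction v generalizing X with
  | zero =>
    simp only [famList, List.mem_singleton, range_zero, subset_empty]
    constructor
    · rintro rfl; simp
    · exact fun h => h.1
  | succ v ih =>
    rw [famList, List.mem_append, ih]
    constructor
    · rintro (⟨h1, h2, h3⟩ | h)
      · exact ⟨h1.trans (range_mono (by omega)), h2, h3⟩
      · split_ifs at h with hv
        · simp at h
        · simp only [List.mem_map, List.mem_filter, decide_eq_true_eq] at h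
          obtain ⟨Y, ⟨hY, hc⟩, rfl⟩ := h
          obtain ⟨h1, h2, -⟩ := ih.1 hY
          refine ⟨?_, ?_, ?_⟩
          · rw [range_add_one]
            exact insert_subset_insert _ h1
          · rw [disjoint_insert_left]
            exact ⟨hv, h2⟩
          · exact (card_insert_le _ _).trans hc
    · rintro ⟨h1, h2, h3⟩
      by_cases hv : v ∈ X
      · right
        rw [if_neg (disjoint_left.1 h2 hv)]
        simp only [List.mem_map, List.mem_filter, decide_eq_true_eq]
        have hc := card_erase_of_mem hv
        have hp := card_pos.2 ⟨v, hv⟩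
        refine ⟨X.erase v, ⟨ih.2 ⟨?_, ?_, ?_⟩, ?_⟩, insert_erase hv⟩
        · intro i hi
          rw [mem_erase] at hi
          have := h1 hi.2
          rw [mem_range] at *
          omega
        · exact h2.mono_left (erase_subset _ _)
        · omega
        · omega
      · left
        refine ⟨fun i hi => ?_, h2, h3⟩
        have := h1 hi
        have : i ≠ v := fun h => hv (h ▸ hi)
        rw [mem_range] at *
        omega

theorem nodup_famList (R : ℕ) (F : Finset ℕ) (v : ℕ) : (famList R F v).Nodup := by
  induction v with
  | zero => simp [famList]
  | succ v ih =>
    rw [famList]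
    have hnot : ∀ X ∈ famList R F v, v ∉ X := fun X hX h => by
      simpa using (mem_famList.1 hX).1 h
    refine List.Nodup.append ih ?_ ?_
    · split_ifs
      · simp
      · refine List.Nodup.map_on ?_ (ih.filter _)
        intro X hX Y hY h
        have hX := hnot X (List.mem_filter.1 hX).1
        have hY := hnot Y (List.mem_filter.1 hY).1
        rw [← erase_insert hX, ← erase_insert hY, h]
    · intro X hX h
      split_ifs at h
      · simp at h
      · simp only [List.mem_map] at h
        obtain ⟨Y, -, rfl⟩ := h
        exact hnot _ hX (mem_insert_self _ _)

/-- `famList` as a set of sets. -/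
def fam (R : ℕ) (F : Finset ℕ) (v : ℕ) : Finset (Finset ℕ) := (famList R F v).toFinset

theorem mem_fam {R : ℕ} {F : Finset ℕ} {v : ℕ} {X : Finset ℕ} :
    X ∈ fam R F v ↔ X ⊆ range v ∧ Disjoint X F ∧ X.card ≤ R := by
  rw [fam, List.mem_toFinset, mem_famList]

theorem fam_mono {R : ℕ} {F : Finset ℕ} {v : ℕ} {X Y : Finset ℕ} (hY : Y ∈ fam R F v)
    (h : X ⊆ Y) : X ∈ fam R F v := by
  rw [mem_fam] at *
  exact ⟨h.trans hY.1, hY.2.1.mono_left h, (card_le_card h).trans hY.2.2⟩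

/-- The source of the binomial sum in the running time. -/
theorem length_famList_le (R : ℕ) (F : Finset ℕ) (v : ℕ) :
    (famList R F v).length ≤ chooseDown v R := by
  rw [← List.toFinset_card_of_nodup (nodup_famList R F v)]
  calc _ ≤ ((range (R + 1)).biUnion fun i => powersetCard i (range v)).card := by
        refine card_le_card fun X hX => ?_
        have := mem_fam.1 hX
        simp only [mem_biUnion, mem_range, mem_powersetCard]
        exact ⟨X.card, by omega, this.1, rfl⟩
    _ ≤ ∑ i ∈ range (R + 1), (powersetCard i (range v)).card := card_biUnion_le
    _ = chooseDown v R := by simp [chooseDown]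

theorem length_famList_mono (R : ℕ) (F : Finset ℕ) {v w : ℕ} (h : v ≤ w) :
    (famList R F v).length ≤ (famList R F w).length := by
  induction w, h using Nat.le_induction with
  | base => rfl
  | succ w _ ih => rw [famList, List.length_append]; omega

/-- A cruder bound, used only to see that the counter of the list fits into a memory cell. -/
theorem length_famList_le_two_pow (R : ℕ) (F : Finset ℕ) (v : ℕ) :
    (famList R F v).length ≤ 2 ^ v := by
  rw [← List.toFinset_card_of_nodup (nodup_famList R F v)]
  calc _ ≤ (range v).powerset.card :=
        card_le_card fun X hX => mem_powerset.2 (mem_fam.1 hX).1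
    _ = 2 ^ v := by simp

theorem sum_famList {A : Type*} [AddCommMonoid A] (R : ℕ) (F : Finset ℕ) (v : ℕ)
    (g : Finset ℕ → A) : ((famList R F v).map g).sum = ∑ X ∈ fam R F v, g X :=
  (List.sum_toFinset g (nodup_famList R F v)).symm

/-! ### Functions of codes -/

section OnCodes

variable {A : Type*}

/-- The function that sends `code X` to `g X` for `X` in the family `Fm`, and everything else
to `0`. -/
def onCodes [AddCommMonoid A] (Fm : Finset (Finset ℕ)) (g : Finset ℕ → A) (x : ℕ) : A :=
  ∑ X ∈ Fm, if code X = x then g X else 0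

theorem onCodes_code [AddCommMonoid A] (Fm : Finset (Finset ℕ)) (g : Finset ℕ → A)
    (X : Finset ℕ) : onCodes Fm g (code X) = if X ∈ Fm then g X else 0 := by
  simp only [onCodes, code_injective.eq_iff]
  rw [sum_ite_eq']

theorem onCodes_code_of_mem [AddCommMonoid A] {Fm : Finset (Finset ℕ)} (g : Finset ℕ → A)
    {X : Finset ℕ} (h : X ∈ Fm) : onCodes Fm g (code X) = g X := by
  rw [onCodes_code, if_pos h]

theorem onCodes_eq_zero [AddCommMonoid A] {Fm : Finset (Finset ℕ)} (g : Finset ℕ → A) {x : ℕ}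
    (h : ∀ X ∈ Fm, code X ≠ x) : onCodes Fm g x = 0 :=
  sum_eq_zero fun X hX => if_neg (h X hX)

/-- If `v` already lies in `X`, the sum has a ternary digit `2` and is no code at all. A table
lookup at this index thus yields exactly the optional summand in the recursion of `zeta`, with no
test of membership. -/
theorem onCodes_code_add_pow [AddCommMonoid A] (Fm : Finset (Finset ℕ)) (g : Finset ℕ → A)
    (X : Finset ℕ) (v : ℕ) : onCodes Fm g (code X + 3 ^ v) =
      if v ∉ X ∧ insert v X ∈ Fm then g (insert v X) else 0 := by
  by_cases hv : v ∈ X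
  · rw [if_neg (by simp [hv])]
    refine onCodes_eq_zero _ fun Y _ h => ?_
    rw [← code_singleton v] at h
    have := (code_add_eq_iff.1 h.symm).1
    simp [hv] at this
  · rw [← code_insert hv, onCodes_code]
    simp [hv]

/-- A difference that is the code of some `Y` satisfies `code Y + code S = code X`, which forces `S
⊆ X`. Hence the lookup itself decides the inclusion. The hypothesis `code S ≤ code X` excludes
truncation of the subtraction. -/
theorem onCodes_code_sub [AddCommMonoid A] {Fm : Finset (Finset ℕ)}
    (hFm : ∀ X Y, Y ∈ Fm → X ⊆ Y → X ∈ Fm) (g : Finset ℕ → A) {X S : Finset ℕ} (hX : X ∈ Fm)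
    (h : code S ≤ code X) : onCodes Fm g (code X - code S) =
      if S ⊆ X then g (X \ S) else 0 := by
  split_ifs with hS
  · have : code (X \ S) + code S = code X :=
      code_add_eq_iff.2 ⟨sdiff_disjoint, sdiff_union_of_subset hS⟩
    rw [← this, Nat.add_sub_cancel, onCodes_code_of_mem _ (hFm _ _ hX sdiff_subset)]
  · refine onCodes_eq_zero _ fun Y _ hY => hS ?_
    have : code Y + code S = code X := by omega
    rw [← (code_add_eq_iff.1 this).2]
    exact subset_union_right

theorem subset_of_code_le {X S : Finset ℕ} (h : S ⊆ X) : code S ≤ code X :=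
  sum_le_sum_of_subset h

end OnCodes

/-! ### The zeta transform and disjoint pairs -/

section Zeta

variable {A : Type*} [CommRing A]

/-- The superset sums of `f` in the family `Fm`, with respect to the numbers below `v`. -/
def zeta (Fm : Finset (Finset ℕ)) (f : Finset ℕ → A) : ℕ → Finset ℕ → A
  | 0, X => f X
  | v + 1, X => zeta Fm f v X +
      if v ∉ X ∧ insert v X ∈ Fm then zeta Fm f v (insert v X) else 0

/-- In the inductive step the sets `Y` that may differ from `X` at `v` are split according to
whether `v ∈ Y`. If `insert v X` is outside the family, closure under subsets shows that no member
contains it, so leaving out the second summand loses nothing. -/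
theorem zeta_eq_sum {Fm : Finset (Finset ℕ)} (hFm : ∀ X Y, Y ∈ Fm → X ⊆ Y → X ∈ Fm)
    (f : Finset ℕ → A) (v : ℕ) {X : Finset ℕ} (hX : X ∈ Fm) :
    zeta Fm f v X = ∑ Y ∈ Fm, if X ⊆ Y ∧ Y \ X ⊆ range v then f Y else 0 := by
  induction v generalizing X with
  | zero =>
    rw [zeta, sum_eq_single X]
    · simp
    · intro Y _ hYX
      rw [if_neg]
      rintro ⟨h1, h2⟩
      rw [range_zero, subset_empty, sdiff_eq_empty_iff_subset] at h2
      exact hYX (h2.antisymm h1)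
    · exact fun h => absurd hX h
  | succ v ih =>
    rw [zeta, ih hX]
    split_ifs with h
    · rw [ih h.2, ← sum_add_distrib]
      refine sum_congr rfl fun Y hY => ?_
      by_cases hXY : X ⊆ Y
      · by_cases hv : v ∈ Y
        · have h1 : ¬ (Y \ X ⊆ range v) := fun h' => by
            simpa using h' (mem_sdiff.2 ⟨hv, h.1⟩)
          have h2 : insert v X ⊆ Y := insert_subset hv hXY
          have h3 : Y \ insert v X ⊆ range v ↔ Y \ X ⊆ range (v + 1) := by
            simp only [subset_iff, mem_sdiff, mem_insert, mem_range, not_or]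
            constructor
            · intro H i hi
              by_cases hiv : i = v
              · omega
              · have := H ⟨hi.1, hiv, hi.2⟩
                omega
            · intro H i hi
              have := H ⟨hi.1, hi.2.2⟩
              have := hi.2.1
              omega
          simp only [hXY, h1, h2, h3, true_and, if_false, zero_add]
        · have h2 : ¬ insert v X ⊆ Y := fun h' => hv (h' (mem_insert_self _ _))
          have h3 : Y \ X ⊆ range v ↔ Y \ X ⊆ range (v + 1) := by
            refine ⟨fun H => H.trans (range_mono (by omega)), fun H i hi => ?_⟩
            have h4 := H hi
            have : i ≠ v := fun h' => hv (h' ▸ (mem_sdiff.1 hi).1)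
            rw [mem_range] at *
            omega
          simp only [hXY, h2, h3, true_and, false_and, if_false, add_zero]
      · have h2 : ¬ insert v X ⊆ Y := fun h' => hXY ((subset_insert _ _).trans h')
        simp only [hXY, h2, false_and, if_false, add_zero]
    · rw [add_zero]
      refine sum_congr rfl fun Y hY => ?_
      refine if_congr (and_congr_right fun hXY => ?_) rfl rfl
      refine ⟨fun H => H.trans (range_mono (by omega)), fun H i hi => ?_⟩
      have h4 := H hi
      have : i ≠ v := by
        rintro rfl
        rw [mem_sdiff] at hi
        exact h ⟨hi.2, hFm _ _ hY (insert_subset hi.1 hXY)⟩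
      rw [mem_range] at *
      omega

theorem zeta_eq_sum_of_subset_range {Fm : Finset (Finset ℕ)} {n : ℕ}
    (hFm : ∀ X Y, Y ∈ Fm → X ⊆ Y → X ∈ Fm) (hn : ∀ X ∈ Fm, X ⊆ range n)
    (f : Finset ℕ → A) {X : Finset ℕ} (hX : X ∈ Fm) :
    zeta Fm f n X = ∑ Y ∈ Fm, if X ⊆ Y then f Y else 0 := by
  rw [zeta_eq_sum hFm f n hX]
  refine sum_congr rfl fun Y hY => if_congr ?_ rfl rfl
  exact ⟨And.left, fun h => ⟨h, sdiff_subset.trans (hn Y hY)⟩⟩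

/-- After expanding and exchanging sums, the pair `Y, Z` has the coefficient `∑_{X ⊆ Y ∩ Z}
(-1)^|X|`, which is `1` or `0` according to whether `Y ∩ Z` is empty. Closure under subsets
guarantees that all these `X` occur in the family. -/
theorem sum_zeta_mul_zeta {Fm : Finset (Finset ℕ)} {n : ℕ}
    (hFm : ∀ X Y, Y ∈ Fm → X ⊆ Y → X ∈ Fm) (hn : ∀ X ∈ Fm, X ⊆ range n)
    (f g : Finset ℕ → A) :
    ∑ X ∈ Fm, (-1) ^ X.card * zeta Fm f n X * zeta Fm g n X =
      ∑ Y ∈ Fm, ∑ Z ∈ Fm, if Disjoint Y Z then f Y * g Z else 0 := by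
  have h1 : ∀ X ∈ Fm, (-1) ^ X.card * zeta Fm f n X * zeta Fm g n X =
      ∑ Y ∈ Fm, ∑ Z ∈ Fm, if X ⊆ Y ∩ Z then (-1) ^ X.card * (f Y * g Z) else 0 := by
    intro X hX
    rw [zeta_eq_sum_of_subset_range hFm hn f hX, zeta_eq_sum_of_subset_range hFm hn g hX,
      mul_assoc, sum_mul_sum, mul_sum]
    refine sum_congr rfl fun Y _ => ?_
    rw [mul_sum]
    refine sum_congr rfl fun Z _ => ?_
    by_cases hY : X ⊆ Y <;> by_cases hZ : X ⊆ Z <;> simp [subset_inter_iff, hY, hZ]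
  rw [sum_congr rfl h1, sum_comm]
  refine sum_congr rfl fun Y hY => ?_
  rw [sum_comm]
  refine sum_congr rfl fun Z hZ => ?_
  rw [← sum_filter, ← sum_mul]
  have h2 : Fm.filter (fun X => X ⊆ Y ∩ Z) = (Y ∩ Z).powerset := by
    ext X
    simp only [mem_filter, mem_powerset]
    exact ⟨And.right, fun h => ⟨hFm _ _ hY (h.trans inter_subset_left), h⟩⟩
  have h3 : ∑ X ∈ (Y ∩ Z).powerset, (-1 : A) ^ X.card = if Y ∩ Z = ∅ then 1 else 0 := by
    have := congrArg (Int.cast : ℤ → A) (sum_powerset_neg_one_pow_card (x := Y ∩ Z))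
    push_cast at this
    exact this
  rw [h2, h3]
  simp [disjoint_iff_inter_eq_empty]

end Zeta

/-! ### Matchings and chains -/

section Chains

variable {α : Type*}

/-- Indices with distinct keys and disjoint sets. -/
def Ok (key : ℕ → α) (mu : ℕ → Finset ℕ) (P : Finset ℕ) : Prop :=
  ∀ c ∈ P, ∀ d ∈ P, c ≠ d → key c ≠ key d ∧ Disjoint (mu c) (mu d)

theorem Ok.subset {key : ℕ → α} {mu : ℕ → Finset ℕ} {P P' : Finset ℕ} (h : Ok key mu P)
    (hP : P' ⊆ P) : Ok key mu P' :=
  fun c hc d hd => h c (hP hc) d (hP hd)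

theorem Ok.insert {key : ℕ → α} {mu : ℕ → Finset ℕ} {P : Finset ℕ} {c : ℕ} (h : Ok key mu P)
    (hk : ∀ d ∈ P, key d ≠ key c) (hm : ∀ d ∈ P, Disjoint (mu d) (mu c)) :
    Ok key mu (insert c P) := by
  intro x hx y hy hxy
  rw [mem_insert] at hx hy
  rcases hx with rfl | hx <;> rcases hy with rfl | hy
  · exact absurd rfl hxy
  · exact ⟨(hk _ hy).symm, (hm _ hy).symm⟩
  · exact ⟨hk _ hx, hm _ hx⟩
  · exact h _ hx _ hy hxy

variable [LinearOrder α]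

/-- The number of chains `c > c₁ > c₂ > ⋯` of `j` further indices below `q`, with
decreasing keys, whose sets are disjoint and have union `X`. -/
def chainCount (key : ℕ → α) (mu : ℕ → Finset ℕ) (q : ℕ) : ℕ → ℕ → Finset ℕ → ℕ
  | 0, _, X => if X = ∅ then 1 else 0
  | j + 1, c, X => ∑ d ∈ range q,
      if key d < key c ∧ mu d ⊆ X then chainCount key mu q j d (X \ mu d) else 0

open Classical in
/-- The sets of `j` compatible indices with keys below the key of `c`, whose sets have
union `X`. -/
noncomputable def chainSets (key : ℕ → α) (mu : ℕ → Finset ℕ) (q j c : ℕ) (X : Finset ℕ) :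
    Finset (Finset ℕ) :=
  (range q).powerset.filter fun P =>
    P.card = j ∧ Ok key mu P ∧ (∀ p ∈ P, key p < key c) ∧ P.biUnion mu = X

theorem mem_chainSets {key : ℕ → α} {mu : ℕ → Finset ℕ} {q j c : ℕ} {X P : Finset ℕ} :
    P ∈ chainSets key mu q j c X ↔ P ⊆ range q ∧ P.card = j ∧ Ok key mu P ∧
      (∀ p ∈ P, key p < key c) ∧ P.biUnion mu = X := by
  simp [chainSets]

/-- Compatible indices have distinct keys, so a set of them can be listed by decreasing key in one
way only. The recursion peels off the index of largest key; removing its mask from `X` makes the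
later masks disjoint from it. -/
theorem chainCount_eq_card (key : ℕ → α) (mu : ℕ → Finset ℕ) (q j c : ℕ) (X : Finset ℕ) :
    chainCount key mu q j c X = (chainSets key mu q j c X).card := by
  induction j generalizing c X with
  | zero =>
    rw [chainCount]
    split_ifs with h
    · symm
      rw [card_eq_one]
      refine ⟨∅, ?_⟩
      ext P
      rw [mem_chainSets, mem_singleton, card_eq_zero]
      constructor
      · exact fun h => h.2.1
      · rintro rfl
        simp [Ok, h]
    · symm
      rw [card_eq_zero, eq_empty_iff_forall_notMem]
      intro P hP
      rw [mem_chainSets, card_eq_zero] at hP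
      obtain ⟨-, rfl, -, -, h2⟩ := hP
      exact h (by simpa using h2.symm)
  | succ j ih =>
    rw [chainCount]
    have hU : chainSets key mu q (j + 1) c X = (range q).biUnion fun d =>
        if key d < key c ∧ mu d ⊆ X then (chainSets key mu q j d (X \ mu d)).image (insert d)
        else ∅ := by
      ext P
      rw [mem_biUnion, mem_chainSets]
      constructor
      · rintro ⟨h1, h2, h3, h4, h5⟩
        -- The first link of the chain is the index with the largest key.
        obtain ⟨d, hd, hmax⟩ := exists_max_image P key (card_pos.1 (by omega))
        refine ⟨d, h1 hd, ?_⟩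
        have hs : mu d ⊆ X := h5 ▸ subset_biUnion_of_mem mu hd
        rw [if_pos ⟨h4 d hd, hs⟩, mem_image]
        refine ⟨P.erase d, mem_chainSets.2 ⟨(erase_subset _ _).trans h1, ?_,
          h3.subset (erase_subset _ _), ?_, ?_⟩, insert_erase hd⟩
        · rw [card_erase_of_mem hd]; omega
        · intro p hp
          rw [mem_erase] at hp
          exact lt_of_le_of_ne (hmax p hp.2) (h3 p hp.2 d hd hp.1).1
        · ext x
          rw [← h5]
          simp only [mem_biUnion, mem_erase, mem_sdiff]
          constructor
          · rintro ⟨p, ⟨hp1, hp2⟩, hx⟩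
            exact ⟨⟨p, hp2, hx⟩, disjoint_left.1 (h3 p hp2 d hd hp1).2 hx⟩
          · rintro ⟨⟨p, hp, hx⟩, hx'⟩
            exact ⟨p, ⟨fun h => hx' (h ▸ hx), hp⟩, hx⟩
      · rintro ⟨d, hd, h⟩
        split_ifs at h with hc
        · rw [mem_image] at h
          obtain ⟨P', hP', rfl⟩ := h
          obtain ⟨h1, h2, h3, h4, h5⟩ := mem_chainSets.1 hP'
          have hdP : d ∉ P' := fun h => lt_irrefl _ (h4 d h)
          refine ⟨insert_subset hd h1, ?_, h3.insert (fun p hp => (h4 p hp).ne) ?_, ?_, ?_⟩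
          · rw [card_insert_of_notMem hdP, h2]
          · intro p hp
            have : mu p ⊆ X \ mu d := h5 ▸ subset_biUnion_of_mem mu hp
            exact disjoint_sdiff_self_left.mono_left this
          · intro p hp
            rw [mem_insert] at hp
            rcases hp with rfl | hp
            · exact hc.1
            · exact (h4 p hp).trans hc.1
          · rw [biUnion_insert, h5, union_sdiff_of_subset hc.2]
        · simp at h
    rw [hU, card_biUnion]
    · refine sum_congr rfl fun d _ => ?_
      split_ifs with h
      · rw [ih, card_image_of_injOn]
        intro P hP P' hP' h
        have h1 : d ∉ P := fun h => lt_irrefl _ ((mem_chainSets.1 hP).2.2.2.1 d h)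
        have h2 : d ∉ P' := fun h => lt_irrefl _ ((mem_chainSets.1 hP').2.2.2.1 d h)
        rw [← erase_insert h1, ← erase_insert h2, h]
      · rfl
    · intro d _ d' _ hdd
      rw [Function.onFun, disjoint_left]
      intro P hP hP'
      -- The pieces for different `d` are disjoint because `d` can be recovered from `P` as its
      -- index of largest key.
      have aux : ∀ e, P ∈ (if key e < key c ∧ mu e ⊆ X then
          (chainSets key mu q j e (X \ mu e)).image (Insert.insert e) else ∅) →
          e ∈ P ∧ ∀ p ∈ P, p ≠ e → key p < key e := by
        intro e he
        split_ifs at he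
        · obtain ⟨P', h', rfl⟩ := mem_image.1 he
          refine ⟨mem_insert_self _ _, fun p hp hpe => ?_⟩
          exact (mem_chainSets.1 h').2.2.2.1 p ((mem_insert.1 hp).resolve_left hpe)
        · simp at he
      have h1 := aux d hP
      have h2 := aux d' hP'
      exact lt_asymm (h1.2 d' h2.1 hdd.symm) (h2.2 d h1.1 hdd)

/-- With distinct keys exactly one element has rank `a`, provided `a < |P|`. Inserting a new maximum
leaves the ranks of the others alone and contributes the rank `|P|`. -/
theorem sum_card_filter_lt (key : ℕ → α) (a : ℕ) (P : Finset ℕ)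
    (hP : Set.InjOn key P) :
    ∑ c ∈ P, (if (P.filter fun p => key p < key c).card = a then 1 else 0) =
      if a < P.card then 1 else 0 := by
  induction P using Finset.induction_on_max_value key with
  | empty => simp
  | insert c P hc hmax ih =>
    have hlt : ∀ p ∈ P, key p < key c := fun p hp => lt_of_le_of_ne (hmax p hp) fun h =>
      hc (hP (by simp [hp]) (by simp) h ▸ hp)
    rw [sum_insert hc, card_insert_of_notMem hc]
    have h1 : (Insert.insert c P).filter (fun p => key p < key c) = P := by
      ext p
      simp only [mem_filter, mem_insert]
      constructor
      · rintro ⟨rfl | h, h'⟩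
        · exact absurd h' (lt_irrefl _)
        · exact h
      · exact fun h => ⟨Or.inr h, hlt p h⟩
    have h2 : ∀ d ∈ P, (Insert.insert c P).filter (fun p => key p < key d) =
        P.filter fun p => key p < key d := by
      intro d hd
      rw [filter_insert, if_neg (not_lt_of_gt (hlt d hd))]
    rw [h1, sum_congr rfl fun d hd => by rw [h2 d hd],
      ih (hP.mono (by simp))]
    split_ifs <;> omega

end Chains

/-! ### Splitting a matching at its middle tuple -/

section Count

open Classical in
/-- The sets of `k` compatible indices below `q`. -/
noncomputable def okSets {α : Type*} [LinearOrder α] (key : ℕ → α) (mu : ℕ → Finset ℕ)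
    (q k : ℕ) : Finset (Finset ℕ) :=
  (range q).powerset.filter fun P => P.card = k ∧ Ok key mu P

theorem mem_okSets {α : Type*} [LinearOrder α] {key : ℕ → α} {mu : ℕ → Finset ℕ}
    {q k : ℕ} {P : Finset ℕ} :
    P ∈ okSets key mu q k ↔ P ⊆ range q ∧ P.card = k ∧ Ok key mu P := by
  simp [okSets]

theorem card_biUnion_le_mul {mu : ℕ → Finset ℕ} {P : Finset ℕ} {d : ℕ}
    (h : ∀ p ∈ P, (mu p).card ≤ d) : (P.biUnion mu).card ≤ P.card * d :=
  card_biUnion_le_card_mul _ _ _ h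

/-- Split a set of compatible indices at the index `c` with exactly `a` smaller keys. -/
theorem card_okSets_split {q n R d a b : ℕ} (key : ℕ → ℕ) (mu : ℕ → Finset ℕ)
    (hmu : ∀ c < q, mu c ⊆ range n) (hcard : ∀ c < q, (mu c).card ≤ d)
    (ha : a * d ≤ R) (hb : b * d ≤ R) {c : ℕ} (hc : c < q) :
    ((okSets key mu q (a + 1 + b)).filter fun P =>
        c ∈ P ∧ (P.filter fun p => key p < key c).card = a).card =
      ∑ X ∈ fam R (mu c) n, ∑ Y ∈ fam R (mu c) n,
        if Disjoint X Y then chainCount key mu q a c X *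
          chainCount (fun i => OrderDual.toDual (key i)) mu q b c Y else 0 := by
  classical
  have hfam : ∀ {P : Finset ℕ} {e : ℕ}, P ⊆ range q → P.card = e → e * d ≤ R →
      (∀ p ∈ P, Disjoint (mu p) (mu c)) → P.biUnion mu ∈ fam R (mu c) n := by
    intro P e h1 h2 h3 h4
    refine mem_fam.2 ⟨?_, ?_, ?_⟩
    · exact biUnion_subset.2 fun p hp => hmu p (mem_range.1 (h1 hp))
    · rw [disjoint_biUnion_left]
      exact h4
    · refine (card_biUnion_le_mul fun p hp => hcard p (mem_range.1 (h1 hp))).trans ?_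
      rw [h2]; exact h3
  let Lo : Finset ℕ → Finset (Finset ℕ) := chainSets key mu q a c
  let Hi : Finset ℕ → Finset (Finset ℕ) :=
    chainSets (fun i => OrderDual.toDual (key i)) mu q b c
  have hR : ∑ X ∈ fam R (mu c) n, ∑ Y ∈ fam R (mu c) n,
        (if Disjoint X Y then chainCount key mu q a c X *
          chainCount (fun i => OrderDual.toDual (key i)) mu q b c Y else 0) =
      ∑ z ∈ (fam R (mu c) n ×ˢ fam R (mu c) n).filter fun z => Disjoint z.1 z.2,
        (Lo z.1 ×ˢ Hi z.2).card := by
    rw [sum_filter, sum_product]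
    refine sum_congr rfl fun X _ => sum_congr rfl fun Y _ => ?_
    rw [chainCount_eq_card, chainCount_eq_card, card_product]
  rw [hR, ← card_sigma]
  -- The two unions are determined by the two halves of `P`; recording them as the first component
  -- of the sigma type is what turns the count into a sum over disjoint pairs `X, Y`.
  refine card_bij'
    (fun P _ => ⟨((P.filter fun p => key p < key c).biUnion mu,
        (P.filter fun p => key c < key p).biUnion mu),
      (P.filter fun p => key p < key c, P.filter fun p => key c < key p)⟩)
    (fun z _ => insert c (z.2.1 ∪ z.2.2)) ?_ ?_ ?_ ?_
  · intro P hP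
    simp only [mem_filter, mem_okSets] at hP
    obtain ⟨⟨h1, h2, h3⟩, h4, h5⟩ := hP
    have hsplit : P = insert c ((P.filter fun p => key p < key c) ∪
        P.filter fun p => key c < key p) := by
      ext p
      simp only [mem_insert, mem_union, mem_filter]
      constructor
      · intro hp
        by_cases hpc : p = c
        · exact Or.inl hpc
        · rcases lt_or_gt_of_ne (h3 p hp c h4 hpc).1 with h | h
          · exact Or.inr (Or.inl ⟨hp, h⟩)
          · exact Or.inr (Or.inr ⟨hp, h⟩)
      · rintro (rfl | h | h)
        · exact h4
        · exact h.1
        · exact h.1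
    have hdisj : Disjoint (P.filter fun p => key p < key c)
        (P.filter fun p => key c < key p) := by
      rw [disjoint_left]
      intro p hp hp'
      exact lt_asymm (mem_filter.1 hp).2 (mem_filter.1 hp').2
    have hb' : (P.filter fun p => key c < key p).card = b := by
      have := congrArg Finset.card hsplit
      rw [card_insert_of_notMem (by simp), card_union_of_disjoint hdisj] at this
      omega
    have hlo : ∀ p ∈ P.filter (fun p => key p < key c), Disjoint (mu p) (mu c) := by
      intro p hp
      rw [mem_filter] at hp
      exact (h3 p hp.1 c h4 (fun h => by simp [h] at hp)).2
    have hhi : ∀ p ∈ P.filter (fun p => key c < key p), Disjoint (mu p) (mu c) := by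
      intro p hp
      rw [mem_filter] at hp
      exact (h3 p hp.1 c h4 (fun h => by simp [h] at hp)).2
    have hsub1 := filter_subset (fun p => key p < key c) P
    have hsub2 := filter_subset (fun p => key c < key p) P
    simp only [mem_sigma, mem_filter, mem_product]
    refine ⟨⟨⟨hfam (hsub1.trans h1) h5 ha hlo, hfam (hsub2.trans h1) hb' hb hhi⟩, ?_⟩,
      mem_chainSets.2 ⟨hsub1.trans h1, h5, h3.subset hsub1, ?_, rfl⟩,
      mem_chainSets.2 ⟨hsub2.trans h1, hb', ?_, ?_, rfl⟩⟩
    · rw [disjoint_biUnion_left]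
      intro p hp
      rw [disjoint_biUnion_right]
      intro p' hp'
      rw [mem_filter] at hp hp'
      exact (h3 p hp.1 p' hp'.1 (by rintro rfl; exact lt_asymm hp.2 hp'.2)).2
    · exact fun p hp => (mem_filter.1 hp).2
    · exact fun x hx y hy hxy => h3 x (hsub2 hx) y (hsub2 hy) hxy
    · exact fun p hp => (mem_filter.1 hp).2
  · rintro ⟨⟨X, Y⟩, P, P'⟩ hz
    simp only [mem_sigma, mem_filter, mem_product] at hz
    obtain ⟨⟨⟨hX, hY⟩, hXY⟩, hP, hP'⟩ := hz
    obtain ⟨h1, h2, h3, h4, rfl⟩ := mem_chainSets.1 hP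
    obtain ⟨h1', h2', h3', h4', rfl⟩ := mem_chainSets.1 hP'
    replace h4' : ∀ p ∈ P', key c < key p := h4'
    have hmc : ∀ p ∈ P, Disjoint (mu p) (mu c) := by
      have := (mem_fam.1 hX).2.1
      rwa [disjoint_biUnion_left] at this
    have hmc' : ∀ p ∈ P', Disjoint (mu p) (mu c) := by
      have := (mem_fam.1 hY).2.1
      rwa [disjoint_biUnion_left] at this
    have hPP : ∀ p ∈ P, ∀ p' ∈ P', Disjoint (mu p) (mu p') := by
      intro p hp p' hp'
      exact hXY.mono (subset_biUnion_of_mem mu hp) (subset_biUnion_of_mem mu hp')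
    have hdisj : Disjoint P P' := by
      rw [disjoint_left]
      exact fun p hp hp' => lt_asymm (h4 p hp) (h4' p hp')
    have hc1 : c ∉ P ∪ P' := by
      rw [mem_union]
      rintro (h | h)
      · exact lt_irrefl _ (h4 c h)
      · exact lt_irrefl _ (h4' c h)
    simp only [mem_filter, mem_okSets]
    refine ⟨⟨insert_subset (mem_range.2 hc) (union_subset h1 h1'), ?_, Ok.insert ?_ ?_ ?_⟩,
      mem_insert_self _ _, ?_⟩
    · rw [card_insert_of_notMem hc1, card_union_of_disjoint hdisj]; omega
    · intro x hx y hy hxy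
      rw [mem_union] at hx hy
      rcases hx with hx | hx <;> rcases hy with hy | hy
      · exact h3 x hx y hy hxy
      · exact ⟨((h4 x hx).trans (h4' y hy)).ne, hPP x hx y hy⟩
      · exact ⟨((h4 y hy).trans (h4' x hx)).ne', (hPP y hy x hx).symm⟩
      · exact h3' x hx y hy hxy
    · intro p hp
      rcases mem_union.1 hp with hp | hp
      · exact (h4 p hp).ne
      · exact (h4' p hp).ne'
    · intro p hp
      rcases mem_union.1 hp with hp | hp
      · exact hmc p hp
      · exact hmc' p hp
    · rw [← h2]
      congr 1
      ext p
      simp only [mem_filter, mem_insert, mem_union]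
      constructor
      · rintro ⟨rfl | h | h, h'⟩
        · exact absurd h' (lt_irrefl _)
        · exact h
        · exact absurd h' (lt_asymm (h4' p h))
      · exact fun h => ⟨Or.inr (Or.inl h), h4 p h⟩
  · intro P hP
    simp only [mem_filter, mem_okSets] at hP
    obtain ⟨⟨h1, h2, h3⟩, h4, h5⟩ := hP
    ext p
    simp only [mem_insert, mem_union, mem_filter]
    constructor
    · rintro (rfl | h | h)
      · exact h4
      · exact h.1
      · exact h.1
    · intro hp
      by_cases hpc : p = c
      · exact Or.inl hpc
      · rcases lt_or_gt_of_ne (h3 p hp c h4 hpc).1 with h | h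
        · exact Or.inr (Or.inl ⟨hp, h⟩)
        · exact Or.inr (Or.inr ⟨hp, h⟩)
  · rintro ⟨⟨X, Y⟩, P, P'⟩ hz
    simp only [mem_sigma, mem_filter, mem_product] at hz
    obtain ⟨-, hP, hP'⟩ := hz
    obtain ⟨-, -, -, h4, rfl⟩ := mem_chainSets.1 hP
    obtain ⟨-, -, -, h4', rfl⟩ := mem_chainSets.1 hP'
    replace h4' : ∀ p ∈ P', key c < key p := h4'
    have e1 : (insert c (P ∪ P')).filter (fun p => key p < key c) = P := by
      ext p
      simp only [mem_filter, mem_insert, mem_union]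
      constructor
      · rintro ⟨rfl | h | h, h'⟩
        · exact absurd h' (lt_irrefl _)
        · exact h
        · exact absurd h' (lt_asymm (h4' p h))
      · exact fun h => ⟨Or.inr (Or.inl h), h4 p h⟩
    have e2 : (insert c (P ∪ P')).filter (fun p => key c < key p) = P' := by
      ext p
      simp only [mem_filter, mem_insert, mem_union]
      constructor
      · rintro ⟨rfl | h | h, h'⟩
        · exact absurd h' (lt_irrefl _)
        · exact absurd h' (lt_asymm (h4 p h))
        · exact h
      · exact fun h => ⟨Or.inr (Or.inr h), h4' p h⟩
    simp only [e1, e2]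

/-- Each matching is counted for exactly one `c`, its element of rank `a`. -/
theorem card_okSets {q n R d a b : ℕ} (key : ℕ → ℕ) (mu : ℕ → Finset ℕ)
    (hmu : ∀ c < q, mu c ⊆ range n) (hcard : ∀ c < q, (mu c).card ≤ d)
    (ha : a * d ≤ R) (hb : b * d ≤ R) :
    (okSets key mu q (a + 1 + b)).card =
      ∑ c ∈ range q, ∑ X ∈ fam R (mu c) n, ∑ Y ∈ fam R (mu c) n,
        if Disjoint X Y then chainCount key mu q a c X *
          chainCount (fun i => OrderDual.toDual (key i)) mu q b c Y else 0 := by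
  rw [← sum_congr rfl fun c hc =>
    card_okSets_split key mu hmu hcard ha hb (mem_range.1 hc)]
  simp only [card_filter]
  rw [sum_comm, card_eq_sum_ones]
  refine sum_congr rfl fun P hP => ?_
  obtain ⟨h1, h2, h3⟩ := mem_okSets.1 hP
  have hinj : Set.InjOn key P := fun x hx y hy h => by
    by_contra hne
    exact (h3 x hx y hy hne).1 h
  have := sum_card_filter_lt key a P hinj
  rw [if_pos (by omega)] at this
  refine this.symm.trans ?_
  rw [← sum_subset h1]
  · refine sum_congr rfl fun c hc => ?_
    simp [hc]
  · intro c _ hc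
    simp [hc]

end Count

/-! ### The costs of terms -/

section TermCost

open RAM

/-- A measure for the size of a term, which also bounds its constants. -/
def termSize : Term → ℕ
  | .lit c => c + 1
  | .input a => termSize a + 1
  | .cell a => termSize a + 1
  | .add a b => termSize a + termSize b + 1
  | .sub a b => termSize a + termSize b + 1
  | .mul a b => termSize a + termSize b + 1
  | .div a b => termSize a + termSize b + 1

theorem termSize_pos (t : Term) : 1 ≤ termSize t := by
  cases t <;> simp [termSize]

variable {inp : List ℕ} {M : Mem} {b : ℕ}

/-- Each operation at most adds the bit lengths of its operands, plus one. Intermediate values, in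
particular addresses, may therefore exceed the bound for stored numbers, but only by a factor in
length that depends on the term alone. -/
theorem val_lt (hb : 1 ≤ b) (hinp : ∀ x ∈ inp, x < 2 ^ b) (hM : ∀ x, M x < 2 ^ b) (t : Term) :
    t.val inp M < 2 ^ (b * termSize t) := by
  have mono : ∀ {x y z : ℕ}, x < 2 ^ (b * y) → y ≤ z → x < 2 ^ (b * z) := fun h hyz =>
    h.trans_le (Nat.pow_le_pow_right (by omega) (Nat.mul_le_mul_left _ hyz))
  induction t with
  | lit c =>
    calc c < 2 ^ c := Nat.lt_two_pow_self
      _ ≤ 2 ^ (b * (c + 1)) := Nat.pow_le_pow_right (by omega) (by nlinarith)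
  | input a _ =>
    refine mono (y := 1) ?_ (by simp [termSize])
    rw [mul_one, Term.val, List.getD_eq_getElem?_getD]
    cases h : inp[a.val inp M]? with
    | none => simp
    | some x => exact hinp x (List.mem_of_getElem? h)
  | cell a _ =>
    refine mono (y := 1) ?_ (by simp [termSize])
    rw [mul_one]
    exact hM _
  | add x y hx hy =>
    have h1 : 2 ^ (b * termSize x) ≤ 2 ^ (b * (termSize x + termSize y)) :=
      Nat.pow_le_pow_right (by omega) (Nat.mul_le_mul_left _ (by omega))
    have h2 : 2 ^ (b * termSize y) ≤ 2 ^ (b * (termSize x + termSize y)) :=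
      Nat.pow_le_pow_right (by omega) (Nat.mul_le_mul_left _ (by omega))
    have h3 : 2 ^ (b * (termSize x + termSize y) + 1) ≤
        2 ^ (b * (termSize x + termSize y + 1)) :=
      Nat.pow_le_pow_right (by omega) (by nlinarith)
    rw [pow_succ] at h3
    simp only [Term.val, termSize]
    omega
  | sub x y hx _ =>
    exact mono ((Nat.sub_le _ _).trans_lt hx) (by simp [termSize]; omega)
  | mul x y hx hy =>
    refine mono (y := termSize x + termSize y) ?_ (by simp [termSize])
    rw [mul_add, pow_add]
    exact Nat.mul_lt_mul'' hx hy
  | div x y hx _ =>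
    exact mono ((Nat.div_le_self _ _).trans_lt hx) (by simp [termSize]; omega)

theorem bitCost_val_le (hb : 1 ≤ b) (hinp : ∀ x ∈ inp, x < 2 ^ b) (hM : ∀ x, M x < 2 ^ b)
    (t : Term) : bitCost (t.val inp M) ≤ b * termSize t + 1 :=
  Nat.succ_le_succ (Nat.size_le.2 (val_lt hb hinp hM t))

/-- There are at most `termSize t` subterms, each of cost at most about `b * termSize t`; hence the
square. The induction rests on `x² + y² + (x + y + 1) ≤ (x + y + 1)²`. -/
theorem cost_le (hb : 1 ≤ b) (hinp : ∀ x ∈ inp, x < 2 ^ b) (hM : ∀ x, M x < 2 ^ b) (t : Term) :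
    t.cost inp M ≤ termSize t ^ 2 * (b + 1) := by
  have h0 := fun t => bitCost_val_le hb hinp hM t
  have h2 : ∀ {x y c d e : ℕ}, c ≤ x ^ 2 * (b + 1) → d ≤ y ^ 2 * (b + 1) →
      e ≤ b * (x + y + 1) + 1 → 1 ≤ x → 1 ≤ y → c + d + e ≤ (x + y + 1) ^ 2 * (b + 1) := by
    intro x y c d e hc hd he hx hy
    have h1 : b * (x + y + 1) + 1 ≤ (x + y + 1) * (b + 1) := by nlinarith
    have h2 : x ^ 2 + y ^ 2 + (x + y + 1) ≤ (x + y + 1) ^ 2 := by nlinarith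
    nlinarith [Nat.mul_le_mul_right (b + 1) h2]
  have h1 : ∀ {x c e : ℕ}, c ≤ x ^ 2 * (b + 1) → e ≤ b * (x + 1) + 1 →
      c + e ≤ (x + 1) ^ 2 * (b + 1) := by
    intro x c e hc he
    have h1 : b * (x + 1) + 1 ≤ (x + 1) * (b + 1) := by nlinarith
    have h2 : x ^ 2 + (x + 1) ≤ (x + 1) ^ 2 := by nlinarith
    nlinarith [Nat.mul_le_mul_right (b + 1) h2]
  induction t with
  | lit c =>
    have := h0 (.lit c)
    have := h1 (x := c) (c := 0) (by omega) this
    rwa [zero_add] at this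
  | input a ih => exact h1 ih (h0 (.input a))
  | cell a ih => exact h1 ih (h0 (.cell a))
  | add x y hx hy => exact h2 hx hy (h0 (.add x y)) (termSize_pos _) (termSize_pos _)
  | sub x y hx hy => exact h2 hx hy (h0 (.sub x y)) (termSize_pos _) (termSize_pos _)
  | mul x y hx hy => exact h2 hx hy (h0 (.mul x y)) (termSize_pos _) (termSize_pos _)
  | div x y hx hy => exact h2 hx hy (h0 (.div x y)) (termSize_pos _) (termSize_pos _)

end TermCost

/-! ### A language with named arrays and bounded loops -/

/-- The arrays of the program; a register is an array of which only the entry `0` is used. -/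
inductive Var : Type
  | out | m | k | p | n | cur | i | len | l | q | acc | W | B | a | b | r | c0 | cnt | old | u
  | j | c | d | WT | PW | KEY | MU | LIST | LSZ | LS | T1 | T2 | Z1 | Z2
  deriving DecidableEq

/-- The number of an array. -/
def Var.idx : Var → ℕ
  | out => 0 | m => 1 | k => 2 | p => 3 | n => 4 | cur => 5 | i => 6 | len => 7 | l => 8
  | q => 9 | acc => 10 | W => 11 | B => 12 | a => 13 | b => 14 | r => 15 | c0 => 16
  | cnt => 17 | old => 18 | u => 19 | j => 20 | c => 21 | d => 22 | WT => 23 | PW => 24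
  | KEY => 25 | MU => 26 | LIST => 27 | LSZ => 28 | LS => 29 | T1 => 30 | T2 => 31
  | Z1 => 32 | Z2 => 33

theorem Var.idx_lt (v : Var) : v.idx < 64 := by
  cases v <;> decide

/-- The array with a given number. -/
def Var.ofIdx : ℕ → Var
  | 0 => out | 1 => m | 2 => k | 3 => p | 4 => n | 5 => cur | 6 => i | 7 => len | 8 => l
  | 9 => q | 10 => acc | 11 => W | 12 => B | 13 => a | 14 => b | 15 => r | 16 => c0
  | 17 => cnt | 18 => old | 19 => u | 20 => j | 21 => c | 22 => d | 23 => WT | 24 => PW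
  | 25 => KEY | 26 => MU | 27 => LIST | 28 => LSZ | 29 => LS | 30 => T1 | 31 => T2
  | 32 => Z1 | _ => Z2

theorem Var.idx_injective : Function.Injective Var.idx :=
  Function.LeftInverse.injective (g := Var.ofIdx) fun v => by cases v <;> rfl

/-- The contents of the arrays. -/
abbrev State : Type := Var → ℕ → ℕ

/-- The contents of the arrays, read off from the memory. -/
def view (M : RAM.Mem) : State := fun v i => M (64 * i + v.idx)

/-- The state with a new entry in one array. -/
def upd (σ : State) (v : Var) (i x : ℕ) : State :=
  Function.update σ v (Function.update (σ v) i x)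

theorem upd_of_ne (σ : State) {v w : Var} (i x : ℕ) (h : w ≠ v) : upd σ v i x w = σ w := by
  rw [upd, Function.update_of_ne h]

theorem upd_self (σ : State) (v : Var) (i x j : ℕ) :
    upd σ v i x v j = if j = i then x else σ v j := by
  rw [upd, Function.update_self, Function.update_apply]

/-- The arrays are interleaved with stride `64`. All array numbers are smaller, so entries of
different arrays never share a cell. -/
theorem view_update (M : RAM.Mem) (v : Var) (i x : ℕ) :
    view (Function.update M (64 * i + v.idx) x) = upd (view M) v i x := by
  funext w j
  have hv := v.idx_lt
  have hw := w.idx_lt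
  by_cases h : w = v
  · subst h
    rw [upd_self, view, Function.update_apply]
    exact if_congr (by omega) rfl rfl
  · rw [upd_of_ne _ _ _ h, view, Function.update_of_ne, view]
    intro h'
    exact h (Var.idx_injective (by omega))

/-- Expressions. -/
inductive Ex : Type
  | lit (c : ℕ) : Ex
  | inp (e : Ex) : Ex
  | rd (v : Var) (e : Ex) : Ex
  | add (e f : Ex) : Ex
  | sub (e f : Ex) : Ex
  | mul (e f : Ex) : Ex
  | div (e f : Ex) : Ex

namespace Ex

/-- The content of a register. -/
abbrev rg (v : Var) : Ex := rd v (lit 0)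

instance : Add Ex := ⟨add⟩
instance : Sub Ex := ⟨sub⟩
instance : Mul Ex := ⟨mul⟩
instance : Div Ex := ⟨div⟩
instance : Coe Var Ex := ⟨rg⟩
instance (n : ℕ) : OfNat Ex n := ⟨lit n⟩

/-- The remainder. -/
def md (e f : Ex) : Ex := e - e / f * f

/-- The value of an expression. -/
def ev (inp : List ℕ) (σ : State) : Ex → ℕ
  | lit c => c
  | .inp e => inp.getD (e.ev inp σ) 0
  | rd v e => σ v (e.ev inp σ)
  | add e f => e.ev inp σ + f.ev inp σ
  | sub e f => e.ev inp σ - f.ev inp σ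
  | mul e f => e.ev inp σ * f.ev inp σ
  | div e f => e.ev inp σ / f.ev inp σ

section ev

variable (l : List ℕ) (σ : State) (e f : Ex)

@[simp] theorem ev_lit (c : ℕ) : (lit c).ev l σ = c := rfl
@[simp] theorem ev_ofNat (c : ℕ) : (ofNat(c) : Ex).ev l σ = c := rfl
@[simp] theorem ev_inp : (Ex.inp e).ev l σ = l.getD (e.ev l σ) 0 := rfl
@[simp] theorem ev_rd (v : Var) : (rd v e).ev l σ = σ v (e.ev l σ) := rfl
@[simp] theorem ev_add : (e + f).ev l σ = e.ev l σ + f.ev l σ := rfl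
@[simp] theorem ev_sub : (e - f).ev l σ = e.ev l σ - f.ev l σ := rfl
@[simp] theorem ev_mul : (e * f).ev l σ = e.ev l σ * f.ev l σ := rfl
@[simp] theorem ev_div : (e / f).ev l σ = e.ev l σ / f.ev l σ := rfl
@[simp] theorem ev_md : (md e f).ev l σ = e.ev l σ % f.ev l σ := by
  rw [md, ev_sub, ev_mul, ev_div, Nat.mod_eq_sub_div_mul]

end ev

/-- The term that computes an expression. -/
def toTerm : Ex → RAM.Term
  | lit c => .lit c
  | inp e => .input e.toTerm
  | rd v e => .cell (.add (.mul (.lit 64) e.toTerm) (.lit v.idx))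
  | add e f => .add e.toTerm f.toTerm
  | sub e f => .sub e.toTerm f.toTerm
  | mul e f => .mul e.toTerm f.toTerm
  | div e f => .div e.toTerm f.toTerm

theorem val_toTerm (l : List ℕ) (M : RAM.Mem) (e : Ex) :
    e.toTerm.val l M = e.ev l (view M) := by
  induction e with
  | lit c => rfl
  | inp e ih => simp only [toTerm, RAM.Term.val, ev, ih]
  | rd v e ih => simp only [toTerm, RAM.Term.val, ev, ih, view]
  | add e f he hf => simp only [toTerm, RAM.Term.val, ev, he, hf]
  | sub e f he hf => simp only [toTerm, RAM.Term.val, ev, he, hf]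
  | mul e f he hf => simp only [toTerm, RAM.Term.val, ev, he, hf]
  | div e f he hf => simp only [toTerm, RAM.Term.val, ev, he, hf]

end Ex

/-- Programs with bounded loops. -/
inductive Cmd : Type
  | skip : Cmd
  /-- `set v e x` is the assignment `v[e] := x` -/
  | set (v : Var) (e x : Ex) : Cmd
  /-- run `c`, then `d` -/
  | seq (c d : Cmd) : Cmd
  | ite (e : Ex) (c d : Cmd) : Cmd
  /-- `rep x y c` runs `c` with `x = 0, 1, …` as long as `x < y` -/
  | rep (x y : Var) (c : Cmd) : Cmd

namespace Cmd

scoped infixr:60 " ;; " => Cmd.seq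

/-- The assignment of a value to a register. -/
abbrev let_ (v : Var) (x : Ex) : Cmd := set v 0 x

/-- The address of an array entry. -/
def addr (v : Var) (e : Ex) : RAM.Term := .add (.mul (.lit 64) e.toTerm) (.lit v.idx)

/-- The program of the machine. -/
def toProgram : Cmd → RAM.Program
  | skip => .skip
  | set v e x => .assign (addr v e) x.toTerm
  | seq c d => .seq c.toProgram d.toProgram
  | ite e c d => .cond e.toTerm c.toProgram d.toProgram
  | rep x y c => .seq (.assign (addr x 0) (0 : Ex).toTerm)
      (.loop ((y : Ex) - (x : Ex)).toTerm
        (.seq c.toProgram (.assign (addr x 0) ((x : Ex) + 1).toTerm)))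

/-- Whether the command may change the array. -/
def mods : Cmd → Var → Bool
  | skip, _ => false
  | set v _ _, w => decide (w = v)
  | seq c d, w => c.mods w || d.mods w
  | ite _ c d, w => c.mods w || d.mods w
  | rep x _ c, w => decide (w = x) || c.mods w

/-- Loops do not change their counters and bounds. -/
def wf : Cmd → Bool
  | skip => true
  | set _ _ _ => true
  | seq c d => c.wf && d.wf
  | ite _ c d => c.wf && d.wf
  | rep x y c => c.wf && !c.mods x && !c.mods y && decide (x ≠ y)

/-- A bound for the sizes of the terms of the program. -/
def maxSize : Cmd → ℕ
  | skip => 1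
  | set v e x => max (termSize (addr v e)) (termSize x.toTerm)
  | seq c d => max c.maxSize d.maxSize
  | ite e c d => max (termSize e.toTerm) (max c.maxSize d.maxSize)
  | rep x y c => max (max (termSize (addr x 0)) (termSize (0 : Ex).toTerm))
      (max (max (termSize ((y : Ex) - (x : Ex)).toTerm) (termSize ((x : Ex) + 1).toTerm))
        c.maxSize)

theorem view_assign (l : List ℕ) (M : RAM.Mem) (v : Var) (e x : Ex) :
    view (Function.update M ((addr v e).val l M) (x.toTerm.val l M)) =
      upd (view M) v (e.ev l (view M)) (x.ev l (view M)) := by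
  rw [← view_update, ← Ex.val_toTerm, ← Ex.val_toTerm]
  rfl

theorem loop_frame {l : List ℕ} {c : RAM.Term} {p : RAM.Program} {v : Var} {M M' : RAM.Mem}
    {t : ℕ} (h : RAM.Runs l (.loop c p) M M' t)
    (hp : ∀ M M' t, RAM.Runs l p M M' t → view M' v = view M v) : view M' v = view M v := by
  generalize hP : RAM.Program.loop c p = P at h
  induction h with
  | loop_done => rfl
  | loop_step _ h1 _ _ ih =>
    cases hP
    rw [ih rfl, hp _ _ _ h1]
  | _ => cases hP

/-- The frame property: a syntactic check replaces a separate invariant for every array that a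
command leaves alone. -/
theorem runs_frame {l : List ℕ} {c : Cmd} {M M' : RAM.Mem} {t : ℕ}
    (h : RAM.Runs l c.toProgram M M' t) {v : Var} (hv : c.mods v = false) :
    view M' v = view M v := by
  induction c generalizing M M' t with
  | skip => cases h; rfl
  | set w e x =>
    cases h
    simp only [mods, decide_eq_false_iff_not] at hv
    rw [view_assign, upd_of_ne _ _ _ hv]
  | seq c d hc hd =>
    simp only [mods, Bool.or_eq_false_iff] at hv
    cases h with
    | seq h1 h2 => rw [hd h2 hv.2, hc h1 hv.1]
  | ite e c d hc hd =>
    simp only [mods, Bool.or_eq_false_iff] at hv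
    cases h with
    | cond_true _ h => exact hc h hv.1
    | cond_false _ h => exact hd h hv.2
  | rep x y c hc =>
    simp only [mods, Bool.or_eq_false_iff, decide_eq_false_iff_not] at hv
    cases h with
    | seq h1 h2 =>
      cases h1
      rw [loop_frame h2, view_assign, upd_of_ne _ _ _ hv.1]
      intro M M' t h
      cases h with
      | seq h1 h2 =>
        cases h2
        rw [view_assign, upd_of_ne _ _ _ hv.1, hc h1 hv.2]

end Cmd

/-! ### Total correctness with a time bound -/

/-- An input, a number of bits for the entries of the memory, and a bound for the sizes of
terms. -/
structure Env where
  inp : List ℕ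
  bits : ℕ
  K : ℕ
  one_le_bits : 1 ≤ bits
  inp_lt : ∀ x ∈ inp, x < 2 ^ bits
  one_le_K : 1 ≤ K

/-- A bound for the time of a single step. -/
def Env.unit (E : Env) : ℕ := 3 * E.K ^ 2 * (E.bits + 1)

/-- Started in the state `σ`, the command halts after at most `s` steps in a state that
satisfies `Q`, and it never writes a number of more than `E.bits` bits. -/
def Tri (E : Env) (c : Cmd) (σ : State) (s : ℕ) (Q : State → Prop) : Prop :=
  c.wf = true → c.maxSize ≤ E.K → ∀ M : RAM.Mem, view M = σ → (∀ x, M x < 2 ^ E.bits) →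
    ∃ M' t, RAM.Runs E.inp c.toProgram M M' t ∧ t ≤ s * E.unit ∧ (∀ x, M' x < 2 ^ E.bits) ∧
      Q (view M')

namespace Tri

variable {E : Env} {σ : State} {s s₁ s₂ : ℕ} {c d : Cmd} {Q Q' : State → Prop}

theorem one_le_unit (E : Env) : 1 ≤ E.unit := by
  have := E.one_le_K
  rw [Env.unit]
  exact Nat.one_le_iff_ne_zero.2 (by positivity)

/-- The factor `3` leaves room in one unit for two evaluations of terms and the constant overhead.
-/
theorem cost_le_unit {M : RAM.Mem} (hM : ∀ x, M x < 2 ^ E.bits) {t : RAM.Term}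
    (ht : termSize t ≤ E.K) : 3 * t.cost E.inp M ≤ E.unit := by
  have h1 := cost_le E.one_le_bits E.inp_lt hM t
  have h2 : termSize t ^ 2 * (E.bits + 1) ≤ E.K ^ 2 * (E.bits + 1) := by gcongr
  rw [Env.unit, mul_assoc]
  omega

theorem three_le_unit (E : Env) : 3 ≤ E.unit := by
  rw [Env.unit, mul_assoc]
  have : 1 ≤ E.K ^ 2 * (E.bits + 1) := Nat.one_le_iff_ne_zero.2 (by have := E.one_le_K; positivity)
  omega

theorem mono (h : Tri E c σ s₁ Q) (hs : s₁ ≤ s₂) (hQ : ∀ τ, Q τ → Q' τ) : Tri E c σ s₂ Q' := by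
  intro h1 h2 M h3 h4
  obtain ⟨M', t, r1, r2, r3, r4⟩ := h h1 h2 M h3 h4
  exact ⟨M', t, r1, r2.trans (Nat.mul_le_mul_right _ hs), r3, hQ _ r4⟩

theorem post (h : Tri E c σ s Q) (hQ : ∀ τ, Q τ → Q' τ) : Tri E c σ s Q' := h.mono le_rfl hQ

theorem steps (h : Tri E c σ s₁ Q) (hs : s₁ ≤ s₂) : Tri E c σ s₂ Q := h.mono hs fun _ => id

theorem frame (h : Tri E c σ s Q) :
    Tri E c σ s fun τ => Q τ ∧ ∀ v, c.mods v = false → τ v = σ v := by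
  intro h1 h2 M h3 h4
  obtain ⟨M', t, r1, r2, r3, r4⟩ := h h1 h2 M h3 h4
  exact ⟨M', t, r1, r2, r3, r4, fun v hv => h3 ▸ Cmd.runs_frame r1 hv⟩

theorem skip (h : Q σ) : Tri E .skip σ 1 Q := by
  rintro - - M rfl h4
  exact ⟨M, 1, .skip M, by have := one_le_unit E; omega, h4, h⟩

theorem set {v : Var} {e x : Ex} (hx : x.ev E.inp σ < 2 ^ E.bits)
    (h : Q (upd σ v (e.ev E.inp σ) (x.ev E.inp σ))) : Tri E (.set v e x) σ 1 Q := by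
  rintro - h2 M rfl h4
  refine ⟨_, _, .assign _ _ M, ?_, ?_, ?_⟩
  · rw [Cmd.maxSize, max_le_iff] at h2
    have h5 := cost_le_unit h4 h2.1
    have h6 := cost_le_unit h4 h2.2
    have := three_le_unit E
    omega
  · intro y
    rw [Function.update_apply]
    split_ifs
    · rwa [Ex.val_toTerm]
    · exact h4 y
  · rwa [Cmd.view_assign]

theorem seq (h : Tri E c σ s₁ fun τ => Tri E d τ s₂ Q) :
    Tri E (.seq c d) σ (s₁ + s₂ + 1) Q := by
  intro h1 h2 M h3 h4
  rw [Cmd.wf, Bool.and_eq_true] at h1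
  rw [Cmd.maxSize, max_le_iff] at h2
  obtain ⟨M', t, r1, r2, r3, r4⟩ := h h1.1 h2.1 M h3 h4
  obtain ⟨M'', t', r1', r2', r3', r4'⟩ := r4 h1.2 h2.2 M' rfl r3
  refine ⟨M'', _, .seq r1 r1', ?_, r3', r4'⟩
  have := one_le_unit E
  rw [add_mul, add_mul]
  omega

theorem ite {e : Ex} (hc : e.ev E.inp σ ≠ 0 → Tri E c σ s Q)
    (hd : e.ev E.inp σ = 0 → Tri E d σ s Q) : Tri E (.ite e c d) σ (s + 1) Q := by
  rintro h1 h2 M rfl h4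
  rw [Cmd.wf, Bool.and_eq_true] at h1
  rw [Cmd.maxSize, max_le_iff, max_le_iff] at h2
  have h5 := cost_le_unit h4 h2.1
  have := three_le_unit E
  by_cases h : e.ev E.inp (view M) = 0
  · obtain ⟨M', t, r1, r2, r3, r4⟩ := hd h h1.2 h2.2.2 M rfl h4
    refine ⟨M', _, .cond_false (by rwa [Ex.val_toTerm]) r1, ?_, r3, r4⟩
    rw [add_mul]
    omega
  · obtain ⟨M', t, r1, r2, r3, r4⟩ := hc h h1.1 h2.2.1 M rfl h4
    refine ⟨M', _, .cond_true (by rwa [Ex.val_toTerm]) r1, ?_, r3, r4⟩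
    rw [add_mul]
    omega

/-- The number of iterations is known in advance, since well-formed loops change neither counter nor
bound. The invariant is stated after the counter has been set; unmodified arrays come back unchanged
without being part of it. -/
theorem rep {x y : Var} (Inv : ℕ → State → Prop) (h0 : Inv 0 (upd σ x 0 0))
    (hstep : ∀ j τ, j < σ y 0 → τ x 0 = j → (∀ v, v ≠ x → c.mods v = false → τ v = σ v) →
      Inv j τ → Tri E c τ s fun τ' => Inv (j + 1) (upd τ' x 0 (j + 1)))
    (hend : ∀ τ, (∀ v, v ≠ x → c.mods v = false → τ v = σ v) → Inv (σ y 0) τ → Q τ) :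
    Tri E (.rep x y c) σ (σ y 0 * (s + 3) + 3) Q := by
  rintro h1 h2 M rfl h4
  simp only [Cmd.wf, Bool.and_eq_true, Bool.not_eq_true', decide_eq_true_eq] at h1
  obtain ⟨⟨⟨w1, w2⟩, w3⟩, w4⟩ := h1
  simp only [Cmd.maxSize, max_le_iff] at h2
  obtain ⟨⟨z1, z2⟩, ⟨z3, z4⟩, z5⟩ := h2
  have hu := three_le_unit E
  have hy : view M y 0 < 2 ^ E.bits := h4 _
  -- Induction on the number `d` of iterations that remain.
  have key : ∀ d j (N : RAM.Mem), j + d = view M y 0 → view N x 0 = j →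
      (∀ v, v ≠ x → c.mods v = false → view N v = view M v) → Inv j (view N) →
      (∀ z, N z < 2 ^ E.bits) →
      ∃ M' t, RAM.Runs E.inp (.loop ((y : Ex) - (x : Ex)).toTerm
        (.seq c.toProgram (.assign (Cmd.addr x 0) ((x : Ex) + 1).toTerm))) N M' t ∧
        t ≤ (d * (s + 3) + 1) * E.unit ∧ (∀ z, M' z < 2 ^ E.bits) ∧ Q (view M') := by
    intro d
    induction d with
    | zero =>
      intro j N hj hx hf hI hN
      have hg : ((y : Ex) - (x : Ex)).toTerm.val E.inp N = 0 := by
        rw [Ex.val_toTerm]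
        simp only [Ex.ev_sub, Ex.ev_rd, Ex.ev_lit, hx, hf y w4.symm w3]
        omega
      have := cost_le_unit hN z3
      exact ⟨N, _, .loop_done hg, by omega, hN, hend _ hf (by rwa [add_zero, ← hj] at *)⟩
    | succ d ih =>
      intro j N hj hx hf hI hN
      have hg : ((y : Ex) - (x : Ex)).toTerm.val E.inp N ≠ 0 := by
        rw [Ex.val_toTerm]
        simp only [Ex.ev_sub, Ex.ev_rd, Ex.ev_lit, hx, hf y w4.symm w3]
        omega
      obtain ⟨N', t, r1, r2, r3, r4⟩ :=
        hstep j (view N) (by omega) hx hf hI w1 z5 N rfl hN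
      have hx' : view N' x 0 = j := by rw [Cmd.runs_frame r1 w2, hx]
      have hview : view (Function.update N' ((Cmd.addr x 0).val E.inp N')
          (((x : Ex) + 1).toTerm.val E.inp N')) = upd (view N') x 0 (j + 1) := by
        rw [Cmd.view_assign]
        simp only [Ex.ev_add, Ex.ev_rd, Ex.ev_lit, Ex.ev_ofNat, hx']
      have hsmall : ∀ z, Function.update N' ((Cmd.addr x 0).val E.inp N')
          (((x : Ex) + 1).toTerm.val E.inp N') z < 2 ^ E.bits := by
        intro z
        rw [Function.update_apply]
        split_ifs
        · rw [Ex.val_toTerm]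
          simp only [Ex.ev_add, Ex.ev_rd, Ex.ev_lit, Ex.ev_ofNat, hx']
          omega
        · exact r3 z
      obtain ⟨M', t', r1', r2', r3', r4'⟩ := ih (j + 1) _ (by omega)
        (by rw [hview, upd_self, if_pos rfl])
        (fun v hv hm => by rw [hview, upd_of_ne _ _ _ hv, Cmd.runs_frame r1 hm, hf v hv hm])
        (by rw [hview]; exact r4) hsmall
      refine ⟨M', _, .loop_step hg (.seq r1 (.assign _ _ N')) r1', ?_, r3', r4'⟩
      have k1 := cost_le_unit hN z3
      have k2 := cost_le_unit r3 z1
      have k3 := cost_le_unit r3 z4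
      have k4 : ((d + 1) * (s + 3) + 1) * E.unit =
        (d * (s + 3) + 1) * E.unit + s * E.unit + 3 * E.unit := by ring
      rw [k4]
      omega
  have hview : view (Function.update M ((Cmd.addr x 0).val E.inp M)
      ((0 : Ex).toTerm.val E.inp M)) = upd (view M) x 0 0 := by
    rw [Cmd.view_assign]
    rfl
  obtain ⟨M', t, r1, r2, r3, r4⟩ := key (view M y 0) 0 _ (by omega)
    (by rw [hview, upd_self, if_pos rfl])
    (fun v hv hm => by rw [hview, upd_of_ne _ _ _ hv]) (by rw [hview]; exact h0)
    (by
      intro z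
      rw [Function.update_apply]
      split_ifs
      · rw [Ex.val_toTerm]
        exact Nat.two_pow_pos _
      · exact h4 z)
  refine ⟨M', _, .seq (.assign _ _ M) r1, ?_, r3, r4⟩
  have k1 := cost_le_unit h4 z1
  have k2 := cost_le_unit h4 z2
  have k4 : (view M y 0 * (s + 3) + 3) * E.unit =
    (view M y 0 * (s + 3) + 1) * E.unit + 2 * E.unit := by ring
  rw [k4]
  omega

/-- Allows a computed value to be copied elsewhere without a separate bound for it. -/
theorem bdd {E : Env} {c : Cmd} {σ : State} {s : ℕ} {Q : State → Prop}
    (h : Tri E c σ s Q) : Tri E c σ s fun τ => Q τ ∧ ∀ v i, τ v i < 2 ^ E.bits := by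
  intro h1 h2 M h3 h4
  obtain ⟨M', t, r1, r2, r3, r4⟩ := h h1 h2 M h3 h4
  exact ⟨M', t, r1, r2, r3, r4, fun v i => r3 _⟩

end Tri

open Cmd Ex

/-! ### The parts of the main loop -/

/-- List the small sets that avoid the set of the tuple `c0`, their sizes and signs. -/
def familyCmd : Cmd :=
  let_ .cnt 1 ;; set .LIST 0 0 ;; set .LSZ 0 0 ;; set .LS 0 1 ;;
  rep .u .n (
    ite (md (rd .MU Var.c0 / rd .PW Var.u) 3) skip
      (let_ .old Var.cnt ;;
       rep .l .old (
         ite (rg .r - rd .LSZ Var.l)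
           (set .LIST Var.cnt (rd .LIST Var.l + rd .PW Var.u) ;;
            set .LSZ Var.cnt (rd .LSZ Var.l + 1) ;;
            set .LS Var.cnt (Var.W - rd .LS Var.l) ;;
            let_ .cnt (Var.cnt + 1))
           skip)))

/-- Fill a row of the table `T` with the values that `val` computes for the listed sets. -/
def fill (T : Var) (row : Ex) (val : Cmd) : Cmd :=
  rep .l .cnt (val ;; set T (row * Var.B + rd .LIST Var.l) Var.acc)

/-- Fill `q` consecutive rows of the table `T`. -/
def layer (T : Var) (base : Ex) (val : Cmd) : Cmd :=
  rep .c .q (fill T (base * Var.q + Var.c) val)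

/-- One value of the next layer of the table of chain counts. -/
def chainVal (T : Var) (cmp : Ex) : Cmd :=
  let_ .acc 0 ;;
  rep .d .q (
    ite (cmp * (rd .LIST Var.l + 1 - rd .MU Var.d))
      (let_ .acc (md (Var.acc + rd T (((Var.c0 * (Var.q + 1) + Var.j) * Var.q + Var.d) * Var.B +
        (rd .LIST Var.l - rd .MU Var.d))) Var.W))
      skip)

/-- The table of chain counts, up to chains of `J` tuples. -/
def chainsCmd (T J : Var) (cmp : Ex) : Cmd :=
  layer T (Var.c0 * (Var.q + 1)) (let_ .acc (1 - rd .LIST Var.l)) ;;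
  rep .j J (layer T (Var.c0 * (Var.q + 1) + (Var.j + 1)) (chainVal T cmp))

/-- The zeta transform of the row of the table `T` for chains of `J` tuples below `c0`. -/
def zetaCmd (Z T J : Var) : Cmd :=
  fill Z (Var.c0 * (Var.n + 1)) (let_ .acc (md
    (rd T (((Var.c0 * (Var.q + 1) + J) * Var.q + Var.c0) * Var.B + rd .LIST Var.l)) Var.W)) ;;
  rep .u .n (fill Z (Var.c0 * (Var.n + 1) + (Var.u + 1)) (let_ .acc (md
    (rd Z ((Var.c0 * (Var.n + 1) + Var.u) * Var.B + rd .LIST Var.l) +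
      rd Z ((Var.c0 * (Var.n + 1) + Var.u) * Var.B + (rd .LIST Var.l + rd .PW Var.u))) Var.W)))

/-- Add the signed sum of the products of the two transforms. -/
def sumCmd : Cmd :=
  rep .l .cnt (let_ .out (md (Var.out + rd .LS Var.l *
    rd .Z1 ((Var.c0 * (Var.n + 1) + Var.n) * Var.B + rd .LIST Var.l) *
    rd .Z2 ((Var.c0 * (Var.n + 1) + Var.n) * Var.B + rd .LIST Var.l)) Var.W))

/-- The count of the matchings in which the tuple `c0` has exactly `a` predecessors. -/
def middleCmd : Cmd :=
  familyCmd ;;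
  chainsCmd .T1 .a (rd .KEY Var.c - rd .KEY Var.d) ;;
  chainsCmd .T2 .b (rd .KEY Var.d - rd .KEY Var.c) ;;
  zetaCmd .Z1 .T1 .a ;; zetaCmd .Z2 .T2 .b ;; sumCmd

/-! ### Their specification -/

/-- The data of the main loop. -/
structure Data where
  n : ℕ
  q : ℕ
  R : ℕ
  a : ℕ
  b : ℕ
  W : ℕ
  key : ℕ → ℕ
  mu : ℕ → Finset ℕ
  mu_subset : ∀ c < q, mu c ⊆ range n
  a_le : a ≤ q
  b_le : b ≤ q
  two_le_W : 2 ≤ W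

/-- The numbers of the main loop fit into the cells of the memory. -/
structure Data.Fits (P : Data) (E : Env) : Prop where
  W_lt : P.W < 2 ^ E.bits
  pow_lt : 2 * 3 ^ P.n < 2 ^ E.bits
  R_lt : P.R < 2 ^ E.bits

/-- The data of the main loop are stored in the memory. -/
structure Data.Stored (P : Data) (σ : State) : Prop where
  n : σ .n 0 = P.n
  q : σ .q 0 = P.q
  r : σ .r 0 = P.R
  a : σ .a 0 = P.a
  b : σ .b 0 = P.b
  W : σ .W 0 = P.W
  B : σ .B 0 = 2 * 3 ^ P.n
  PW : ∀ i < P.n, σ .PW i = 3 ^ i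
  KEY : ∀ c < P.q, σ .KEY c = P.key c
  MU : ∀ c < P.q, σ .MU c = code (P.mu c)

/-- The variables of `Data.Stored`. -/
def isData : Var → Bool
  | .n | .q | .r | .a | .b | .W | .B | .PW | .KEY | .MU => true
  | _ => false

theorem Data.Stored.congr {P : Data} {σ τ : State} (h : P.Stored σ)
    (hτ : ∀ v, isData v = true → τ v = σ v) : P.Stored τ where
  n := by rw [hτ _ rfl, h.n]
  q := by rw [hτ _ rfl, h.q]
  r := by rw [hτ _ rfl, h.r]
  a := by rw [hτ _ rfl, h.a]
  b := by rw [hτ _ rfl, h.b]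
  W := by rw [hτ _ rfl, h.W]
  B := by rw [hτ _ rfl, h.B]
  PW := by rw [hτ _ rfl]; exact h.PW
  KEY := by rw [hτ _ rfl]; exact h.KEY
  MU := by rw [hτ _ rfl]; exact h.MU

/-- `L` is listed in the memory. -/
structure Listed (W : ℕ) (L : List (Finset ℕ)) (σ : State) : Prop where
  cnt : σ .cnt 0 = L.length
  LIST : ∀ l X, L[l]? = some X → σ .LIST l = code X
  LS : ∀ l X, L[l]? = some X → σ .LS l ≤ W ∧ (σ .LS l : ZMod W) = (-1) ^ X.card

theorem Listed.congr {W : ℕ} {L : List (Finset ℕ)} {σ τ : State} (h : Listed W L σ)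
    (h1 : τ .cnt = σ .cnt) (h2 : τ .LIST = σ .LIST) (h3 : τ .LS = σ .LS) : Listed W L τ where
  cnt := by rw [h1, h.cnt]
  LIST := by rw [h2]; exact h.LIST
  LS := by rw [h3]; exact h.LS

/-- The family of the tuple `c`. -/
abbrev Data.list (P : Data) (c : ℕ) : List (Finset ℕ) := famList P.R (P.mu c) P.n

/-- The family of the tuple `c`, as a set. -/
abbrev Data.fam (P : Data) (c : ℕ) : Finset (Finset ℕ) := KMatching.fam P.R (P.mu c) P.n

/-- The data and the family of the tuple `c` are stored in the memory. -/
structure Data.Ready (P : Data) (c : ℕ) (σ : State) : Prop where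
  stored : P.Stored σ
  listed : Listed P.W (P.list c) σ
  c0 : σ .c0 0 = c

/-- The variables of `Data.Ready`. -/
def isStatic : Var → Bool
  | .cnt | .LIST | .LS | .c0 => true
  | v => isData v

theorem Data.Ready.congr {P : Data} {c : ℕ} {σ τ : State} (h : P.Ready c σ)
    (hτ : ∀ v, isStatic v = true → τ v = σ v) : P.Ready c τ where
  stored := h.stored.congr fun v hv => hτ v (by cases v <;> first | rfl | exact hv)
  listed := h.listed.congr (hτ _ rfl) (hτ _ rfl) (hτ _ rfl)
  c0 := by rw [hτ _ rfl, h.c0]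

theorem Data.code_lt (P : Data) {c : ℕ} {X : Finset ℕ} (h : X ∈ P.list c) :
    code X < 3 ^ P.n :=
  KMatching.code_lt (mem_famList.1 h).1

theorem row_div {B y : ℕ} (x : ℕ) (h : y < B) : (x * B + y) / B = x := by
  rw [mul_comm, Nat.mul_add_div (by omega), Nat.div_eq_of_lt h, add_zero]

/-- The row `ρ` of the table `T` contains the values of `g`. -/
def Data.Row (P : Data) (c : ℕ) (σ : State) (T : Var) (ρ : ℕ) (g : Finset ℕ → ZMod P.W) : Prop :=
  ∀ x < 2 * 3 ^ P.n, (σ T (ρ * (2 * 3 ^ P.n) + x) : ZMod P.W) =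
    onCodes (P.fam c) g x

/-! ### Filling rows and layers of tables -/

section Spec

variable {E : Env} {P : Data}

/-- Distinct sets have distinct codes, so no write destroys an earlier one. The entries that are not
written must vanish for the row to represent `onCodes`; this is why the row is required to be
untouched beforehand. -/
theorem fill_spec {σ : State} {c₀ : ℕ} {T : Var} {row : Ex} {val : Cmd} {s ρ : ℕ}
    {g : Finset ℕ → ZMod P.W} (hσ : P.Ready c₀ σ)
    (hT : isStatic T = false) (hTl : T ≠ .l) (hTv : val.mods T = false)
    (hval : ∀ v, isStatic v = true → val.mods v = false)
    (hvl : val.mods .l = false)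
    (hrow : ∀ τ, (∀ v, v ≠ .l → v ≠ T → val.mods v = false → τ v = σ v) →
      row.ev E.inp τ = ρ)
    (hzero : ∀ x, x / (2 * 3 ^ P.n) = ρ → σ T x = 0)
    (hspec : ∀ τ l X, (P.list c₀)[l]? = some X → τ .l 0 = l → P.Ready c₀ τ →
      (∀ v, v ≠ .l → v ≠ T → val.mods v = false → τ v = σ v) →
      (∀ x, x / (2 * 3 ^ P.n) ≠ ρ → τ T x = σ T x) →
      Tri E val τ s fun τ' => (τ' .acc 0 : ZMod P.W) = g X) :
    Tri E (fill T row val) σ ((P.list c₀).length * (s + 5) + 3) fun τ =>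
      P.Row c₀ τ T ρ g ∧ ∀ x, x / (2 * 3 ^ P.n) ≠ ρ → τ T x = σ T x := by
  have hB : 0 < 2 * 3 ^ P.n := by positivity
  have hmem : ∀ {l X}, (P.list c₀)[l]? = some X → code X < 2 * 3 ^ P.n := fun h =>
    (P.code_lt (List.mem_of_getElem? h)).trans_le (by omega)
  have hstat : ∀ v, isStatic v = true → v ≠ .l ∧ v ≠ T := fun v hv =>
    ⟨by rintro rfl; simp [isStatic, isData] at hv, by rintro rfl; simp [hT] at hv⟩
  refine Tri.steps (Tri.rep (s := s + 2) (fun j τ =>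
      (∀ i X, i < j → (P.list c₀)[i]? = some X →
        (τ T (ρ * (2 * 3 ^ P.n) + code X) : ZMod P.W) = g X) ∧
      (∀ x, x < 2 * 3 ^ P.n → (∀ i X, i < j → (P.list c₀)[i]? = some X → code X ≠ x) →
        τ T (ρ * (2 * 3 ^ P.n) + x) = 0) ∧
      ∀ x, x / (2 * 3 ^ P.n) ≠ ρ → τ T x = σ T x) ?_ ?_ ?_) ?_
  · rw [upd_of_ne _ _ _ hTl]
    refine ⟨fun i X h => by omega, fun x hx _ => hzero _ (row_div _ hx), fun x _ => rfl⟩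
  · rintro j τ hj hl hf ⟨i1, i2, i3⟩
    replace hf : ∀ v, v ≠ .l → v ≠ T → val.mods v = false → τ v = σ v := fun v h1 h2 h3 =>
      hf v h1 (by simp [mods, h2, h3])
    have hτ : P.Ready c₀ τ := hσ.congr fun v hv => hf v (hstat v hv).1 (hstat v hv).2 (hval v hv)
    rw [hσ.listed.cnt] at hj
    have hX : (P.list c₀)[j]? = some (P.list c₀)[j] := List.getElem?_eq_getElem hj
    generalize (P.list c₀)[j] = X at hX
    refine Tri.seq (Tri.post (hspec τ j X hX hl hτ hf i3).frame.bdd ?_)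
    rintro τ' ⟨⟨hacc, hf'⟩, hb⟩
    have hτ' : P.Ready c₀ τ' := hτ.congr fun v hv => hf' v (hval v hv)
    have hidx : (row * Var.B + rd .LIST Var.l).ev E.inp τ' = ρ * (2 * 3 ^ P.n) + code X := by
      rw [ev_add, ev_mul, hrow τ' fun v h1 h2 h3 => by rw [hf' v h3, hf v h1 h2 h3]]
      simp only [ev_rd, ev_lit, hτ'.stored.B, hf' .l hvl, hl, hτ'.listed.LIST j X hX]
    refine Tri.set (hb _ _) ?_
    rw [hidx]
    simp only [upd_of_ne _ _ _ hTl, upd_self, hf' T hTv, ev_rd, ev_lit]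
    refine ⟨fun i Y hi hY => ?_, fun x hx h => ?_, fun x hx => ?_⟩
    · split_ifs with h
      · rw [hacc]
        have : code Y = code X := by omega
        rw [code_injective this]
      · rcases Nat.lt_succ_iff_lt_or_eq.1 hi with hi | rfl
        · exact i1 i Y hi hY
        · rw [hX, Option.some.injEq] at hY
          exact absurd (by rw [hY]) h
    · rw [if_neg, i2 x hx fun i Y hi => h i Y (by omega)]
      intro h'
      exact h j X (by omega) hX (by omega)
    · rw [if_neg, i3 x hx]
      rintro rfl
      exact hx (row_div _ (hmem hX))
  · rintro τ hf ⟨i1, i2, i3⟩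
    refine ⟨fun x hx => ?_, i3⟩
    rw [hσ.listed.cnt] at i1 i2
    by_cases h : ∃ X ∈ P.list c₀, code X = x
    · obtain ⟨X, hX, rfl⟩ := h
      obtain ⟨i, hi, rfl⟩ := List.getElem_of_mem hX
      rw [onCodes_code_of_mem (Fm := P.fam c₀) _ (List.mem_toFinset.2 hX)]
      exact i1 i _ hi (List.getElem?_eq_getElem hi)
    · push Not at h
      rw [onCodes_eq_zero (Fm := P.fam c₀) _ fun X hX => h X (List.mem_toFinset.1 hX), i2 x hx, Nat.cast_zero]
      exact fun i X _ hX => h X (List.mem_of_getElem? hX)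
  · rw [hσ.listed.cnt]

theorem Data.Row.congr {c₀ : ℕ} {σ τ : State} {T : Var} {ρ : ℕ} {g : Finset ℕ → ZMod P.W}
    (h : P.Row c₀ σ T ρ g) (hτ : ∀ x, x / (2 * 3 ^ P.n) = ρ → τ T x = σ T x) :
    P.Row c₀ τ T ρ g := fun x hx => by
  rw [hτ _ (row_div _ hx)]
  exact h x hx

/-- The three conclusions feed the next layer: the new rows are correct, everything above is still
empty, and everything below is preserved. -/
theorem layer_spec {σ : State} {c₀ : ℕ} {T : Var} {base : Ex} {val : Cmd} {s β : ℕ}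
    {g : ℕ → Finset ℕ → ZMod P.W} (hσ : P.Ready c₀ σ)
    (hT : isStatic T = false) (hTl : T ≠ .l) (hTc : T ≠ .c) (hTv : val.mods T = false)
    (hval : ∀ v, isStatic v = true → val.mods v = false)
    (hvl : val.mods .l = false) (hvc : val.mods .c = false)
    (hbase : ∀ τ, (∀ v, v ≠ .l → v ≠ .c → v ≠ T → val.mods v = false → τ v = σ v) →
      base.ev E.inp τ = β)
    (hzero : ∀ x, β * P.q ≤ x / (2 * 3 ^ P.n) → σ T x = 0)
    (hspec : ∀ τ c l X, c < P.q → (P.list c₀)[l]? = some X → τ .l 0 = l → τ .c 0 = c →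
      P.Ready c₀ τ →
      (∀ v, v ≠ .l → v ≠ .c → v ≠ T → val.mods v = false → τ v = σ v) →
      (∀ x, x / (2 * 3 ^ P.n) < β * P.q → τ T x = σ T x) →
      Tri E val τ s fun τ' => (τ' .acc 0 : ZMod P.W) = g c X) :
    Tri E (layer T base val) σ (P.q * ((P.list c₀).length * (s + 5) + 6) + 3) fun τ =>
      (∀ c < P.q, P.Row c₀ τ T (β * P.q + c) (g c)) ∧
      (∀ x, (β + 1) * P.q ≤ x / (2 * 3 ^ P.n) → τ T x = 0) ∧
      (∀ x, x / (2 * 3 ^ P.n) < β * P.q → τ T x = σ T x) := by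
  have hstat : ∀ v, isStatic v = true → v ≠ .l ∧ v ≠ .c ∧ v ≠ T := fun v hv =>
    ⟨by rintro rfl; simp [isStatic, isData] at hv, by rintro rfl; simp [isStatic, isData] at hv,
      by rintro rfl; simp [hT] at hv⟩
  refine Tri.steps (Tri.rep (s := (P.list c₀).length * (s + 5) + 3) (fun j τ =>
      (∀ c < j, P.Row c₀ τ T (β * P.q + c) (g c)) ∧
      (∀ x, β * P.q + j ≤ x / (2 * 3 ^ P.n) → τ T x = 0) ∧
      (∀ x, x / (2 * 3 ^ P.n) < β * P.q → τ T x = σ T x)) ?_ ?_ ?_) ?_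
  · rw [upd_of_ne _ _ _ hTc]
    exact ⟨fun c h => by omega, hzero, fun _ _ => rfl⟩
  · rintro j τ hj hc hf ⟨i1, i2, i3⟩
    rw [hσ.stored.q] at hj
    replace hf : ∀ v, v ≠ .l → v ≠ .c → v ≠ T → val.mods v = false → τ v = σ v :=
      fun v h1 h2 h3 h4 => hf v h2 (by simp [fill, mods, h1, h3, h4])
    have hτ : P.Ready c₀ τ := hσ.congr fun v hv =>
      hf v (hstat v hv).1 (hstat v hv).2.1 (hstat v hv).2.2 (hval v hv)
    refine Tri.post (fill_spec (ρ := β * P.q + j) (g := g j) (s := s) hτ hT hTl hTv hval hvl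
      ?_ ?_ ?_) ?_
    · intro τ' hf'
      have hτ' : P.Ready c₀ τ' := hτ.congr fun v hv =>
        hf' v (hstat v hv).1 (hstat v hv).2.2 (hval v hv)
      rw [ev_add, ev_mul, hbase τ' fun v h1 h2 h3 h4 => by rw [hf' v h1 h3 h4, hf v h1 h2 h3 h4]]
      simp only [ev_rd, ev_lit, hτ'.stored.q, hf' .c (by decide) hTc.symm hvc, hc]
    · exact fun x hx => i2 x hx.ge
    · intro τ' l X hX hl hτ' hf' hx'
      refine hspec τ' j l X hj hX hl (by rw [hf' .c (by decide) hTc.symm hvc, hc]) hτ'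
        (fun v h1 h2 h3 h4 => by rw [hf' v h1 h3 h4, hf v h1 h2 h3 h4]) fun x hx => ?_
      rw [hx' x (by omega), i3 x hx]
    · rintro τ' ⟨h1, h2⟩
      rw [upd_of_ne _ _ _ hTc, Data.Row] at *
      refine ⟨fun c hc => ?_, fun x hx => ?_, fun x hx => ?_⟩
      · have : P.Row c₀ τ' T (β * P.q + c) (g c) := by
          rcases Nat.lt_succ_iff_lt_or_eq.1 hc with hc | rfl
          · exact (i1 c hc).congr fun x hx => h2 x (by omega)
          · exact h1
        exact this.congr fun x _ => by rw [upd_of_ne _ _ _ hTc]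
      · rw [h2 x (by omega), i2 x (by omega)]
      · rw [h2 x (by omega), i3 x hx]
  · rintro τ hf ⟨i1, i2, i3⟩
    rw [hσ.stored.q] at i1 i2
    exact ⟨i1, fun x hx => i2 x (by rw [add_mul, one_mul] at hx; exact hx), i3⟩
  · rw [hσ.stored.q]

end Spec

/-! ### The dynamic programming over chains -/

section Spec

variable {E : Env} {P : Data}

/-- The chain counts as elements of `ZMod P.W`. -/
abbrev Data.chain {α : Type*} [LinearOrder α] (P : Data) (key : ℕ → α) (j c : ℕ)
    (X : Finset ℕ) : ZMod P.W := (chainCount key P.mu P.q j c X : ZMod P.W)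

theorem chainVal_spec {α : Type*} [LinearOrder α] {key : ℕ → α} {σ : State} {c₀ : ℕ} {T : Var}
    {cmp : Ex} {c j l : ℕ} {X : Finset ℕ} (hσ : P.Ready c₀ σ) (hW : P.W < 2 ^ E.bits)
    (hT : T = .T1 ∨ T = .T2) (hc : c < P.q)
    (hcmp : ∀ τ, P.Ready c₀ τ → τ .c 0 < P.q → τ .d 0 < P.q →
      (cmp.ev E.inp τ ≠ 0 ↔ key (τ .d 0) < key (τ .c 0)))
    (hX : (P.list c₀)[l]? = some X) (hl : σ .l 0 = l) (hcσ : σ .c 0 = c) (hj : σ .j 0 = j)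
    (hrow : ∀ d < P.q, P.Row c₀ σ T ((c₀ * (P.q + 1) + j) * P.q + d) (P.chain key j d)) :
    Tri E (chainVal T cmp) σ (5 * P.q + 5) fun τ =>
      (τ .acc 0 : ZMod P.W) = P.chain key (j + 1) c X := by
  have hTacc : T ≠ .acc ∧ T ≠ .d := by rcases hT with rfl | rfl <;> decide
  have hW0 := P.two_le_W
  refine Tri.steps (Tri.seq (s₁ := 1) (s₂ := P.q * 5 + 3) (Tri.set (by simp) ?_)) (by omega)
  simp only [ev_ofNat]
  set σ' := upd σ .acc 0 0 with hσ'
  have hσ'r : P.Ready c₀ σ' := hσ.congr fun v hv =>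
    upd_of_ne _ _ _ (by rintro rfl; simp [isStatic, isData] at hv)
  have hq := hσ'r.stored.q
  have e1 : σ' T = σ T := upd_of_ne _ _ _ hTacc.1
  have e2 : σ' .l 0 = l := by rw [hσ', upd_of_ne _ _ _ (by decide), hl]
  have e3 : σ' .c 0 = c := by rw [hσ', upd_of_ne _ _ _ (by decide), hcσ]
  have e4 : σ' .j 0 = j := by rw [hσ', upd_of_ne _ _ _ (by decide), hj]
  have e5 : σ' .acc 0 = 0 := by rw [hσ', upd_self, if_pos rfl]
  clear_value σ'
  refine Tri.steps (Tri.rep (s := 2) (fun d τ => (τ .acc 0 : ZMod P.W) =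
    ∑ d ∈ range d, if key d < key c ∧ P.mu d ⊆ X then P.chain key j d (X \ P.mu d) else 0)
      ?_ ?_ ?_) (by rw [hq])
  · simp [upd_of_ne, e5]
  · intro d τ hd hdτ hf hI
    rw [hq] at hd
    have hτ : P.Ready c₀ τ := hσ'r.congr fun v hv =>
      hf v (by rintro rfl; simp [isStatic, isData] at hv)
        (by cases v <;> first | rfl | simp [isStatic, isData] at hv)
    have f1 : τ T = σ T := by rw [hf T hTacc.2 (by simp [mods, hTacc]), e1]
    have f2 : τ .l 0 = l := by rw [hf _ (by decide) rfl, e2]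
    have f3 : τ .c 0 = c := by rw [hf _ (by decide) rfl, e3]
    have f4 : τ .j 0 = j := by rw [hf _ (by decide) rfl, e4]
    have hcmp' := hcmp τ hτ (by rw [f3]; exact hc) (by rw [hdτ]; exact hd)
    rw [f3, hdτ] at hcmp'
    have hLX := hτ.listed.LIST l X hX
    have hXm := List.mem_of_getElem? hX
    -- The second factor is nonzero iff `code (mu d) ≤ code X`. This is weaker than `mu d ⊆ X`; it
    -- only prevents truncation in the index, and the table lookup decides the inclusion.
    have hguard : (cmp * (rd .LIST Var.l + 1 - rd .MU Var.d)).ev E.inp τ ≠ 0 ↔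
        key d < key c ∧ code (P.mu d) ≤ code X := by
      rw [ev_mul, mul_ne_zero_iff, hcmp']
      simp only [ev_sub, ev_add, ev_rd, ev_lit, ev_ofNat, f2, hdτ, hLX, hτ.stored.MU d hd]
      exact and_congr_right fun _ => by omega
    rw [sum_range_succ, ← hI]
    refine Tri.ite (s := 1) (fun h => ?_) (fun h => ?_)
    · rw [hguard] at h
      have hv := hrow d hd (code X - code (P.mu d))
        (by have := P.code_lt hXm; omega)
      rw [onCodes_code_sub (Fm := P.fam c₀) (fun X Y hY h => fam_mono hY h) _
        (List.mem_toFinset.2 hXm) h.2] at hv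
      refine Tri.set ?_ ?_
      · simp only [ev_md, ev_rd, ev_lit, hτ.stored.W]
        exact (Nat.mod_lt _ (by omega)).trans hW
      · simp only [upd_of_ne, upd_self, ev_md, ev_rd, ev_lit, ev_add, ev_mul, ev_sub, ev_ofNat,
          hτ.stored.W, hτ.stored.q, hτ.stored.B, hτ.stored.MU d hd, hτ.c0, f1, f2, f4, hdτ, hLX,
          ne_eq, reduceCtorEq, not_false_eq_true, if_true, ZMod.natCast_mod, Nat.cast_add]
        rw [hv]
        simp [h.1]
    · refine Tri.skip ?_
      rw [if_neg fun h' => hguard.2 ⟨h'.1, subset_of_code_le h'.2⟩ h,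
        upd_of_ne _ _ _ (by decide), add_zero]
  · intro τ hf hI
    rw [hq] at hI
    rw [hI, Data.chain, chainCount]
    push_cast
    refine sum_congr rfl fun d _ => ?_
    split_ifs <;> simp

/-- The tuple `c₀` owns `q + 1` layers of `q` rows, enough for chain lengths `0, …, q`. As `jmax ≤
q`, the rows of the next tuple are still empty afterwards. -/
theorem chains_spec {α : Type*} [LinearOrder α] {key : ℕ → α} {σ : State} {c₀ : ℕ} {T J : Var}
    {cmp : Ex} {jmax : ℕ} (hσ : P.Ready c₀ σ) (hW : P.W < 2 ^ E.bits)
    (hT : T = .T1 ∨ T = .T2) (hJ : J = .a ∨ J = .b) (hjmax : σ J 0 = jmax)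
    (hjq : jmax ≤ P.q)
    (hcmp : ∀ τ, P.Ready c₀ τ → τ .c 0 < P.q → τ .d 0 < P.q →
      (cmp.ev E.inp τ ≠ 0 ↔ key (τ .d 0) < key (τ .c 0)))
    (hzero : ∀ x, c₀ * ((P.q + 1) * P.q) ≤ x / (2 * 3 ^ P.n) → σ T x = 0) :
    Tri E (chainsCmd T J cmp) σ
      (P.q * ((P.list c₀).length * 6 + 6) + 3 +
        (jmax * (P.q * ((P.list c₀).length * (5 * P.q + 10) + 6) + 6) + 3) + 1) fun τ =>
      (∀ c < P.q, P.Row c₀ τ T ((c₀ * (P.q + 1) + jmax) * P.q + c) (P.chain key jmax c)) ∧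
      (∀ x, (c₀ + 1) * ((P.q + 1) * P.q) ≤ x / (2 * 3 ^ P.n) → τ T x = 0) := by
  have hTs : isStatic T = false ∧ T ≠ .l ∧ T ≠ .c ∧ T ≠ .acc ∧ T ≠ .d ∧ T ≠ .j := by
    rcases hT with rfl | rfl <;> decide
  obtain ⟨t1, t2, t3, t4, t5, t6⟩ := hTs
  refine Tri.seq (Tri.post (layer_spec (s := 1) (β := c₀ * (P.q + 1)) (g := P.chain key 0)
    hσ t1 t2 t3 (by simp [mods, t4]) ?_ (by simp [mods]) (by simp [mods]) ?_ ?_ ?_).frame ?_)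
  · intro v hv
    cases v <;> first | rfl | simp [isStatic, isData] at hv
  · intro τ hf
    simp only [ev_mul, ev_add, ev_rd, ev_lit, ev_ofNat]
    rw [hf .c0 (by decide) (by decide) (by rintro rfl; simp at hT) rfl,
      hf .q (by decide) (by decide) (by rintro rfl; simp at hT) rfl, hσ.c0, hσ.stored.q]
  · intro x hx
    exact hzero x (by rw [← mul_assoc]; exact hx)
  · intro τ c l X hc hX hl hcτ hτ hf hx
    refine Tri.set ?_ ?_
    · simp only [ev_sub, ev_ofNat]
      exact (Nat.sub_le _ _).trans_lt (Nat.one_lt_two_pow (by have := E.one_le_bits; omega))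
    · simp only [upd_self, ev_sub, ev_ofNat, ev_rd, ev_lit, hl, hτ.listed.LIST l X hX,
        if_true, Data.chain, chainCount]
      -- Only the empty set has code `0`, so the truncated difference `1 - code X` is the indicator
      -- of `X = ∅`.
      by_cases h : X = ∅
      · simp [h]
      · have := mt code_eq_zero.1 h
        rw [if_neg h, Nat.sub_eq_zero_of_le (by omega)]
  · rintro τ ⟨⟨h1, h2, -⟩, hf⟩
    have hmods : ∀ v, v ≠ .l → v ≠ .c → v ≠ T → v ≠ .acc →
        (layer T (Var.c0 * (Var.q + 1)) (let_ .acc (1 - rd .LIST Var.l))).mods v = false := by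
      intro v h1 h2 h3 h4
      simp [layer, fill, mods, h1, h2, h3, h4]
    have hτ : P.Ready c₀ τ := hσ.congr fun v hv => hf v (hmods v
      (by rintro rfl; simp [isStatic, isData] at hv)
      (by rintro rfl; simp [isStatic, isData] at hv)
      (by rintro rfl; simp [t1] at hv)
      (by rintro rfl; simp [isStatic, isData] at hv))
    have hJτ : τ J 0 = jmax := by
      rw [hf J (by rcases hJ with rfl | rfl <;> rcases hT with rfl | rfl <;> decide), hjmax]
    refine Tri.steps (Tri.rep (s := P.q * ((P.list c₀).length * (5 * P.q + 5 + 5) + 6) + 3)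
      (fun j τ =>
      (∀ c < P.q, P.Row c₀ τ T ((c₀ * (P.q + 1) + j) * P.q + c) (P.chain key j c)) ∧
      (∀ x, (c₀ * (P.q + 1) + j + 1) * P.q ≤ x / (2 * 3 ^ P.n) → τ T x = 0)) ?_ ?_ ?_)
      (by rw [hJτ])
    · rw [upd_of_ne _ _ _ t6]
      refine ⟨fun c hc => (h1 c hc).congr fun x _ => by rw [upd_of_ne _ _ _ t6], h2⟩
    · rintro j τ' hj hjτ hf' ⟨i1, i2⟩
      have hτ' : P.Ready c₀ τ' := hτ.congr fun v hv => hf' v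
        (by rintro rfl; simp [isStatic, isData] at hv)
        (by
          have : v ≠ T := by rintro rfl; simp [t1] at hv
          cases v <;> first
            | simp [isStatic, isData] at hv; done
            | simp [layer, fill, chainVal, mods, this])
      refine Tri.post (layer_spec (s := 5 * P.q + 5) (β := c₀ * (P.q + 1) + (j + 1))
        (g := P.chain key (j + 1)) hτ' t1 t2 t3 (by simp [chainVal, mods, t4, t5]) ?_
        (by simp [chainVal, mods]) (by simp [chainVal, mods]) ?_ i2 ?_) ?_
      · intro v hv
        cases v <;> first | rfl | simp [isStatic, isData] at hv
      · intro τ'' hf''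
        simp only [ev_mul, ev_add, ev_rd, ev_lit, ev_ofNat]
        rw [hf'' .c0 (by decide) (by decide) (by rintro rfl; simp at hT) rfl,
          hf'' .q (by decide) (by decide) (by rintro rfl; simp at hT) rfl,
          hf'' .j (by decide) (by decide) t6.symm rfl, hτ'.c0, hτ'.stored.q, hjτ]
      · intro τ'' c l X hc hX hl hcτ hτ'' hf'' hx
        refine chainVal_spec hτ'' hW hT hc hcmp hX hl hcτ
          (by rw [hf'' .j (by decide) (by decide) t6.symm rfl, hjτ]) fun d hd =>
          (i1 d hd).congr fun x hx' => hx x ?_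
        rw [hx', ← add_assoc, add_mul _ 1, one_mul]
        omega
      · rintro τ'' ⟨g1, g2, -⟩
        rw [upd_of_ne _ _ _ t6]
        exact ⟨fun c hc => (g1 c hc).congr fun x _ => by rw [upd_of_ne _ _ _ t6], g2⟩
    · rintro τ' hf' ⟨i1, i2⟩
      rw [hJτ] at i1 i2
      refine ⟨i1, fun x hx => i2 x (le_trans ?_ hx)⟩
      rw [← mul_assoc]
      exact Nat.mul_le_mul_right _ (by rw [add_mul]; omega)

end Spec

/-! ### Zeta transform, signed sum and listing of the family -/

section Spec

variable {E : Env} {P : Data}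

/-- Each pass writes a fresh row instead of updating in place, so `c₀` owns `n + 1` rows and each
row is the transform up to one more element. -/
theorem zeta_spec {σ : State} {c₀ jmax : ℕ} {Z T J : Var} {f : Finset ℕ → ZMod P.W}
    (hσ : P.Ready c₀ σ) (hW : P.W < 2 ^ E.bits) (hT : T = .T1 ∨ T = .T2)
    (hZ : Z = .Z1 ∨ Z = .Z2) (hJ : J = .a ∨ J = .b) (hjmax : σ J 0 = jmax)
    (hrow : P.Row c₀ σ T ((c₀ * (P.q + 1) + jmax) * P.q + c₀) f)
    (hzero : ∀ x, c₀ * (P.n + 1) ≤ x / (2 * 3 ^ P.n) → σ Z x = 0) :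
    Tri E (zetaCmd Z T J) σ ((P.list c₀).length * 6 + 3 +
      (P.n * ((P.list c₀).length * 6 + 6) + 3) + 1) fun τ =>
      P.Row c₀ τ Z (c₀ * (P.n + 1) + P.n) (zeta (P.fam c₀) f P.n) ∧
      (∀ x, (c₀ + 1) * (P.n + 1) ≤ x / (2 * 3 ^ P.n) → τ Z x = 0) := by
  have hZs : isStatic Z = false ∧ Z ≠ .l ∧ Z ≠ .acc ∧ Z ≠ .u ∧ Z ≠ .c0 ∧ Z ≠ .n := by
    rcases hZ with rfl | rfl <;> decide
  obtain ⟨t1, t2, t3, t4, t5, t6⟩ := hZs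
  have hJZ : J ≠ .l ∧ J ≠ Z ∧ J ≠ .acc ∧ J ≠ .u := by
    rcases hJ with rfl | rfl <;> rcases hZ with rfl | rfl <;> decide
  have hTZ : T ≠ .l ∧ T ≠ Z ∧ T ≠ .acc := by
    rcases hT with rfl | rfl <;> rcases hZ with rfl | rfl <;> decide
  have hW0 := P.two_le_W
  have hcode : ∀ {l X}, (P.list c₀)[l]? = some X → code X < 3 ^ P.n := fun hX =>
    P.code_lt (List.mem_of_getElem? hX)
  refine Tri.seq (Tri.post (fill_spec (s := 1) (ρ := c₀ * (P.n + 1)) (g := f)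
    hσ t1 t2 (by simp [mods, t3]) ?_ (by simp [mods]) ?_ ?_ ?_).frame ?_)
  · intro v hv
    cases v <;> first | rfl | simp [isStatic, isData] at hv
  · intro τ hf
    simp only [ev_mul, ev_add, ev_rd, ev_lit, ev_ofNat]
    rw [hf .c0 (by decide) t5.symm rfl, hf .n (by decide) t6.symm rfl, hσ.c0, hσ.stored.n]
  · exact fun x hx => hzero x hx.ge
  · intro τ l X hX hl hτ hf hx
    have hv : (rd T (((Var.c0 * (Var.q + 1) + J) * Var.q + Var.c0) * Var.B +
        rd .LIST Var.l)).ev E.inp τ = σ T (((c₀ * (P.q + 1) + jmax) * P.q + c₀) *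
          (2 * 3 ^ P.n) + code X) := by
      simp only [ev_rd, ev_add, ev_mul, ev_lit, ev_ofNat, hτ.c0, hτ.stored.q, hτ.stored.B, hl,
        hτ.listed.LIST l X hX]
      rw [hf J hJZ.1 hJZ.2.1 (by simp [mods, hJZ.2.2.1]),
        hf T hTZ.1 hTZ.2.1 (by simp [mods, hTZ.2.2]), hjmax]
    have hb := hrow (code X) (by have := hcode hX; omega)
    rw [onCodes_code_of_mem (Fm := P.fam c₀) _
      (List.mem_toFinset.2 (List.mem_of_getElem? hX)), ← hv] at hb
    have hWv : (rg .W).ev E.inp τ = P.W := hτ.stored.W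
    refine Tri.set ?_ ?_
    · rw [ev_md, hWv]
      exact (Nat.mod_lt _ (by omega)).trans hW
    · rw [ev_ofNat, upd_self, if_pos rfl, ev_md, hWv, ZMod.natCast_mod, hb]
  · rintro τ ⟨⟨h1, h2⟩, hf⟩
    have hτ : P.Ready c₀ τ := hσ.congr fun v hv => hf v (by
      have : v ≠ Z := by rintro rfl; simp [t1] at hv
      cases v <;> first
        | simp [isStatic, isData] at hv; done
        | simp [fill, mods, this])
    refine Tri.steps (Tri.rep (s := (P.list c₀).length * 6 + 3)
      (fun j τ => P.Row c₀ τ Z (c₀ * (P.n + 1) + j) (zeta (P.fam c₀) f j) ∧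
        ∀ x, c₀ * (P.n + 1) + (j + 1) ≤ x / (2 * 3 ^ P.n) → τ Z x = 0) ?_ ?_ ?_)
      (by rw [hτ.stored.n])
    · rw [upd_of_ne _ _ _ t4]
      refine ⟨h1.congr fun x _ => by rw [upd_of_ne _ _ _ t4], fun x hx => ?_⟩
      rw [h2 x (by omega), hzero x (by omega)]
    · rintro j τ' hj hjτ hf' ⟨i1, i2⟩
      rw [hτ.stored.n] at hj
      have hτ' : P.Ready c₀ τ' := hτ.congr fun v hv => hf' v
        (by rintro rfl; simp [isStatic, isData] at hv)
        (by
          have : v ≠ Z := by rintro rfl; simp [t1] at hv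
          cases v <;> first
            | simp [isStatic, isData] at hv; done
            | simp [fill, mods, this])
      refine Tri.post (fill_spec (s := 1) (ρ := c₀ * (P.n + 1) + (j + 1))
        (g := zeta (P.fam c₀) f (j + 1)) hτ' t1 t2 (by simp [mods, t3]) ?_ (by simp [mods])
        ?_ ?_ ?_) ?_
      · intro v hv
        cases v <;> first | rfl | simp [isStatic, isData] at hv
      · intro τ'' hf''
        simp only [ev_mul, ev_add, ev_rd, ev_lit, ev_ofNat]
        rw [hf'' .c0 (by decide) t5.symm rfl, hf'' .n (by decide) t6.symm rfl,
          hf'' .u (by decide) t4.symm rfl, hτ'.c0, hτ'.stored.n, hjτ]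
      · exact fun x hx => i2 x hx.ge
      · intro τ'' l X hX hl hτ'' hf'' hx
        have hu : τ'' .u 0 = j := by rw [hf'' .u (by decide) t4.symm rfl, hjτ]
        have hXl := hcode hX
        -- The index `code X + 3 ^ j` can exceed `3 ^ n` but stays below `2 * 3 ^ n`; this is the
        -- reason for the doubled row width.
        have hpow : 3 ^ j < 3 ^ P.n := Nat.pow_lt_pow_right (by omega) hj
        have b1 := i1 (code X) (by omega)
        have b2 := i1 (code X + 3 ^ j) (by omega)
        rw [onCodes_code_of_mem (Fm := P.fam c₀) _
          (List.mem_toFinset.2 (List.mem_of_getElem? hX))] at b1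
        rw [onCodes_code_add_pow] at b2
        refine Tri.set ?_ ?_
        · simp only [ev_md, ev_rd, ev_lit, hτ''.stored.W]
          exact (Nat.mod_lt _ (by omega)).trans hW
        · simp only [upd_self, ev_md, ev_rd, ev_lit, ev_add, ev_mul, ev_ofNat, if_true,
            hτ''.stored.W, hτ''.stored.n, hτ''.stored.B, hτ''.stored.PW j hj, hτ''.c0, hu, hl,
            hτ''.listed.LIST l X hX, ZMod.natCast_mod, Nat.cast_add]
          rw [hx _ (by rw [row_div _ (by omega)]; omega),
            hx _ (by rw [row_div _ (by omega)]; omega), b1, b2, zeta]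
      · rintro τ'' ⟨g1, g2⟩
        rw [upd_of_ne _ _ _ t4]
        refine ⟨g1.congr fun x _ => by rw [upd_of_ne _ _ _ t4], fun x hx => ?_⟩
        rw [g2 x (by omega), i2 x (by omega)]
    · rintro τ' hf' ⟨i1, i2⟩
      rw [hτ.stored.n] at i1 i2
      exact ⟨i1, fun x hx => i2 x (by rw [add_mul, one_mul] at hx; exact hx)⟩

theorem sum_spec {σ : State} {c₀ : ℕ} {z₁ z₂ : Finset ℕ → ZMod P.W}
    (hσ : P.Ready c₀ σ) (hW : P.W < 2 ^ E.bits) (hout : σ .out 0 < P.W)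
    (h1 : P.Row c₀ σ .Z1 (c₀ * (P.n + 1) + P.n) z₁)
    (h2 : P.Row c₀ σ .Z2 (c₀ * (P.n + 1) + P.n) z₂) :
    Tri E sumCmd σ ((P.list c₀).length * 4 + 3) fun τ => τ .out 0 < P.W ∧
      (τ .out 0 : ZMod P.W) = σ .out 0 +
        ∑ X ∈ P.fam c₀, (-1) ^ X.card * z₁ X * z₂ X := by
  have hW0 := P.two_le_W
  refine Tri.steps (Tri.rep (s := 1) (fun j τ => τ .out 0 < P.W ∧
    (τ .out 0 : ZMod P.W) = σ .out 0 +
      (((P.list c₀).take j).map fun X => (-1) ^ X.card * z₁ X * z₂ X).sum) ?_ ?_ ?_)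
    (by rw [hσ.listed.cnt])
  · rw [upd_of_ne _ _ _ (by decide)]
    simp [hout]
  · rintro j τ hj hjτ hf ⟨i1, i2⟩
    rw [hσ.listed.cnt] at hj
    have hτ : P.Ready c₀ τ := hσ.congr fun v hv => hf v
      (by rintro rfl; simp [isStatic, isData] at hv)
      (by cases v <;> first | rfl | simp [isStatic, isData] at hv)
    have hX : (P.list c₀)[j]? = some (P.list c₀)[j] := List.getElem?_eq_getElem hj
    rw [List.take_succ_eq_append_getElem hj] at *
    generalize (P.list c₀)[j] = X at hX
    have hXm := List.mem_of_getElem? hX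
    have hXl := P.code_lt hXm
    have b1 := h1 (code X) (by omega)
    have b2 := h2 (code X) (by omega)
    rw [onCodes_code_of_mem (Fm := P.fam c₀) _ (List.mem_toFinset.2 hXm)] at b1 b2
    refine Tri.set ?_ ?_
    · simp only [ev_md, ev_rd, ev_lit, hτ.stored.W]
      exact (Nat.mod_lt _ (by omega)).trans hW
    · simp only [upd_of_ne, upd_self, ev_md, ev_rd, ev_lit, ev_add, ev_mul, ev_ofNat, if_true,
        ne_eq, reduceCtorEq, not_false_eq_true, hτ.stored.W, hτ.stored.n, hτ.stored.B, hτ.c0,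
        hjτ, hτ.listed.LIST j X hX, ZMod.natCast_mod, Nat.cast_add, Nat.cast_mul]
      refine ⟨Nat.mod_lt _ (by omega), ?_⟩
      rw [hf .Z1 (by decide) rfl, hf .Z2 (by decide) rfl, i2, b1, b2, (hτ.listed.LS j X hX).2,
        List.map_append, List.sum_append]
      simp [add_assoc]
  · rintro τ hf ⟨i1, i2⟩
    rw [hσ.listed.cnt, List.take_length, sum_famList] at i2
    exact ⟨i1, i2⟩

/-- The sign is kept as a natural number at most `W`, so `W - s` is an honest subtraction and
represents `-s` modulo `W`. -/
theorem push_spec {σ : State} {L : List (Finset ℕ)} {X Y : Finset ℕ} {l u W : ℕ}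
    (hL : Listed W L σ) (hsz : ∀ l X, L[l]? = some X → σ .LSZ l = X.card)
    (hX : L[l]? = some X) (hl : σ .l 0 = l) (hPW : σ .PW (σ .u 0) = 3 ^ u)
    (hWσ : σ .W 0 = W) (hu : u ∉ X) (hY : Y = insert u X)
    (hW : W < 2 ^ E.bits) (hcode : code Y < 2 ^ E.bits) (hcard : Y.card < 2 ^ E.bits)
    (hlen : L.length + 1 < 2 ^ E.bits) :
    Tri E (set .LIST Var.cnt (rd .LIST Var.l + rd .PW Var.u) ;;
            set .LSZ Var.cnt (rd .LSZ Var.l + 1) ;;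
            set .LS Var.cnt (Var.W - rd .LS Var.l) ;;
            let_ .cnt (Var.cnt + 1)) σ 7 fun τ =>
      Listed W (L ++ [Y]) τ ∧ ∀ l X, (L ++ [Y])[l]? = some X → τ .LSZ l = X.card := by
  have e1 : σ .LIST l + 3 ^ u = code Y := by rw [hL.LIST l X hX, hY, code_insert hu]
  have e2 : σ .LSZ l + 1 = Y.card := by rw [hsz l X hX, hY, card_insert_of_notMem hu]
  have hl' : l < L.length := (List.getElem?_eq_some_iff.1 hX).1
  have hne : l ≠ L.length := hl'.ne
  have hlast : ∀ {i Z}, (L ++ [Y])[i]? = some Z → (i = L.length ∧ Y = Z) ∨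
      (i ≠ L.length ∧ L[i]? = some Z) := by
    intro i Z h
    rcases lt_trichotomy i L.length with hi | hi | hi
    · right
      rw [List.getElem?_append_left hi] at h
      exact ⟨hi.ne, h⟩
    · left
      subst hi
      simpa using h
    · rw [List.getElem?_eq_none (by simp; omega)] at h
      simp at h
  refine Tri.seq (s₁ := 1) (s₂ := 5) (Tri.set ?_ ?_)
  · simpa [hl, hPW, e1] using hcode
  refine Tri.seq (s₁ := 1) (s₂ := 3) (Tri.set ?_ ?_)
  · simpa [upd_of_ne, hl, e2] using hcard
  refine Tri.seq (s₁ := 1) (s₂ := 1) (Tri.set ?_ (Tri.set ?_ ⟨⟨?_, ?_, ?_⟩, ?_⟩))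
  · simp only [ev_sub, ev_rd, ev_lit, upd_of_ne, ne_eq, reduceCtorEq, not_false_eq_true, hWσ]
    omega
  · simpa [upd_of_ne, hL.cnt] using hlen
  · simp [upd_self, upd_of_ne, hL.cnt]
  · intro i Z hZ
    simp only [upd_self, upd_of_ne, ev_sub, ev_add, ev_rd, ev_lit, ev_ofNat, ne_eq, reduceCtorEq,
      not_false_eq_true, hL.cnt, hl, hPW, e1]
    rcases hlast hZ with ⟨rfl, rfl⟩ | ⟨h1, h2⟩
    · rw [if_pos rfl]
    · rw [if_neg h1, hL.LIST i Z h2]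
  · intro i Z hZ
    simp only [upd_self, upd_of_ne, ev_sub, ev_add, ev_rd, ev_lit, ev_ofNat, ne_eq, reduceCtorEq,
      not_false_eq_true, hL.cnt, hl, hWσ]
    rcases hlast hZ with ⟨rfl, rfl⟩ | ⟨h1, h2⟩
    · rw [if_pos rfl]
      obtain ⟨k1, k2⟩ := hL.LS l X hX
      refine ⟨Nat.sub_le _ _, ?_⟩
      rw [Nat.cast_sub k1, k2, hY, card_insert_of_notMem hu, pow_succ]
      simp
    · rw [if_neg h1]
      exact hL.LS i Z h2
  · intro i Z hZ
    simp only [upd_self, upd_of_ne, ev_sub, ev_add, ev_rd, ev_lit, ev_ofNat, ne_eq, reduceCtorEq,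
      not_false_eq_true, hL.cnt, hl, e2]
    rcases hlast hZ with ⟨rfl, rfl⟩ | ⟨h1, h2⟩
    · rw [if_pos rfl]
    · rw [if_neg h1, hsz i Z h2]

theorem family_spec {σ : State} {c₀ : ℕ} (hσ : P.Stored σ) (hE : P.Fits E) (hc₀ : c₀ < P.q)
    (hc : σ .c0 0 = c₀) :
    Tri E familyCmd σ (P.n * ((P.list c₀).length * 11 + 9) + 11) fun τ => P.Ready c₀ τ := by
  have hone : 1 < 2 ^ E.bits := Nat.one_lt_two_pow (by have := E.one_le_bits; omega)
  have hW0 := P.two_le_W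
  have hsum : P.n * ((P.list c₀).length * 11 + 9) + 11 =
    1 + (1 + (1 + (1 + (P.n * ((P.list c₀).length * 11 + 6 + 3) + 3) + 1) + 1) + 1) + 1 := by
    ring
  rw [hsum]
  refine Tri.seq (Tri.set (by simpa using hone) (Tri.seq (Tri.set (by simp) (Tri.seq
    (Tri.set (by simp) (Tri.seq (Tri.set (by simpa using hone) ?_)))))))
  simp only [ev_ofNat]
  set σ' := upd (upd (upd (upd σ .cnt 0 1) .LIST 0 0) .LSZ 0 0) .LS 0 1 with hσ'
  have hσ's : P.Stored σ' := hσ.congr fun v hv => by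
    rw [hσ', upd_of_ne, upd_of_ne, upd_of_ne, upd_of_ne] <;>
      (rintro rfl; simp [isData] at hv)
  have hc' : σ' .c0 0 = c₀ := by
    rw [hσ', upd_of_ne _ _ _ (by decide), upd_of_ne _ _ _ (by decide),
      upd_of_ne _ _ _ (by decide), upd_of_ne _ _ _ (by decide), hc]
  have hL0 : Listed P.W (famList P.R (P.mu c₀) 0) σ' := by
    refine ⟨by simp [hσ', upd_of_ne, upd_self, famList], ?_, ?_⟩ <;>
    · intro l X h
      rw [famList, List.getElem?_singleton] at h
      split_ifs at h with hl
      cases h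
      simp [hσ', upd_of_ne, upd_self, hl] <;> omega
  have hS0 : ∀ l X, (famList P.R (P.mu c₀) 0)[l]? = some X → σ' .LSZ l = X.card := by
    intro l X h
    rw [famList, List.getElem?_singleton] at h
    split_ifs at h with hl
    cases h
    simp [hσ', upd_of_ne, upd_self, hl]
  clear_value σ'
  refine Tri.steps (Tri.rep (s := (P.list c₀).length * 11 + 6) (fun j τ =>
    Listed P.W (famList P.R (P.mu c₀) j) τ ∧
      ∀ l X, (famList P.R (P.mu c₀) j)[l]? = some X → τ .LSZ l = X.card) ?_ ?_ ?_)
    (by rw [hσ's.n])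
  · exact ⟨hL0.congr (upd_of_ne _ _ _ (by decide)) (upd_of_ne _ _ _ (by decide))
      (upd_of_ne _ _ _ (by decide)), by rwa [upd_of_ne _ _ _ (by decide)]⟩
  · rintro j τ hj hjτ hf ⟨i1, i2⟩
    rw [hσ's.n] at hj
    have hτ : P.Stored τ := hσ's.congr fun v hv => hf v
      (by rintro rfl; simp [isData] at hv)
      (by cases v <;> first | rfl | simp [isData] at hv)
    have hdig : (md (rd .MU Var.c0 / rd .PW Var.u) 3).ev E.inp τ =
        if j ∈ P.mu c₀ then 1 else 0 := by
      simp only [ev_md, ev_div, ev_rd, ev_lit, ev_ofNat, hjτ, hf .c0 (by decide) rfl, hc',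
        hτ.MU c₀ hc₀, hτ.PW j hj]
      exact code_digit _ _
    refine Tri.ite (s := (P.list c₀).length * 11 + 5) (fun h => ?_) (fun h => ?_)
    · have hjm : j ∈ P.mu c₀ := by
        by_contra h'
        exact h (by rw [hdig, if_neg h'])
      refine Tri.steps (Tri.skip ?_) (by omega)
      have : famList P.R (P.mu c₀) (j + 1) = famList P.R (P.mu c₀) j := by
        rw [famList, if_pos hjm, List.append_nil]
      rw [this]
      exact ⟨i1.congr (upd_of_ne _ _ _ (by decide)) (upd_of_ne _ _ _ (by decide))
        (upd_of_ne _ _ _ (by decide)), by rwa [upd_of_ne _ _ _ (by decide)]⟩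
    · have hjm : j ∉ P.mu c₀ := by
        intro h'
        rw [hdig, if_pos h'] at h
        omega
      -- The list at most doubles while `j` is processed, so its counter stays below `2 ^ (j + 1) ≤
      -- 3 ^ n`, which fits into a cell. Monotonicity of the lengths bounds the time of every pass
      -- by the final length.
      have hlen := length_famList_mono P.R (P.mu c₀) hj.le
      have hlen2 := length_famList_le_two_pow P.R (P.mu c₀) j
      have hpow : 2 ^ (j + 1) ≤ 3 ^ P.n :=
        (Nat.pow_le_pow_right (by omega) hj).trans (Nat.pow_le_pow_left (by omega) _)
      have hfits := hE.pow_lt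
      rw [pow_succ] at hpow
      refine Tri.steps (Tri.seq (s₁ := 1)
        (s₂ := (famList P.R (P.mu c₀) j).length * (8 + 3) + 3) (Tri.set ?_ ?_)) ?_
      · simp only [ev_rd, ev_lit, i1.cnt]
        omega
      · set L := famList P.R (P.mu c₀) j with hL
        simp only [ev_ofNat, ev_rd, ev_lit]
        set τ' := upd τ .old 0 (τ .cnt 0) with hτ'
        have hold : τ' .old 0 = L.length := by rw [hτ', upd_self, if_pos rfl, i1.cnt]
        have hτ's : P.Stored τ' := hτ.congr fun v hv =>
          upd_of_ne _ _ _ (by rintro rfl; simp [isData] at hv)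
        have hL1 : Listed P.W L τ' := i1.congr (upd_of_ne _ _ _ (by decide))
          (upd_of_ne _ _ _ (by decide)) (upd_of_ne _ _ _ (by decide))
        have hL2 : ∀ l X, L[l]? = some X → τ' .LSZ l = X.card := by
          rwa [hτ', upd_of_ne _ _ _ (by decide)]
        have hu : τ' .u 0 = j := by rw [hτ', upd_of_ne _ _ _ (by decide), hjτ]
        clear_value τ'
        refine Tri.steps (Tri.rep (s := 8) (fun i τ =>
          Listed P.W (L ++ ((L.take i).filter fun X => X.card < P.R).map (insert j)) τ ∧
          ∀ l X, (L ++ ((L.take i).filter fun X => X.card < P.R).map (insert j))[l]? = some X →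
            τ .LSZ l = X.card) ?_ ?_ ?_) (by rw [hold])
        · simp only [List.take_zero, List.filter_nil, List.map_nil, List.append_nil]
          exact ⟨hL1.congr (upd_of_ne _ _ _ (by decide)) (upd_of_ne _ _ _ (by decide))
            (upd_of_ne _ _ _ (by decide)), by rwa [upd_of_ne _ _ _ (by decide)]⟩
        · rintro i ρ hi hiρ hf' ⟨k1, k2⟩
          rw [hold] at hi
          have hρ : P.Stored ρ := hτ's.congr fun v hv => hf' v
            (by rintro rfl; simp [isData] at hv)
            (by cases v <;> first | rfl | simp [isData] at hv)
          have hX : L[i]? = some L[i] := List.getElem?_eq_getElem hi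
          rw [List.take_succ_eq_append_getElem hi] at *
          generalize L[i] = X at hX
          -- Appending does not move the entries of `L`: the scan up to `old` reads the old list
          -- while new sets are added behind it.
          have hX' : (L ++ ((L.take i).filter fun X => X.card < P.R).map (insert j))[i]? =
            some X := by rw [List.getElem?_append_left hi, hX]
          have hXm := mem_famList.1 (List.mem_of_getElem? hX)
          have hjX : j ∉ X := fun h => by simpa using hXm.1 h
          have hguard : (rg .r - rd .LSZ Var.l).ev E.inp ρ = P.R - X.card := by
            simp only [ev_sub, ev_rd, ev_lit, hρ.r, hiρ, k2 i X hX']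
          have hinv : ∀ {L' : List (Finset ℕ)} {ρ' : State} (y : ℕ), (Listed P.W L' ρ' ∧
              ∀ l X, L'[l]? = some X → ρ' .LSZ l = X.card) →
              Listed P.W L' (upd ρ' .l 0 y) ∧
              ∀ l X, L'[l]? = some X → upd ρ' .l 0 y .LSZ l = X.card := by
            rintro L' ρ' y ⟨m1, m2⟩
            exact ⟨m1.congr (upd_of_ne _ _ _ (by decide)) (upd_of_ne _ _ _ (by decide))
              (upd_of_ne _ _ _ (by decide)), by rwa [upd_of_ne _ _ _ (by decide)]⟩
          refine Tri.ite (s := 7) (fun h => ?_) (fun h => ?_)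
          · rw [hguard] at h
            have hcard : X.card < P.R := by omega
            rw [List.filter_append, List.map_append, ← List.append_assoc]
            have : ([X].filter fun X => decide (X.card < P.R)).map (insert j) = [insert j X] := by
              simp [hcard]
            rw [this]
            refine Tri.post (push_spec (u := j) k1 k2 hX' hiρ ?_ hρ.W hjX rfl hE.W_lt ?_ ?_ ?_)
              fun ρ' => hinv _
            · rw [hf' .u (by decide) rfl, hu, hρ.PW j hj]
            · refine (KMatching.code_lt (n := P.n) ?_).trans (by omega)
              exact insert_subset (mem_range.2 hj) (hXm.1.trans (range_mono hj.le))
            · rw [card_insert_of_notMem hjX]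
              have := hE.R_lt
              omega
            · rw [List.length_append, List.length_map]
              have := List.length_filter_le (fun X => decide (X.card < P.R)) (L.take i)
              rw [List.length_take] at this
              omega
          · rw [hguard] at h
            have hcard : ¬ X.card < P.R := by omega
            rw [List.filter_append, List.map_append, ← List.append_assoc]
            have : ([X].filter fun X => decide (X.card < P.R)).map (insert j) = [] := by
              simp [hcard]
            rw [this, List.append_nil]
            exact Tri.steps (Tri.skip (hinv _ ⟨k1, k2⟩)) (by omega)
        · rintro ρ hf' ⟨k1, k2⟩
          rw [hold, List.take_length] at k1 k2
          rw [famList, if_neg hjm, ← hL]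
          exact ⟨k1.congr (upd_of_ne _ _ _ (by decide)) (upd_of_ne _ _ _ (by decide))
            (upd_of_ne _ _ _ (by decide)), by rwa [upd_of_ne _ _ _ (by decide)]⟩
      · have : (famList P.R (P.mu c₀) j).length ≤ (P.list c₀).length := hlen
        omega
  · rintro τ hf ⟨i1, -⟩
    rw [hσ's.n] at i1
    exact ⟨hσ's.congr fun v hv => hf v (by rintro rfl; simp [isData] at hv)
      (by cases v <;> first | rfl | simp [isData] at hv), i1, by rw [hf .c0 (by decide) rfl, hc']⟩

end Spec

/-- The number of matchings in which the tuple `c` has `a` predecessors, as computed by the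
main loop. -/
def Data.term (P : Data) (c : ℕ) : ZMod P.W :=
  ∑ X ∈ P.fam c, (-1) ^ X.card * zeta (P.fam c) (P.chain P.key P.a c) P.n X *
    zeta (P.fam c) (P.chain (fun i => OrderDual.toDual (P.key i)) P.b c) P.n X

/-- The tables are empty from the rows of the tuple `c` on. -/
structure Data.Clean (P : Data) (c : ℕ) (σ : State) : Prop where
  T1 : ∀ x, c * ((P.q + 1) * P.q) ≤ x / (2 * 3 ^ P.n) → σ .T1 x = 0
  T2 : ∀ x, c * ((P.q + 1) * P.q) ≤ x / (2 * 3 ^ P.n) → σ .T2 x = 0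
  Z1 : ∀ x, c * (P.n + 1) ≤ x / (2 * 3 ^ P.n) → σ .Z1 x = 0
  Z2 : ∀ x, c * (P.n + 1) ≤ x / (2 * 3 ^ P.n) → σ .Z2 x = 0

/-! ### The main loop over the middle tuple -/

section Spec

variable {E : Env} {P : Data}

/-- The dominant contribution is that of the chain tables: `a` or `b` layers, `q` rows each, `N`
sets per row and `q` candidates for the next link. -/
theorem middle_steps_le {n q a b N l : ℕ} (hn : n ≤ l) (hq : q ≤ l) (ha : a ≤ l) (hb : b ≤ l)
    (hl : 1 ≤ l) (hN : 1 ≤ N) :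
    n * (N * 11 + 9) + 11 +
      (q * (N * 6 + 6) + 3 + (a * (q * (N * (5 * q + 10) + 6) + 6) + 3) + 1 +
      (q * (N * 6 + 6) + 3 + (b * (q * (N * (5 * q + 10) + 6) + 6) + 3) + 1 +
      (N * 6 + 3 + (n * (N * 6 + 6) + 3) + 1 +
      (N * 6 + 3 + (n * (N * 6 + 6) + 3) + 1 +
      (N * 4 + 3) + 1) + 1) + 1) + 1) + 1 ≤ 300 * (l ^ 3 * N) := by
  have h1 : ∀ x ≤ l, x * N ≤ l ^ 3 * N := fun x hx => by
    refine Nat.mul_le_mul_right _ (hx.trans ?_)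
    exact Nat.le_self_pow (by omega) _
  have h2 : ∀ x ≤ l, x ≤ l ^ 3 * N := fun x hx =>
    (Nat.le_mul_of_pos_right _ hN).trans (h1 x hx)
  have h3 : ∀ x ≤ l, ∀ y ≤ l, x * y * N ≤ l ^ 3 * N := fun x hx y hy => by
    refine Nat.mul_le_mul_right _ ((Nat.mul_le_mul hx hy).trans ?_)
    rw [← sq]
    exact Nat.pow_le_pow_right hl (by omega)
  have h4 : ∀ x ≤ l, ∀ y ≤ l, x * y ≤ l ^ 3 * N := fun x hx y hy =>
    (Nat.le_mul_of_pos_right _ hN).trans (h3 x hx y hy)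
  have h5 : ∀ x ≤ l, x * q * q * N ≤ l ^ 3 * N := fun x hx => by
    refine Nat.mul_le_mul_right _ ?_
    calc x * q * q ≤ l * l * l := by gcongr
      _ = l ^ 3 := by ring
  have h6 : N ≤ l ^ 3 * N := Nat.le_mul_of_pos_left _ (by positivity)
  have h7 : 1 ≤ l ^ 3 * N := hN.trans h6
  have := h1 n hn
  have := h1 q hq
  have := h2 n hn
  have := h2 q hq
  have := h2 a ha
  have := h2 b hb
  have := h3 a ha q hq
  have := h3 b hb q hq
  have := h4 a ha q hq
  have := h4 b hb q hq
  have := h5 a ha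
  have := h5 b hb
  nlinarith

theorem middle_spec {σ : State} {c₀ l : ℕ} (hσ : P.Stored σ) (hE : P.Fits E) (hc₀ : c₀ < P.q)
    (hc : σ .c0 0 = c₀) (hclean : P.Clean c₀ σ) (hout : σ .out 0 < P.W)
    (hn : P.n ≤ l) (hq : P.q ≤ l) :
    Tri E middleCmd σ (300 * (l ^ 3 * chooseDown P.n P.R)) fun τ => P.Clean (c₀ + 1) τ ∧
      τ .out 0 < P.W ∧ (τ .out 0 : ZMod P.W) = σ .out 0 + P.term c₀ := by
  -- The empty set is always listed, so terms without the factor `N` can be absorbed.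
  have hN : 1 ≤ (P.list c₀).length := by
    refine List.length_pos_iff_exists_mem.2 ⟨∅, mem_famList.2 ?_⟩
    simp
  refine Tri.steps (Tri.seq (Tri.post (family_spec hσ hE hc₀ hc).frame ?_))
    ((middle_steps_le hn hq (P.a_le.trans hq) (P.b_le.trans hq) (by omega) hN).trans
      (by gcongr; exact length_famList_le _ _ _))
  rintro σ₁ ⟨r₁, f₁⟩
  refine Tri.seq (Tri.post (chains_spec (key := P.key) (jmax := P.a) r₁ hE.W_lt (Or.inl rfl)
    (Or.inl rfl) r₁.stored.a P.a_le ?_ ?_).frame ?_)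
  · intro τ hτ h1 h2
    simp only [ev_sub, ev_rd, ev_lit, hτ.stored.KEY _ h1, hτ.stored.KEY _ h2]
    omega
  · rw [f₁ .T1 (by decide)]
    exact hclean.T1
  rintro σ₂ ⟨⟨t₁, t₁'⟩, f₂⟩
  have r₂ : P.Ready c₀ σ₂ := r₁.congr fun v hv => f₂ v (by revert hv; cases v <;> decide)
  refine Tri.seq (Tri.post (chains_spec (key := fun i => OrderDual.toDual (P.key i))
    (jmax := P.b) r₂ hE.W_lt (Or.inr rfl) (Or.inr rfl) r₂.stored.b P.b_le ?_ ?_).frame ?_)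
  · intro τ hτ h1 h2
    simp only [ev_sub, ev_rd, ev_lit, hτ.stored.KEY _ h1, hτ.stored.KEY _ h2,
      OrderDual.toDual_lt_toDual]
    omega
  · rw [f₂ .T2 (by decide), f₁ .T2 (by decide)]
    exact hclean.T2
  rintro σ₃ ⟨⟨t₂, t₂'⟩, f₃⟩
  have r₃ : P.Ready c₀ σ₃ := r₂.congr fun v hv => f₃ v (by revert hv; cases v <;> decide)
  refine Tri.seq (Tri.post (zeta_spec (T := .T1) (J := .a) (jmax := P.a) r₃ hE.W_lt (Or.inl rfl)
    (Or.inl rfl) (Or.inl rfl) r₃.stored.a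
    ((t₁ c₀ hc₀).congr fun x _ => by rw [f₃ .T1 (by decide)]) ?_).frame ?_)
  · rw [f₃ .Z1 (by decide), f₂ .Z1 (by decide), f₁ .Z1 (by decide)]
    exact hclean.Z1
  rintro σ₄ ⟨⟨z₁, z₁'⟩, f₄⟩
  have r₄ : P.Ready c₀ σ₄ := r₃.congr fun v hv => f₄ v (by revert hv; cases v <;> decide)
  refine Tri.seq (Tri.post (zeta_spec (T := .T2) (J := .b) (jmax := P.b) r₄ hE.W_lt (Or.inr rfl)
    (Or.inr rfl) (Or.inr rfl) r₄.stored.b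
    ((t₂ c₀ hc₀).congr fun x _ => by rw [f₄ .T2 (by decide)]) ?_).frame ?_)
  · rw [f₄ .Z2 (by decide), f₃ .Z2 (by decide), f₂ .Z2 (by decide), f₁ .Z2 (by decide)]
    exact hclean.Z2
  rintro σ₅ ⟨⟨z₂, z₂'⟩, f₅⟩
  have r₅ : P.Ready c₀ σ₅ := r₄.congr fun v hv => f₅ v (by revert hv; cases v <;> decide)
  have ho : σ₅ .out = σ .out := by
    rw [f₅ _ (by decide), f₄ _ (by decide), f₃ _ (by decide), f₂ _ (by decide),
      f₁ _ (by decide)]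
  refine Tri.post (sum_spec r₅ hE.W_lt (by rwa [ho])
    (z₁.congr fun x _ => by rw [f₅ .Z1 (by decide)]) z₂).frame ?_
  rintro σ₆ ⟨⟨o₁, o₂⟩, f₆⟩
  rw [ho] at o₂
  refine ⟨⟨?_, ?_, ?_, ?_⟩, o₁, o₂⟩
  · rwa [f₆ _ (by decide), f₅ _ (by decide), f₄ _ (by decide), f₃ _ (by decide)]
  · rwa [f₆ _ (by decide), f₅ _ (by decide), f₄ _ (by decide)]
  · rwa [f₆ _ (by decide), f₅ _ (by decide)]
  · rwa [f₆ _ (by decide)]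

theorem main_loop_spec {σ : State} {l : ℕ} (hσ : P.Stored σ) (hE : P.Fits E)
    (hclean : P.Clean 0 σ) (hout : σ .out 0 = 0) (hn : P.n ≤ l) (hq : P.q ≤ l) :
    Tri E (rep .c0 .q middleCmd) σ (P.q * (300 * (l ^ 3 * chooseDown P.n P.R) + 3) + 3)
      fun τ => τ .out 0 < P.W ∧ (τ .out 0 : ZMod P.W) = ∑ c ∈ range P.q, P.term c := by
  have hW0 := P.two_le_W
  refine Tri.steps (Tri.rep (fun j τ => P.Clean j τ ∧ τ .out 0 < P.W ∧
    (τ .out 0 : ZMod P.W) = ∑ c ∈ range j, P.term c) ?_ ?_ ?_) (by rw [hσ.q])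
  · refine ⟨⟨?_, ?_, ?_, ?_⟩, ?_, ?_⟩
    · rw [upd_of_ne _ _ _ (by decide)]; exact hclean.T1
    · rw [upd_of_ne _ _ _ (by decide)]; exact hclean.T2
    · rw [upd_of_ne _ _ _ (by decide)]; exact hclean.Z1
    · rw [upd_of_ne _ _ _ (by decide)]; exact hclean.Z2
    · rw [upd_of_ne _ _ _ (by decide), hout]; omega
    · rw [upd_of_ne _ _ _ (by decide), hout]; simp
  · rintro j τ hj hjτ hf ⟨i1, i2, i3⟩
    rw [hσ.q] at hj
    have hτ : P.Stored τ := hσ.congr fun v hv => hf v (by rintro rfl; simp [isData] at hv)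
      (by revert hv; cases v <;> decide)
    refine Tri.post (middle_spec hτ hE hj hjτ i1 i2 hn hq) ?_
    rintro τ' ⟨⟨g1, g2, g3, g4⟩, h2, h3⟩
    rw [upd_of_ne _ _ _ (by decide), sum_range_succ, ← i3]
    refine ⟨⟨?_, ?_, ?_, ?_⟩, h2, h3⟩ <;> rwa [upd_of_ne _ _ _ (by decide)]
  · rintro τ hf ⟨-, h⟩
    rwa [hσ.q] at h

/-- Combines inclusion–exclusion with the splitting at the middle tuple; both are identities modulo
any `W`. -/
theorem sum_term_eq {d : ℕ} (hcard : ∀ c < P.q, (P.mu c).card ≤ d) (ha : P.a * d ≤ P.R)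
    (hb : P.b * d ≤ P.R) :
    ∑ c ∈ range P.q, P.term c =
      ((okSets P.key P.mu P.q (P.a + 1 + P.b)).card : ZMod P.W) := by
  rw [card_okSets P.key P.mu P.mu_subset hcard ha hb]
  push_cast
  refine sum_congr rfl fun c _ => ?_
  rw [Data.term, sum_zeta_mul_zeta (fun X Y hY h => fam_mono hY h) fun X hX => (mem_fam.1 hX).1]

end Spec

/-! ### Reading the input -/

/-- Read the elements of one of the sets; those of the first set are skipped. -/
def readElements : Cmd :=
  rep .l .len (
    ite Var.i
      (set .WT (.inp Var.p) Var.cur ;; set .PW Var.n Var.cur ;; let_ .n (Var.n + 1) ;;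
        let_ .cur (3 * Var.cur))
      skip ;;
    let_ .p (Var.p + 1))

/-- Read the sets. -/
def readSets : Cmd :=
  rep .i .m (let_ .len (.inp Var.p) ;; let_ .p (Var.p + 1) ;; readElements)

/-- Read the coordinates of a tuple and add the weights of its elements. -/
def readCoordinates : Cmd :=
  rep .i .m (let_ .acc (Var.acc + rd .WT (.inp Var.p)) ;; let_ .p (Var.p + 1))

/-- Read the tuples. -/
def readTuples : Cmd :=
  rep .c .q (set .KEY Var.c (.inp Var.p) ;; let_ .acc 0 ;; readCoordinates ;;
    set .MU Var.c Var.acc ;; let_ .W (2 * Var.W))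

/-- Read the input. -/
def readCmd : Cmd :=
  let_ .m (.inp 0) ;; let_ .k (.inp 1) ;; let_ .p 2 ;; let_ .cur 1 ;; readSets ;;
  let_ .q (.inp Var.p) ;; let_ .p (Var.p + 1) ;; let_ .W 2 ;; readTuples ;;
  let_ .B (2 * Var.cur)

/-- The weight of an element of `V`. -/
def wt (V : List ℕ) (x : ℕ) : ℕ := if x ∈ V then 3 ^ V.idxOf x else 0

/-- Describes the effect of writing one weight; the new element must be absent so that earlier
positions keep their weights. -/
theorem wt_append_singleton {V : List ℕ} {x : ℕ} (h : x ∉ V) (y : ℕ) :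
    wt (V ++ [x]) y = if y = x then 3 ^ V.length else wt V y := by
  unfold wt
  by_cases hy : y = x
  · subst hy
    simp [List.idxOf_append, h]
  · by_cases hV : y ∈ V
    · simp [List.idxOf_append, hy, hV]
    · simp [hy, hV]

theorem wt_le (V : List ℕ) (x : ℕ) : wt V x ≤ 3 ^ V.length := by
  unfold wt
  split_ifs with h
  · exact Nat.pow_le_pow_right (by omega) (List.idxOf_lt_length_of_mem h).le
  · exact Nat.zero_le _

/-- The weights of the elements of `V` are stored in the memory. -/
structure Weights (V : List ℕ) (σ : State) : Prop where
  n : σ .n 0 = V.length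
  cur : σ .cur 0 = 3 ^ V.length
  WT : ∀ x, σ .WT x = wt V x
  PW : ∀ i < V.length, σ .PW i = 3 ^ i

theorem Weights.congr {V : List ℕ} {σ τ : State} (h : Weights V σ) (h1 : τ .n = σ .n)
    (h2 : τ .cur = σ .cur) (h3 : τ .WT = σ .WT) (h4 : τ .PW = σ .PW) : Weights V τ := by
  constructor
  · rw [h1, h.n]
  · rw [h2, h.cur]
  · rw [h3]; exact h.WT
  · rw [h4]; exact h.PW

theorem drop_facts {l rest : List ℕ} {p x : ℕ} (h : l.drop p = x :: rest) :
    l.getD p 0 = x ∧ l.drop (p + 1) = rest ∧ p < l.length ∧ x ∈ l := by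
  have h1 : l[p]? = some x := by
    have h0 : (l.drop p)[0]? = l[p + 0]? := List.getElem?_drop
    rw [h] at h0
    exact h0.symm
  refine ⟨by rw [List.getD_eq_getElem?_getD, h1]; rfl, ?_, ?_, List.mem_of_getElem? h1⟩
  · rw [← List.drop_drop, h]; rfl
  · exact (List.getElem?_eq_some_iff.1 h1).1

/-! ### Correctness of the input phase -/

section Spec

variable {E : Env}

/-- For the first set (`i = 0`) only the reading position advances. Its elements keep the initial
weight `0`, which agrees with `wt` outside `V`. -/
theorem readElements_spec {σ : State} {V u rest : List ℕ} (hlen : E.inp.length < 2 ^ E.bits)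
    (hV : Weights V σ) (hu : σ .len 0 = u.length) (hp : E.inp.drop (σ .p 0) = u ++ rest)
    (hnodup : σ .i 0 ≠ 0 → (V ++ u).Nodup)
    (hpow : σ .i 0 ≠ 0 → 3 ^ (V ++ u).length < 2 ^ E.bits) :
    Tri E readElements σ (u.length * 13 + 3) fun τ =>
      Weights (V ++ if σ .i 0 = 0 then [] else u) τ ∧ E.inp.drop (τ .p 0) = rest := by
  refine Tri.steps (Tri.rep (s := 10) (fun j τ =>
    Weights (V ++ if σ .i 0 = 0 then [] else u.take j) τ ∧
      E.inp.drop (τ .p 0) = u.drop j ++ rest) ?_ ?_ ?_) (by rw [hu])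
  · rw [upd_of_ne _ _ _ (by decide), List.take_zero, ite_self, List.append_nil]
    exact ⟨hV.congr (upd_of_ne _ _ _ (by decide)) (upd_of_ne _ _ _ (by decide))
      (upd_of_ne _ _ _ (by decide)) (upd_of_ne _ _ _ (by decide)), hp⟩
  · rintro j τ hj hjτ hf ⟨i1, i2⟩
    rw [hu] at hj
    rw [List.drop_eq_getElem_cons hj, List.cons_append] at i2
    obtain ⟨d1, d2, d3, -⟩ := drop_facts i2
    have hi : τ .i = σ .i := hf _ (by decide) (by decide)
    refine Tri.seq (s₁ := 8) (s₂ := 1) (Tri.post (Q := fun τ' =>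
      Weights (V ++ if σ .i 0 = 0 then [] else u.take (j + 1)) τ' ∧ τ' .p = τ .p)
        (Tri.ite (s := 7) ?_ ?_) ?_)
    · intro h
      simp only [ev_rd, ev_lit, hi] at h
      have hnd := hnodup h
      have hpw := hpow h
      rw [if_neg h] at i1 ⊢
      have hVl : (V ++ u.take j).length = V.length + j := by
        rw [List.length_append, List.length_take, min_eq_left hj.le]
      have hle : V.length + j + 1 ≤ (V ++ u).length := by rw [List.length_append]; omega
      have hpw1 : 3 ^ (V.length + j + 1) < 2 ^ E.bits :=
        (Nat.pow_le_pow_right (by omega) hle).trans_lt hpw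
      have hpw2 : V.length + j + 1 < 2 ^ E.bits := (Nat.lt_pow_self (by omega)).trans hpw1
      -- Absence of repetitions ensures that no weight is overwritten.
      have hnot : u[j] ∉ V ++ u.take j := by
        have : V ++ u = (V ++ u.take j) ++ (u[j] :: u.drop (j + 1)) := by
          rw [List.append_assoc, ← List.drop_eq_getElem_cons hj, List.take_append_drop]
        rw [this, List.nodup_append] at hnd
        exact fun h => hnd.2.2 _ h u[j] List.mem_cons_self rfl
      have key : Weights (V ++ u.take j ++ [u[j]])
          (upd (upd (upd (upd τ .WT u[j] (3 ^ (V.length + j))) .PW (V.length + j)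
            (3 ^ (V.length + j))) .n 0 (V.length + j + 1)) .cur 0 (3 * 3 ^ (V.length + j))) := by
        have hl' : (V ++ u.take j ++ [u[j]]).length = V.length + j + 1 := by
          rw [List.length_append, hVl]; rfl
        refine ⟨?_, ?_, fun x => ?_, fun x hx => ?_⟩
        · rw [upd_of_ne _ _ _ (by decide), upd_self, if_pos rfl, hl']
        · rw [upd_self, if_pos rfl, hl', pow_succ, mul_comm]
        · simp only [upd_of_ne, upd_self, ne_eq, reduceCtorEq, not_false_eq_true]
          rw [wt_append_singleton hnot, hVl, i1.WT]
        · simp only [upd_of_ne, upd_self, ne_eq, reduceCtorEq, not_false_eq_true]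
          split_ifs with h
          · rw [h]
          · exact i1.PW x (by rw [hVl]; omega)
      have en := i1.n
      have ec := i1.cur
      rw [hVl] at en ec
      rw [pow_succ] at hpw1
      refine Tri.seq (s₁ := 1) (s₂ := 5) (Tri.set ?_ (Tri.seq (s₁ := 1) (s₂ := 3) (Tri.set ?_
        (Tri.seq (s₁ := 1) (s₂ := 1) (Tri.set ?_ (Tri.set ?_ ?_))))))
      · simp only [ev_rd, ev_lit, ec]; omega
      · simp only [ev_rd, ev_lit, upd_of_ne, ne_eq, reduceCtorEq, not_false_eq_true, ec]; omega
      · simp only [ev_rd, ev_lit, ev_add, ev_ofNat, upd_of_ne, ne_eq, reduceCtorEq,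
          not_false_eq_true, en]
        omega
      · simp only [ev_rd, ev_lit, ev_mul, ev_ofNat, upd_of_ne, ne_eq, reduceCtorEq,
          not_false_eq_true, ec]
        omega
      · rw [List.take_succ_eq_append_getElem hj, ← List.append_assoc]
        simp only [ev_rd, ev_lit, ev_mul, ev_add, ev_inp, ev_ofNat, upd_of_ne, ne_eq,
          reduceCtorEq, not_false_eq_true, ec, en, d1, and_true]
        exact key
    · intro h
      simp only [ev_rd, ev_lit, hi] at h
      rw [if_pos h] at i1 ⊢
      exact Tri.steps (Tri.skip ⟨i1, rfl⟩) (by omega)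
    · rintro τ' ⟨h1, h2⟩
      refine Tri.set ?_ ?_
      · simp only [ev_rd, ev_lit, ev_add, ev_ofNat, h2]
        omega
      · simp only [ev_rd, ev_lit, ev_add, ev_ofNat, h2]
        refine ⟨h1.congr ?_ ?_ ?_ ?_, ?_⟩
        · rw [upd_of_ne _ _ _ (by decide), upd_of_ne _ _ _ (by decide)]
        · rw [upd_of_ne _ _ _ (by decide), upd_of_ne _ _ _ (by decide)]
        · rw [upd_of_ne _ _ _ (by decide), upd_of_ne _ _ _ (by decide)]
        · rw [upd_of_ne _ _ _ (by decide), upd_of_ne _ _ _ (by decide)]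
        · rw [upd_of_ne _ _ _ (by decide), upd_self, if_pos rfl, d2]
  · rintro τ hf ⟨h1, h2⟩
    rw [hu] at h1 h2
    rw [List.take_length] at h1
    rw [List.drop_length] at h2
    exact ⟨h1, h2⟩

/-- The list of a block of the input: the size of the set and its elements. -/
abbrev block (u : List ℕ) : List ℕ := u.length :: u

theorem readSets_spec {σ : State} {blocks : List (List ℕ)} {rest : List ℕ} {l : ℕ}
    (hlen : E.inp.length < 2 ^ E.bits) (hV : Weights [] σ) (hm : σ .m 0 = blocks.length)
    (hp : E.inp.drop (σ .p 0) = (blocks.map block).flatten ++ rest)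
    (hnodup : blocks.tail.flatten.Nodup)
    (hpow : 3 ^ blocks.tail.flatten.length < 2 ^ E.bits)
    (hl : ∀ u ∈ blocks, u.length ≤ l) :
    Tri E readSets σ (blocks.length * (l * 13 + 10) + 3) fun τ =>
      Weights blocks.tail.flatten τ ∧ E.inp.drop (τ .p 0) = rest := by
  refine Tri.steps (Tri.rep (s := l * 13 + 7) (fun j τ =>
    Weights (blocks.take j).tail.flatten τ ∧
      E.inp.drop (τ .p 0) = ((blocks.drop j).map block).flatten ++ rest) ?_ ?_ ?_) (by rw [hm])
  · rw [upd_of_ne _ _ _ (by decide)]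
    exact ⟨hV.congr (upd_of_ne _ _ _ (by decide)) (upd_of_ne _ _ _ (by decide))
      (upd_of_ne _ _ _ (by decide)) (upd_of_ne _ _ _ (by decide)), hp⟩
  · rintro j τ hj hjτ hf ⟨i1, i2⟩
    rw [hm] at hj
    have hsucc : (blocks.take (j + 1)).tail.flatten =
        (blocks.take j).tail.flatten ++ if j = 0 then [] else blocks[j] := by
      rw [List.take_succ_eq_append_getElem hj]
      rcases j with _ | j
      · simp
      · rw [List.tail_append_of_ne_nil]
        · simp
        · intro h
          simp only [List.take_eq_nil_iff] at h
          rcases h with h | h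
          · omega
          · simp [h] at hj
    -- What has been read is a prefix of the final list, so it inherits the absence of repetitions
    -- and the size bound.
    have hpre : (blocks.take (j + 1)).tail.flatten <+: blocks.tail.flatten := by
      obtain ⟨b, bs, rfl⟩ := List.exists_cons_of_length_pos (l := blocks) (by omega)
      rw [List.take_succ_cons, List.tail_cons, List.tail_cons]
      refine ⟨(bs.drop j).flatten, ?_⟩
      rw [← List.flatten_append, List.take_append_drop]
    have hul := hl blocks[j] (List.getElem_mem hj)
    rw [List.drop_eq_getElem_cons hj, List.map_cons, List.flatten_cons] at i2
    generalize blocks[j] = u at *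
    rw [block, List.append_assoc, List.cons_append] at i2
    obtain ⟨d1, d2, d3, d4⟩ := drop_facts i2
    refine Tri.steps (Tri.seq (s₁ := 1) (s₂ := 1 + (u.length * 13 + 3) + 1) (Tri.set ?_
      (Tri.seq (Tri.set ?_ (Tri.post (readElements_spec (u := u)
      (rest := ((blocks.drop (j + 1)).map block).flatten ++ rest) hlen (i1.congr ?_ ?_ ?_ ?_)
      ?_ ?_ ?_ ?_) ?_))))) (by omega)
    · simp only [ev_inp, ev_rd, ev_lit, d1]
      exact E.inp_lt _ d4
    · simp only [ev_add, ev_rd, ev_lit, ev_ofNat, upd_of_ne, ne_eq, reduceCtorEq,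
        not_false_eq_true]
      omega
    · rw [upd_of_ne _ _ _ (by decide), upd_of_ne _ _ _ (by decide)]
    · rw [upd_of_ne _ _ _ (by decide), upd_of_ne _ _ _ (by decide)]
    · rw [upd_of_ne _ _ _ (by decide), upd_of_ne _ _ _ (by decide)]
    · rw [upd_of_ne _ _ _ (by decide), upd_of_ne _ _ _ (by decide)]
    · simp [upd_of_ne, upd_self, d1, -List.getD_eq_getElem?_getD]
    · simp only [ev_add, ev_rd, ev_lit, ev_ofNat, upd_of_ne, upd_self, ne_eq, reduceCtorEq,
        not_false_eq_true, if_true]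
      exact d2
    · simp only [upd_of_ne, ne_eq, reduceCtorEq, not_false_eq_true, hjτ]
      intro h
      rw [if_neg h] at hsucc
      rw [← hsucc]
      exact hnodup.sublist hpre.sublist
    · simp only [upd_of_ne, ne_eq, reduceCtorEq, not_false_eq_true, hjτ]
      intro h
      rw [if_neg h] at hsucc
      rw [← hsucc]
      exact (Nat.pow_le_pow_right (by omega) hpre.length_le).trans_lt hpow
    · simp only [upd_of_ne, ne_eq, reduceCtorEq, not_false_eq_true, hjτ, ← hsucc]
      rintro τ' ⟨h1, h2⟩
      refine ⟨h1.congr ?_ ?_ ?_ ?_, h2⟩ <;> rw [upd_of_ne _ _ _ (by decide)]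
  · rintro τ hf ⟨h1, h2⟩
    rw [hm] at h1 h2
    rw [List.take_length] at h1
    rw [List.drop_length] at h2
    exact ⟨h1, h2⟩

/-- The first coordinate needs no special treatment when this is applied to tuples: its weight is
`0`. The bound `t.length * 3 ^ V.length` covers all partial sums. -/
theorem readCoordinates_spec {σ : State} {V t rest : List ℕ}
    (hlen : E.inp.length < 2 ^ E.bits) (hV : ∀ x, σ .WT x = wt V x) (hm : σ .m 0 = t.length)
    (hp : E.inp.drop (σ .p 0) = t ++ rest) (hacc : σ .acc 0 = 0)
    (hpow : t.length * 3 ^ V.length < 2 ^ E.bits) :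
    Tri E readCoordinates σ (t.length * 6 + 3) fun τ =>
      τ .acc 0 = (t.map (wt V)).sum ∧ E.inp.drop (τ .p 0) = rest := by
  refine Tri.steps (Tri.rep (s := 3) (fun j τ =>
    τ .acc 0 = ((t.take j).map (wt V)).sum ∧ E.inp.drop (τ .p 0) = t.drop j ++ rest)
    ?_ ?_ ?_) (by rw [hm])
  · rw [upd_of_ne _ _ _ (by decide), upd_of_ne _ _ _ (by decide)]
    exact ⟨hacc, hp⟩
  · rintro j τ hj hjτ hf ⟨i1, i2⟩
    rw [hm] at hj
    rw [List.drop_eq_getElem_cons hj, List.cons_append] at i2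
    obtain ⟨d1, d2, d3, -⟩ := drop_facts i2
    have hW : τ .WT = σ .WT := hf _ (by decide) (by decide)
    have hsum : ((t.take (j + 1)).map (wt V)).sum = τ .acc 0 + wt V t[j] := by
      rw [List.take_succ_eq_append_getElem hj, i1, List.map_append, List.sum_append,
        List.map_singleton, List.sum_singleton]
    have hle : ((t.take (j + 1)).map (wt V)).sum ≤ t.length * 3 ^ V.length := by
      refine (List.sum_le_card_nsmul _ (3 ^ V.length) ?_).trans ?_
      · intro x hx
        obtain ⟨y, -, rfl⟩ := List.mem_map.1 hx
        exact wt_le _ _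
      · rw [List.length_map, List.length_take, smul_eq_mul]
        exact Nat.mul_le_mul_right _ (min_le_right _ _)
    have hev : (Var.acc + rd .WT (.inp Var.p)).ev E.inp τ =
        ((t.take (j + 1)).map (wt V)).sum := by
      rw [hsum]
      simp only [ev_add, ev_rd, ev_lit, ev_inp, d1, hW, hV]
    refine Tri.seq (s₁ := 1) (s₂ := 1) (Tri.set ?_ (Tri.set ?_ ⟨?_, ?_⟩))
    · rw [hev]
      omega
    · simp only [ev_add, ev_rd, ev_lit, ev_ofNat, upd_of_ne, ne_eq, reduceCtorEq,
        not_false_eq_true]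
      omega
    · rw [hev]
      simp [upd_of_ne, upd_self]
    · simp only [ev_add, ev_rd, ev_lit, ev_ofNat, upd_of_ne, upd_self, ne_eq, reduceCtorEq,
        not_false_eq_true, if_true]
      exact d2
  · rintro τ hf ⟨h1, h2⟩
    rw [hm] at h1 h2
    rw [List.take_length] at h1
    rw [List.drop_length] at h2
    exact ⟨h1, h2⟩

/-- `W` starts at `2` and is doubled with every tuple, which produces the modulus without an
exponentiation. -/
theorem readTuples_spec {σ : State} {V : List ℕ} {m : ℕ} {tuples : List (List ℕ)}
    (hlen : E.inp.length < 2 ^ E.bits) (hV : ∀ x, σ .WT x = wt V x) (hm : σ .m 0 = m)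
    (hm0 : 0 < m) (hq : σ .q 0 = tuples.length) (ht : ∀ t ∈ tuples, t.length = m)
    (hp : E.inp.drop (σ .p 0) = tuples.flatten) (hW : σ .W 0 = 2)
    (hWb : 2 ^ (tuples.length + 1) < 2 ^ E.bits) (hpow : m * 3 ^ V.length < 2 ^ E.bits) :
    Tri E readTuples σ (tuples.length * (m * 6 + 14) + 3) fun τ =>
      (∀ c t, tuples[c]? = some t → τ .KEY c = t.getD 0 0 ∧ τ .MU c = (t.map (wt V)).sum) ∧
      τ .W 0 = 2 ^ (tuples.length + 1) := by
  refine Tri.steps (Tri.rep (s := m * 6 + 11) (fun j τ =>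
    E.inp.drop (τ .p 0) = (tuples.drop j).flatten ∧
    (∀ c t, c < j → tuples[c]? = some t →
      τ .KEY c = t.getD 0 0 ∧ τ .MU c = (t.map (wt V)).sum) ∧
    τ .W 0 = 2 ^ (j + 1)) ?_ ?_ ?_) (by rw [hq])
  · rw [upd_of_ne _ _ _ (by decide), upd_of_ne _ _ _ (by decide)]
    exact ⟨hp, fun c t h => by omega, hW⟩
  · rintro j τ hj hjτ hf ⟨i1, i2, i3⟩
    rw [hq] at hj
    have hT : tuples[j]? = some tuples[j] := List.getElem?_eq_getElem hj
    have htl := ht _ (List.getElem_mem hj)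
    rw [List.drop_eq_getElem_cons hj, List.flatten_cons] at i1
    generalize tuples[j] = t at *
    obtain ⟨x, t', rfl⟩ := List.exists_cons_of_length_pos (l := t) (by omega)
    have i1' := i1
    rw [List.cons_append] at i1'
    obtain ⟨d1, -, -, d4⟩ := drop_facts i1'
    have hWT : τ .WT = σ .WT := hf _ (by decide) (by decide)
    have hmτ : τ .m = σ .m := hf _ (by decide) (by decide)
    refine Tri.steps (Tri.seq (s₁ := 1) (s₂ := 1 + ((m * 6 + 3) + (1 + 1 + 1) + 1) + 1)
      (Tri.set ?_ (Tri.seq (Tri.set (by simp) (Tri.seq (Tri.post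
        (Tri.steps (readCoordinates_spec (V := V) (t := x :: t')
          (rest := (tuples.drop (j + 1)).flatten) hlen ?_ ?_ ?_ ?_ ?_)
          (by rw [htl])).frame.bdd ?_)))))) (by omega)
    · simp only [ev_inp, ev_rd, ev_lit, d1]
      exact E.inp_lt _ d4
    · rwa [upd_of_ne _ _ _ (by decide), upd_of_ne _ _ _ (by decide), hWT]
    · rw [upd_of_ne _ _ _ (by decide), upd_of_ne _ _ _ (by decide), hmτ, hm, htl]
    · rw [upd_of_ne _ _ _ (by decide), upd_of_ne _ _ _ (by decide), i1]
    · simp [upd_self]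
    · rwa [htl]
    · rintro τ' ⟨⟨⟨a1, a2⟩, hf'⟩, hb⟩
      have hc : τ' .c 0 = j := by
        rw [hf' _ (by decide), upd_of_ne _ _ _ (by decide), upd_of_ne _ _ _ (by decide), hjτ]
      have hW' : τ' .W 0 = 2 ^ (j + 1) := by
        rw [hf' _ (by decide), upd_of_ne _ _ _ (by decide), upd_of_ne _ _ _ (by decide), i3]
      have hK' : ∀ c, τ' .KEY c = if c = j then x else τ .KEY c := by
        intro c
        rw [hf' _ (by decide), upd_of_ne _ _ _ (by decide), upd_self]
        simp only [ev_rd, ev_lit, ev_inp, hjτ, d1]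
      have hM' : τ' .MU = τ .MU := by
        rw [hf' _ (by decide), upd_of_ne _ _ _ (by decide), upd_of_ne _ _ _ (by decide)]
      refine Tri.seq (Tri.set (hb _ _) (Tri.set ?_ ⟨?_, ?_, ?_⟩))
      · simp only [ev_mul, ev_rd, ev_lit, ev_ofNat, upd_of_ne, ne_eq, reduceCtorEq,
          not_false_eq_true, hW']
        refine lt_of_le_of_lt ?_ hWb
        rw [← pow_succ']
        exact Nat.pow_le_pow_right (by omega) (by omega)
      · rwa [upd_of_ne _ _ _ (by decide), upd_of_ne _ _ _ (by decide),
          upd_of_ne _ _ _ (by decide)]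
      · intro c t hcj hct
        simp only [upd_of_ne, upd_self, ev_rd, ev_lit, ne_eq, reduceCtorEq, not_false_eq_true,
          hc, a1, hK', hM']
        rcases Nat.lt_succ_iff_lt_or_eq.1 hcj with h | rfl
        · rw [if_neg h.ne, if_neg h.ne]
          exact i2 c t h hct
        · rw [hT, Option.some.injEq] at hct
          subst hct
          simp
      · simp only [upd_of_ne, upd_self, ev_rd, ev_lit, ev_mul, ev_ofNat, ne_eq, reduceCtorEq,
          not_false_eq_true, if_true, hW']
        ring
  · rintro τ hf ⟨-, h2, h3⟩
    rw [hq] at h2 h3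
    exact ⟨fun c t h => h2 c t (List.getElem?_eq_some_iff.1 h).1 h, h3⟩

end Spec

section Spec

variable {E : Env}

theorem read_spec {m k : ℕ} {blocks tuples : List (List ℕ)} {l : ℕ}
    (hinp : E.inp = m :: k :: ((blocks.map block).flatten ++ tuples.length :: tuples.flatten))
    (hlen : E.inp.length < 2 ^ E.bits) (hm0 : 0 < m) (hm : blocks.length = m)
    (hnodup : blocks.tail.flatten.Nodup)
    (hpow : m * 3 ^ blocks.tail.flatten.length < 2 ^ E.bits)
    (hpow2 : 2 * 3 ^ blocks.tail.flatten.length < 2 ^ E.bits)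
    (hl : ∀ u ∈ blocks, u.length ≤ l) (ht : ∀ t ∈ tuples, t.length = m)
    (hWb : 2 ^ (tuples.length + 1) < 2 ^ E.bits) :
    Tri E readCmd (fun _ _ => 0)
      (m * (l * 13 + 10) + tuples.length * (m * 6 + 14) + 23) fun τ =>
      Weights blocks.tail.flatten τ ∧ τ .m 0 = m ∧ τ .k 0 = k ∧ τ .q 0 = tuples.length ∧
      τ .W 0 = 2 ^ (tuples.length + 1) ∧ τ .B 0 = 2 * 3 ^ blocks.tail.flatten.length ∧
      ∀ c t, tuples[c]? = some t →
        τ .KEY c = t.getD 0 0 ∧ τ .MU c = (t.map (wt blocks.tail.flatten)).sum := by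
  have hone : 1 < 2 ^ E.bits := Nat.one_lt_two_pow (by have := E.one_le_bits; omega)
  have hlen3 : 3 ≤ E.inp.length := by rw [hinp]; simp; omega
  have hmb : m < 2 ^ E.bits := E.inp_lt _ (by rw [hinp]; simp)
  have hkb : k < 2 ^ E.bits := E.inp_lt _ (by rw [hinp]; simp)
  have hsteps : m * (l * 13 + 10) + tuples.length * (m * 6 + 14) + 23 =
      1 + (1 + (1 + (1 + ((m * (l * 13 + 10) + 3) + (1 + (1 + (1 +
        ((tuples.length * (m * 6 + 14) + 3) + 1 + 1) + 1) + 1) + 1) + 1) + 1) + 1) + 1) + 1 := by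
    ring
  rw [hsteps]
  refine Tri.seq (Tri.set ?_ (Tri.seq (Tri.set ?_ (Tri.seq (Tri.set ?_ (Tri.seq
    (Tri.set ?_ ?_)))))))
  · simpa [hinp] using hmb
  · simpa [hinp] using hkb
  · simp only [ev_ofNat]; omega
  · simpa using hone
  set σ := upd (upd (upd (upd (fun _ _ => 0) .m ((0 : Ex).ev E.inp fun _ _ => 0) _) _ _ _)
    _ _ _) _ _ _ with hσ
  have s1 : σ .m 0 = m := by simp [hσ, upd_of_ne, upd_self, hinp]
  have s2 : σ .k 0 = k := by simp [hσ, upd_of_ne, upd_self, hinp]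
  have s3 : σ .p 0 = 2 := by simp [hσ, upd_of_ne, upd_self]
  have s4 : Weights [] σ := by
    constructor <;> simp [hσ, upd_of_ne, upd_self, wt]
  clear_value σ
  refine Tri.seq (Tri.post (Tri.steps (readSets_spec (blocks := blocks)
    (rest := tuples.length :: tuples.flatten) (l := l) hlen s4 (by rw [s1, hm]) ?_ hnodup ?_ hl)
    (by rw [hm])).frame ?_)
  · rw [s3, hinp]
    rfl
  · exact lt_of_le_of_lt (Nat.le_mul_of_pos_left _ (by omega)) hpow2
  rintro σ₁ ⟨⟨w₁, p₁⟩, f₁⟩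
  obtain ⟨d1, d2, d3, d4⟩ := drop_facts p₁
  have m₁ : σ₁ .m 0 = m := by rw [f₁ _ (by decide), s1]
  have k₁ : σ₁ .k 0 = k := by rw [f₁ _ (by decide), s2]
  refine Tri.seq (Tri.set ?_ (Tri.seq (Tri.set ?_ (Tri.seq (Tri.set ?_ ?_)))))
  · simp only [ev_inp, ev_rd, ev_lit, d1]
    exact E.inp_lt _ d4
  · simp only [ev_add, ev_rd, ev_lit, ev_ofNat, upd_of_ne, ne_eq, reduceCtorEq,
      not_false_eq_true]
    omega
  · simp only [ev_ofNat]; omega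
  set σ₂ := upd (upd (upd σ₁ _ _ _) _ _ _) _ _ _ with hσ₂
  have q₂ : σ₂ .q 0 = tuples.length := by
    simp only [hσ₂, upd_of_ne, upd_self, ev_rd, ev_lit, ev_inp, ev_ofNat, d1, ne_eq, reduceCtorEq,
      not_false_eq_true, if_true]
  have p₂ : σ₂ .p 0 = σ₁ .p 0 + 1 := by
    simp only [hσ₂, upd_of_ne, upd_self, ev_rd, ev_lit, ev_add, ev_ofNat, ne_eq, reduceCtorEq,
      not_false_eq_true, if_true]
  have W₂ : σ₂ .W 0 = 2 := by simp [hσ₂, upd_self]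
  have f₂ : ∀ v, v ≠ .q → v ≠ .p → v ≠ .W → σ₂ v = σ₁ v := fun v h1 h2 h3 => by
    rw [hσ₂, upd_of_ne _ _ _ h3, upd_of_ne _ _ _ h2, upd_of_ne _ _ _ h1]
  clear_value σ₂
  refine Tri.seq (s₁ := tuples.length * (m * 6 + 14) + 3) (s₂ := 1) (Tri.post (readTuples_spec (V := blocks.tail.flatten) (m := m)
    (tuples := tuples) hlen ?_ ?_ hm0 q₂ ht ?_ W₂ hWb hpow).frame ?_)
  · rw [f₂ _ (by decide) (by decide) (by decide)]
    exact w₁.WT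
  · rw [f₂ _ (by decide) (by decide) (by decide), m₁]
  · rw [p₂, d2]
  rintro σ₃ ⟨⟨t₃, W₃⟩, f₃⟩
  have f₃' : ∀ v, readTuples.mods v = false → v ≠ .q → v ≠ .p → v ≠ .W → σ₃ v = σ₁ v :=
    fun v h0 h1 h2 h3 => by rw [f₃ v h0, f₂ v h1 h2 h3]
  have w₃ : Weights blocks.tail.flatten σ₃ := w₁.congr
    (f₃' _ (by decide) (by decide) (by decide) (by decide))
    (f₃' _ (by decide) (by decide) (by decide) (by decide))
    (f₃' _ (by decide) (by decide) (by decide) (by decide))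
    (f₃' _ (by decide) (by decide) (by decide) (by decide))
  refine Tri.set ?_ ⟨w₃.congr ?_ ?_ ?_ ?_, ?_, ?_, ?_, ?_, ?_, ?_⟩
  · simpa [w₃.cur] using hpow2
  · rw [upd_of_ne _ _ _ (by decide)]
  · rw [upd_of_ne _ _ _ (by decide)]
  · rw [upd_of_ne _ _ _ (by decide)]
  · rw [upd_of_ne _ _ _ (by decide)]
  · rw [upd_of_ne _ _ _ (by decide), f₃' _ (by decide) (by decide) (by decide) (by decide), m₁]
  · rw [upd_of_ne _ _ _ (by decide), f₃' _ (by decide) (by decide) (by decide) (by decide), k₁]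
  · rw [upd_of_ne _ _ _ (by decide), f₃ _ (by decide), q₂]
  · rw [upd_of_ne _ _ _ (by decide), W₃]
  · simp [upd_self, w₃.cur]
  · rw [upd_of_ne _ _ _ (by decide), upd_of_ne _ _ _ (by decide)]
    exact t₃

end Spec

/-! ### The sets of positions of a tuple -/

/-- The positions in `V` of the elements of `t`. -/
def posSet (V t : List ℕ) : Finset ℕ := (t.toFinset.filter (· ∈ V)).image fun x => V.idxOf x

theorem mem_posSet {V t : List ℕ} {i : ℕ} :
    i ∈ posSet V t ↔ ∃ x ∈ t, x ∈ V ∧ V.idxOf x = i := by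
  simp [posSet, and_assoc]

theorem posSet_subset (V t : List ℕ) : posSet V t ⊆ range V.length := by
  intro i hi
  obtain ⟨x, -, hx, rfl⟩ := mem_posSet.1 hi
  exact mem_range.2 (List.idxOf_lt_length_of_mem hx)

/-- Links the number accumulated by the program to the set it stands for. Distinct entries of `t`
are needed, for otherwise a power of `3` would be added twice. -/
theorem code_posSet {V t : List ℕ} (ht : t.Nodup) : code (posSet V t) = (t.map (wt V)).sum := by
  rw [code, posSet, sum_image, ← List.sum_toFinset _ ht, sum_filter]
  · rfl
  · intro x hx y hy h
    exact (List.idxOf_inj (mem_filter.1 hx).2).1 h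

theorem card_posSet_le {V t : List ℕ} (h : t.getD 0 0 ∉ V) :
    (posSet V t).card ≤ t.length - 1 := by
  rcases t with _ | ⟨x, t⟩
  · simp [posSet]
  · refine card_image_le.trans ?_
    have : (x :: t).toFinset.filter (· ∈ V) ⊆ t.toFinset := by
      intro y hy
      rw [mem_filter, List.mem_toFinset, List.mem_cons] at hy
      rcases hy with ⟨rfl | hy, hV⟩
      · exact absurd hV h
      · exact List.mem_toFinset.2 hy
    exact (card_le_card this).trans (List.toFinset_card_le t)

theorem mem_flatten_tail_ofFn {m : ℕ} {U : Fin m → List ℕ} {x : ℕ} :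
    x ∈ (List.ofFn U).tail.flatten ↔ ∃ i : Fin m, i.val ≠ 0 ∧ x ∈ U i := by
  cases m with
  | zero => simp
  | succ m =>
    rw [List.ofFn_succ, List.tail_cons, List.mem_flatten]
    constructor
    · rintro ⟨l, hl, hx⟩
      obtain ⟨i, rfl⟩ := List.mem_ofFn.1 hl
      exact ⟨i.succ, by simp, hx⟩
    · rintro ⟨i, hi, hx⟩
      obtain ⟨j, rfl⟩ := Fin.exists_succ_eq.2 (fun h => hi (by rw [h]; rfl) : i ≠ 0)
      exact ⟨U j.succ, List.mem_ofFn.2 ⟨j, rfl⟩, hx⟩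

theorem length_flatten_tail_ofFn {m : ℕ} (U : Fin m → List ℕ) :
    (List.ofFn U).tail.flatten.length =
      ∑ i ∈ univ.filter (fun i : Fin m => i.val ≠ 0), (U i).length := by
  cases m with
  | zero => simp
  | succ m =>
    rw [List.ofFn_succ, List.tail_cons, List.length_flatten, List.map_ofFn, List.sum_ofFn,
      sum_filter, Fin.sum_univ_succ]
    simp

end KMatching

/-! ### From matchings of tuples to compatible sets of indices -/

namespace MatchingInstance

open KMatching

variable (I : MatchingInstance)

/-- The elements of all the sets except the first one. -/
def elements : List ℕ := (List.ofFn I.U).tail.flatten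

theorem mem_elements {x : ℕ} : x ∈ I.elements ↔ ∃ i : Fin I.m, i.val ≠ 0 ∧ x ∈ I.U i :=
  mem_flatten_tail_ofFn

theorem length_elements : I.elements.length = I.numElements :=
  length_flatten_tail_ofFn I.U

theorem nodup_elements : I.elements.Nodup := by
  rw [elements, List.nodup_flatten]
  constructor
  · intro l hl
    obtain ⟨i, rfl⟩ := List.mem_ofFn.1 (List.mem_of_mem_tail hl)
    exact I.U_nodup i
  · refine List.Pairwise.sublist (List.tail_sublist _) ?_
    rw [List.pairwise_ofFn]
    exact fun i j hij => I.U_disjoint i j hij.ne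

/-- The tuples, as lists. -/
def tuples : List (List ℕ) := I.C.map fun t => List.ofFn t

/-- The tuple with a given index. -/
def tuple (c : ℕ) : Fin I.m → ℕ := I.C.getD c fun _ => 0

/-- The first coordinate of the tuple with a given index. -/
def key (c : ℕ) : ℕ := (List.ofFn (I.tuple c)).getD 0 0

/-- The positions of the other coordinates of the tuple with a given index. -/
def mu (c : ℕ) : Finset ℕ := posSet I.elements (List.ofFn (I.tuple c))

theorem tuple_eq {c : ℕ} (hc : c < I.C.length) : I.tuple c = I.C[c] :=
  List.getD_eq_getElem _ _ hc

theorem tuple_mem {c : ℕ} (hc : c < I.C.length) : I.tuple c ∈ I.C := by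
  rw [I.tuple_eq hc]
  exact List.getElem_mem hc

theorem tuple_injOn : Set.InjOn I.tuple (range I.C.length) := by
  intro c hc d hd h
  have hc := mem_range.1 hc
  have hd := mem_range.1 hd
  rw [I.tuple_eq hc, I.tuple_eq hd] at h
  exact (I.C_nodup.getElem_inj_iff).1 h

theorem key_eq (c : ℕ) : I.key c = I.tuple c ⟨0, I.m_pos⟩ := by
  have h := I.m_pos
  rw [key, List.getD_eq_getElem _ _ (by rw [List.length_ofFn]; exact h), List.getElem_ofFn]

theorem eq_of_mem {x : ℕ} {i j : Fin I.m} (hi : x ∈ I.U i) (hj : x ∈ I.U j) : i = j := by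
  by_contra h
  exact I.U_disjoint i j h hi hj

/-- Entries at different coordinates come from disjoint sets. -/
theorem tuple_injective {t : Fin I.m → ℕ} (ht : t ∈ I.C) : Function.Injective t := by
  intro i j h
  exact I.eq_of_mem (I.C_mem t ht i) (h ▸ I.C_mem t ht j)

theorem key_notMem {c : ℕ} (hc : c < I.C.length) : I.key c ∉ I.elements := by
  rw [I.key_eq, I.mem_elements]
  rintro ⟨i, hi, h⟩
  exact hi (by rw [I.eq_of_mem h (I.C_mem _ (I.tuple_mem hc) _)])

theorem card_mu_le {c : ℕ} (hc : c < I.C.length) : (I.mu c).card ≤ I.m - 1 := by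
  have := card_posSet_le (I.key_notMem hc)
  rwa [List.length_ofFn] at this

/-- Since the sets are mutually disjoint, two tuples can share an element only at the same
coordinate: coordinate `0` is compared by the keys, and all others by positions in `elements`. -/
theorem disjoint_iff {c d : ℕ} (hc : c < I.C.length) (hd : d < I.C.length) :
    Disjoint (univ.image (I.tuple c)) (univ.image (I.tuple d)) ↔
      I.key c ≠ I.key d ∧ Disjoint (I.mu c) (I.mu d) := by
  have hcm := I.C_mem _ (I.tuple_mem hc)
  have hdm := I.C_mem _ (I.tuple_mem hd)
  constructor
  · intro h
    rw [disjoint_left] at h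
    refine ⟨fun hk => ?_, disjoint_left.2 fun p hp hp' => ?_⟩
    · rw [I.key_eq, I.key_eq] at hk
      exact h (mem_image_of_mem (I.tuple c) (mem_univ ⟨0, I.m_pos⟩))
        (by rw [hk]; exact mem_image_of_mem _ (mem_univ _))
    · obtain ⟨x, hx, hxV, hxp⟩ := mem_posSet.1 hp
      obtain ⟨y, hy, hyV, hyp⟩ := mem_posSet.1 hp'
      have : x = y := (List.idxOf_inj hxV).1 (hxp.trans hyp.symm)
      subst this
      obtain ⟨i, rfl⟩ := List.mem_ofFn.1 hx
      obtain ⟨j, hj⟩ := List.mem_ofFn.1 hy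
      exact h (mem_image_of_mem (I.tuple c) (mem_univ i))
        (by rw [← hj]; exact mem_image_of_mem _ (mem_univ _))
  · rintro ⟨hk, hm⟩
    rw [disjoint_left]
    intro x hx hx'
    obtain ⟨i, -, rfl⟩ := mem_image.1 hx
    obtain ⟨j, -, hj⟩ := mem_image.1 hx'
    have hij : i = j := I.eq_of_mem (hcm i) (hj ▸ hdm j)
    subst hij
    by_cases hi : i.val = 0
    · have hi' : i = ⟨0, I.m_pos⟩ := Fin.ext hi
      rw [hi'] at hj
      exact hk (by rw [I.key_eq, I.key_eq, hj])
    · have hV : I.tuple c i ∈ I.elements := I.mem_elements.2 ⟨i, hi, hcm i⟩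
      refine disjoint_left.1 hm (mem_posSet.2 ⟨_, List.mem_ofFn.2 ⟨i, rfl⟩, hV, rfl⟩)
        (mem_posSet.2 ⟨_, List.mem_ofFn.2 ⟨i, hj⟩, hV, rfl⟩)

/-- The list of tuples has no repetitions, so collections of tuples correspond to sets of indices.
-/
theorem numMatchings_eq : I.numMatchings = (okSets I.key I.mu I.C.length I.k).card := by
  classical
  have hinj : ∀ P ∈ okSets I.key I.mu I.C.length I.k, Set.InjOn I.tuple P := fun P hP =>
    I.tuple_injOn.mono (by exact_mod_cast (mem_okSets.1 hP).1)
  have hset : {S : Finset (Fin I.m → ℕ) | (∀ t ∈ S, t ∈ I.C) ∧ S.card = I.k ∧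
      (S : Set (Fin I.m → ℕ)).PairwiseDisjoint (fun t => Finset.univ.image t)} =
      ((okSets I.key I.mu I.C.length I.k).image fun P => P.image I.tuple :
        Finset (Finset (Fin I.m → ℕ))) := by
    ext S
    simp only [Set.mem_ofPred_eq, coe_image, Set.mem_image, mem_coe]
    constructor
    · rintro ⟨h1, h2, h3⟩
      have himg : ((range I.C.length).filter fun c => I.tuple c ∈ S).image I.tuple = S := by
        ext t
        simp only [mem_image, mem_filter, mem_range]
        constructor
        · rintro ⟨c, ⟨-, h⟩, rfl⟩
          exact h
        · intro ht
          obtain ⟨c, hc, rfl⟩ := List.getElem_of_mem (h1 t ht)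
          exact ⟨c, ⟨hc, by rwa [I.tuple_eq hc]⟩, I.tuple_eq hc⟩
      refine ⟨_, mem_okSets.2 ⟨filter_subset _ _, ?_, ?_⟩, himg⟩
      · rw [← h2, ← himg, card_image_of_injOn, himg]
        exact I.tuple_injOn.mono (by exact_mod_cast filter_subset _ _)
      · intro c hc d hd hcd
        rw [mem_filter, mem_range] at hc hd
        exact (I.disjoint_iff hc.1 hd.1).1 (h3 hc.2 hd.2 fun h =>
          hcd (I.tuple_injOn (by simpa using hc.1) (by simpa using hd.1) h))
    · rintro ⟨P, hP, rfl⟩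
      have hP' := mem_okSets.1 hP
      have hlt : ∀ c ∈ P, c < I.C.length := fun c hc => mem_range.1 (hP'.1 hc)
      refine ⟨?_, ?_, ?_⟩
      · intro t ht
        obtain ⟨c, hc, rfl⟩ := mem_image.1 ht
        exact I.tuple_mem (hlt c hc)
      · rw [card_image_of_injOn (hinj P hP), hP'.2.1]
      · intro t ht t' ht' htt
        obtain ⟨c, hc, rfl⟩ := mem_image.1 (mem_coe.1 ht)
        obtain ⟨d, hd, rfl⟩ := mem_image.1 (mem_coe.1 ht')
        exact (I.disjoint_iff (hlt c hc) (hlt d hd)).2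
          (hP'.2.2 c hc d hd fun h => htt (by rw [h]))
  rw [numMatchings, hset, Set.ncard_coe_finset, card_image_of_injOn]
  intro P hP P' hP' h
  have h1 := (mem_okSets.1 hP).1
  have h2 := (mem_okSets.1 hP').1
  ext c
  have h : P.image I.tuple = P'.image I.tuple := h
  constructor
  · intro hc
    obtain ⟨d, hd, hcd⟩ := mem_image.1 (h ▸ mem_image_of_mem I.tuple hc)
    rwa [← I.tuple_injOn (h2 hd) (h1 hc) hcd]
  · intro hc
    obtain ⟨d, hd, hcd⟩ := mem_image.1 (h ▸ mem_image_of_mem I.tuple hc)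
    rwa [← I.tuple_injOn (h1 hd) (h2 hc) hcd]

end MatchingInstance

/-! ### The whole program and its degenerate cases -/

namespace KMatching

open Cmd Ex

/-- Count the matchings when `1 ≤ k ≤ q`. -/
def solveCmd : Cmd :=
  let_ .a ((Var.k - 1) / 2) ;; let_ .b (Var.k / 2) ;; let_ .r ((Var.m - 1) * Var.k / 2) ;;
  rep .c0 .q middleCmd

/-- The whole algorithm. -/
def mainCmd : Cmd :=
  readCmd ;; ite Var.k (ite (Var.q + 1 - Var.k) solveCmd skip) (let_ .out 1)

theorem mainCmd_wf : mainCmd.wf = true := by decide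

theorem length_flatten_map_block (blocks : List (List ℕ)) :
    (blocks.map block).flatten.length = blocks.flatten.length + blocks.length := by
  induction blocks with
  | nil => rfl
  | cons u blocks ih =>
    simp only [List.map_cons, List.flatten_cons, List.length_append, ih, List.length_cons]
    omega

theorem length_le_length_flatten {m : ℕ} (hm : 0 < m) {tuples : List (List ℕ)}
    (h : ∀ t ∈ tuples, t.length = m) : tuples.length ≤ tuples.flatten.length := by
  induction tuples with
  | nil => simp
  | cons t tuples ih =>
    have h1 := h t (by simp)
    have h2 := ih fun t ht => h t (by simp [ht])
    simp only [List.flatten_cons, List.length_append, List.length_cons]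
    omega

theorem length_le_inputSize (l : List ℕ) : l.length ≤ RAM.inputSize l := by
  induction l with
  | nil => simp
  | cons x l ih =>
    simp only [RAM.inputSize, List.map_cons, List.sum_cons, List.length_cons, RAM.bitCost] at *
    omega

theorem lt_two_pow_inputSize {l : List ℕ} {x : ℕ} (h : x ∈ l) : x < 2 ^ RAM.inputSize l := by
  rw [← Nat.size_le]
  induction l with
  | nil => simp at h
  | cons y l ih =>
    simp only [RAM.inputSize, List.map_cons, List.sum_cons, RAM.bitCost] at *
    rcases List.mem_cons.1 h with rfl | h
    · omega
    · have := ih h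
      omega

/-- Bounds the result below the modulus `2 ^ (q + 1)`. -/
theorem card_okSets_le_two_pow {α : Type*} [LinearOrder α] (key : ℕ → α) (mu : ℕ → Finset ℕ)
    (q k : ℕ) : (okSets key mu q k).card ≤ 2 ^ q := by
  calc _ ≤ (range q).powerset.card :=
        card_le_card fun P hP => mem_powerset.2 (mem_okSets.1 hP).1
    _ = 2 ^ q := by simp

theorem card_okSets_zero {α : Type*} [LinearOrder α] (key : ℕ → α) (mu : ℕ → Finset ℕ)
    (q : ℕ) : (okSets key mu q 0).card = 1 := by
  rw [card_eq_one]
  refine ⟨∅, ?_⟩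
  ext P
  rw [mem_okSets, mem_singleton, card_eq_zero]
  constructor
  · exact fun h => h.2.1
  · rintro rfl
    simp [Ok]

/-- This case is treated separately because `k` is given in binary and may be exponentially large;
in the main case `k ≤ q` bounds the numbers of layers. -/
theorem card_okSets_of_lt {α : Type*} [LinearOrder α] (key : ℕ → α) (mu : ℕ → Finset ℕ)
    {q k : ℕ} (h : q < k) : (okSets key mu q k).card = 0 := by
  rw [card_eq_zero, eq_empty_iff_forall_notMem]
  intro P hP
  obtain ⟨h1, h2, -⟩ := mem_okSets.1 hP
  have := card_le_card h1
  rw [card_range] at this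
  omega

end KMatching

/-! ### Choice of parameters, correctness and running time -/

namespace MatchingInstance

open KMatching Cmd Ex

variable (I : MatchingInstance)

theorem encode_eq : I.encode = I.m :: I.k :: (((List.ofFn I.U).map block).flatten ++
    I.tuples.length :: I.tuples.flatten) := by
  simp [encode, tuples, List.map_ofFn, Function.comp_def]

theorem length_of_mem_tuples {t : List ℕ} (ht : t ∈ I.tuples) : t.length = I.m := by
  obtain ⟨t, -, rfl⟩ := List.mem_map.1 ht
  simp

theorem length_tuples : I.tuples.length = I.C.length := by simp [tuples]

theorem getElem?_tuples {c : ℕ} (hc : c < I.C.length) :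
    I.tuples[c]? = some (List.ofFn (I.tuple c)) := by
  rw [tuples, List.getElem?_map, List.getElem?_eq_getElem hc, I.tuple_eq hc]
  rfl

/-- The size of the input. -/
abbrev size : ℕ := RAM.inputSize I.encode

theorem size_bounds : I.m + I.elements.length + I.C.length + 3 ≤ I.size ∧
    ∀ u ∈ List.ofFn I.U, u.length ≤ I.size := by
  have h1 : I.encode.length ≤ I.size := length_le_inputSize I.encode
  have h2 := length_le_length_flatten I.m_pos fun t ht => I.length_of_mem_tuples ht
  have h3 := length_flatten_map_block (List.ofFn I.U)
  have h4 : I.elements.length ≤ (List.ofFn I.U).flatten.length :=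
    (List.Sublist.flatten (List.tail_sublist _)).length_le
  have h5 : I.encode.length = I.m + (List.ofFn I.U).flatten.length + I.tuples.flatten.length + 3 := by
    rw [encode_eq, List.length_cons, List.length_cons, List.length_append, h3, List.length_cons,
      List.length_ofFn]
    omega
  rw [I.length_tuples] at h2
  refine ⟨by omega, fun u hu => ?_⟩
  have := (List.sublist_flatten_of_mem hu).length_le
  omega

/-- The data of the main loop. -/
def data (h : I.k ≤ I.C.length) : Data where
  n := I.elements.length
  q := I.C.length
  R := (I.m - 1) * I.k / 2
  -- For `k ≥ 1` these choices give `a + 1 + b = k` for either parity, with `a, b ≤ k / 2`.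
  a := (I.k - 1) / 2
  b := I.k / 2
  W := 2 ^ (I.C.length + 1)
  key := I.key
  mu := I.mu
  mu_subset := fun _ _ => posSet_subset _ _
  a_le := by omega
  b_le := by omega
  two_le_W := by
    rw [pow_succ]
    have := Nat.one_le_two_pow (n := I.C.length)
    omega

/-- The parameters for running the algorithm. -/
noncomputable def env : Env where
  inp := I.encode
  -- The largest demand is `m * 3 ^ n < 2 ^ size * 4 ^ size`; the additive constant leaves room for
  -- constant factors.
  bits := 3 * I.size + 8
  K := mainCmd.maxSize + 1
  one_le_bits := by omega
  inp_lt := fun _ hx => (lt_two_pow_inputSize hx).trans_le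
    (Nat.pow_le_pow_right (by omega) (by change I.size ≤ 3 * I.size + 8; omega))
  one_le_K := by omega

theorem k_lt : I.k < 2 ^ I.size := lt_two_pow_inputSize (by rw [encode_eq]; simp)

theorem m_lt : I.m < 2 ^ I.size := lt_two_pow_inputSize (by rw [encode_eq]; simp)

theorem bounds : I.m * 3 ^ I.elements.length < 2 ^ I.env.bits ∧
    2 * 3 ^ I.elements.length < 2 ^ I.env.bits ∧ 2 ^ (I.C.length + 1) < 2 ^ I.env.bits ∧
    (I.m - 1) * I.k / 2 < 2 ^ I.env.bits ∧ I.encode.length < 2 ^ I.env.bits := by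
  obtain ⟨h1, -⟩ := I.size_bounds
  have h2 : I.encode.length ≤ I.size := length_le_inputSize I.encode
  have h3 : 3 ^ I.elements.length ≤ 2 ^ (2 * I.size) := by
    rw [pow_mul]
    exact (Nat.pow_le_pow_left (by omega) _).trans (Nat.pow_le_pow_right (by omega) (by omega))
  have hb : I.env.bits = 3 * I.size + 8 := rfl
  rw [hb]
  have hm := I.m_lt
  have hk := I.k_lt
  have e1 : 2 ^ (3 * I.size + 8) = 256 * (2 ^ I.size * 2 ^ (2 * I.size)) := by
    rw [← pow_add, show (256 : ℕ) = 2 ^ 8 by norm_num, ← pow_add]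
    congr 1
    omega
  have e2 : 2 ^ (2 * I.size) = 2 ^ I.size * 2 ^ I.size := by rw [two_mul, pow_add]
  have p1 : 1 ≤ 2 ^ I.size := Nat.one_le_two_pow
  have p2 : 1 ≤ 2 ^ (2 * I.size) := Nat.one_le_two_pow
  have e3 : 2 ^ (2 * I.size) ≤ 2 ^ I.size * 2 ^ (2 * I.size) := Nat.le_mul_of_pos_left _ p1
  refine ⟨?_, ?_, ?_, ?_, ?_⟩
  · have := Nat.mul_le_mul hm.le h3
    omega
  · omega
  · exact Nat.pow_lt_pow_right (by omega) (by omega)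
  · have := Nat.mul_le_mul ((Nat.sub_le I.m 1).trans hm.le) hk.le
    have := Nat.div_le_self ((I.m - 1) * I.k) 2
    omega
  · have : I.encode.length < 2 ^ I.encode.length := Nat.lt_two_pow_self
    exact this.trans_le (Nat.pow_le_pow_right (by omega) (by omega))

theorem fits (h : I.k ≤ I.C.length) : (I.data h).Fits I.env where
  W_lt := I.bounds.2.2.1
  pow_lt := I.bounds.2.1
  R_lt := I.bounds.2.2.2.1

theorem sum_term (hk : I.k ≠ 0) (h : I.k ≤ I.C.length) :
    ∑ c ∈ range (I.data h).q, (I.data h).term c = (I.numMatchings : ZMod (I.data h).W) := by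
  -- The rounding down in `R` is harmless: `x * (m - 1)` is an integer not exceeding `(m - 1) * k /
  -- 2`.
  have hR : ∀ x, 2 * x ≤ I.k → x * (I.m - 1) ≤ (I.m - 1) * I.k / 2 := fun x hx => by
    rw [Nat.le_div_iff_mul_le (by omega), mul_comm x, mul_assoc, mul_comm x]
    exact Nat.mul_le_mul_left _ hx
  have ha : 2 * (I.data h).a ≤ I.k := by
    change 2 * ((I.k - 1) / 2) ≤ I.k
    omega
  have hb : 2 * (I.data h).b ≤ I.k := by
    change 2 * (I.k / 2) ≤ I.k
    omega
  rw [sum_term_eq (d := I.m - 1) (fun c hc => I.card_mu_le hc) (hR _ ha) (hR _ hb), I.numMatchings_eq]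
  have : (I.data h).a + 1 + (I.data h).b = I.k := by
    change (I.k - 1) / 2 + 1 + I.k / 2 = I.k
    omega
  rw [this]
  rfl

/-- The last hypothesis supplies the empty tables: the input phase never touches them, so they still
hold the initial zeros. -/
theorem solve_spec {σ : State} (hk : I.k ≠ 0) (h : I.k ≤ I.C.length)
    (hw : Weights I.elements σ) (hm : σ .m 0 = I.m) (hkσ : σ .k 0 = I.k)
    (hq : σ .q 0 = I.C.length) (hW : σ .W 0 = 2 ^ (I.C.length + 1))
    (hB : σ .B 0 = 2 * 3 ^ I.elements.length)
    (ht : ∀ c < I.C.length, σ .KEY c = I.key c ∧ σ .MU c = code (I.mu c))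
    (h0 : ∀ v, readCmd.mods v = false → σ v = fun _ => 0) :
    Tri I.env solveCmd σ (I.C.length * (300 * (I.size ^ 3 *
      chooseDown I.elements.length ((I.m - 1) * I.k / 2)) + 3) + 9) fun τ =>
      τ .out 0 = I.numMatchings := by
  obtain ⟨h1, -⟩ := I.size_bounds
  have hkb : I.k < 2 ^ I.env.bits := I.k_lt.trans_le
    (Nat.pow_le_pow_right (by omega) (by change I.size ≤ 3 * I.size + 8; omega))
  suffices H : Tri I.env solveCmd σ (1 + (1 + (1 + (I.C.length * (300 * (I.size ^ 3 *
      chooseDown I.elements.length ((I.m - 1) * I.k / 2)) + 3) + 3) + 1) + 1) + 1) fun τ =>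
      τ .out 0 = I.numMatchings from H.steps (by omega)
  refine Tri.seq (Tri.set ?_ (Tri.seq (Tri.set ?_ (Tri.seq (Tri.set ?_ ?_)))))
  · simp only [ev_div, ev_sub, ev_rd, ev_lit, ev_ofNat, hkσ]
    omega
  · simp only [ev_div, ev_rd, ev_lit, ev_ofNat, upd_of_ne, ne_eq, reduceCtorEq,
      not_false_eq_true, hkσ]
    omega
  · simp only [ev_div, ev_mul, ev_sub, ev_rd, ev_lit, ev_ofNat, upd_of_ne, ne_eq, reduceCtorEq,
      not_false_eq_true, hkσ, hm]
    exact I.bounds.2.2.2.1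
  simp only [ev_div, ev_mul, ev_sub, ev_rd, ev_lit, ev_ofNat, upd_of_ne, ne_eq, reduceCtorEq,
    not_false_eq_true, hkσ, hm]
  set τ := upd (upd (upd σ .a 0 ((I.k - 1) / 2)) .b 0 (I.k / 2)) .r 0 ((I.m - 1) * I.k / 2)
    with hτ
  have hf : ∀ v, v ≠ .a → v ≠ .b → v ≠ .r → τ v = σ v := fun v h1 h2 h3 => by
    rw [hτ, upd_of_ne _ _ _ h3, upd_of_ne _ _ _ h2, upd_of_ne _ _ _ h1]
  have hstored : (I.data h).Stored τ := by
    constructor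
    · rw [hf _ (by decide) (by decide) (by decide), hw.n]; rfl
    · rw [hf _ (by decide) (by decide) (by decide), hq]; rfl
    · rw [hτ, upd_self, if_pos rfl]; rfl
    · rw [hτ, upd_of_ne _ _ _ (by decide), upd_of_ne _ _ _ (by decide), upd_self, if_pos rfl]; rfl
    · rw [hτ, upd_of_ne _ _ _ (by decide), upd_self, if_pos rfl]; rfl
    · rw [hf _ (by decide) (by decide) (by decide), hW]; rfl
    · rw [hf _ (by decide) (by decide) (by decide), hB]; rfl
    · rw [hf _ (by decide) (by decide) (by decide)]; exact hw.PW
    · rw [hf _ (by decide) (by decide) (by decide)]; exact fun c hc => (ht c hc).1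
    · rw [hf _ (by decide) (by decide) (by decide)]; exact fun c hc => (ht c hc).2
  have hzero : ∀ v, readCmd.mods v = false → v ≠ .a → v ≠ .b → v ≠ .r → ∀ x, τ v x = 0 :=
    fun v h1 h2 h3 h4 x => by rw [hf v h2 h3 h4, h0 v h1]
  have hq' : (I.data h).q = I.C.length := rfl
  have hn' : (I.data h).n = I.elements.length := rfl
  have hR' : (I.data h).R = (I.m - 1) * I.k / 2 := rfl
  refine Tri.mono (main_loop_spec (l := I.size) hstored (I.fits h) ⟨?_, ?_, ?_, ?_⟩ ?_ ?_ ?_)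
    (by rw [hq', hn', hR']) ?_
  · exact fun x _ => hzero _ (by decide) (by decide) (by decide) (by decide) x
  · exact fun x _ => hzero _ (by decide) (by decide) (by decide) (by decide) x
  · exact fun x _ => hzero _ (by decide) (by decide) (by decide) (by decide) x
  · exact fun x _ => hzero _ (by decide) (by decide) (by decide) (by decide) x
  · exact hzero _ (by decide) (by decide) (by decide) (by decide) 0
  · rw [hn']; omega
  · rw [hq']; omega
  · rintro ρ ⟨o1, o2⟩
    -- Both numbers are smaller than `W`, so their congruence modulo `W` is an equality.
    rw [I.sum_term hk h, ZMod.natCast_eq_natCast_iff', Nat.mod_eq_of_lt o1, Nat.mod_eq_of_lt] at o2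
    · exact o2
    · change _ < 2 ^ (I.C.length + 1)
      rw [I.numMatchings_eq, pow_succ]
      have := card_okSets_le_two_pow I.key I.mu I.C.length I.k
      have := Nat.two_pow_pos I.C.length
      omega

theorem steps_le {m q l N s : ℕ} (hm : m ≤ s) (hq : q ≤ s) (hl : l ≤ s) (hs : 1 ≤ s)
    (hN : 1 ≤ N) :
    (m * (l * 13 + 10) + q * (m * 6 + 14) + 23) +
      (q * (300 * (s ^ 3 * N) + 3) + 9 + 1 + 1) + 1 ≤ 1000 * (s ^ 4 * N) := by
  have h1 : m * (l * 13 + 10) ≤ s * (s * 13 + 10) := by gcongr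
  have h2 : q * (m * 6 + 14) ≤ s * (s * 6 + 14) := by gcongr
  have h3 : q * (300 * (s ^ 3 * N) + 3) ≤ s * (300 * (s ^ 3 * N) + 3) := by gcongr
  have h4 : s * (300 * (s ^ 3 * N) + 3) = 300 * (s ^ 4 * N) + 3 * s := by ring
  have h5 : ∀ e ≤ 4, s ^ e ≤ s ^ 4 * N := fun e he =>
    (Nat.pow_le_pow_right hs he).trans (Nat.le_mul_of_pos_right _ hN)
  have h6 := h5 0 (by omega)
  have h7 := h5 1 (by omega)
  have h8 := h5 2 (by omega)
  rw [pow_zero] at h6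
  rw [pow_one] at h7
  nlinarith

theorem main_spec : Tri I.env mainCmd (fun _ _ => 0)
    (1000 * (I.size ^ 4 * chooseDown I.numElements ((I.m - 1) * I.k / 2))) fun τ =>
      τ .out 0 = I.numMatchings := by
  obtain ⟨h1, h2⟩ := I.size_bounds
  obtain ⟨b1, b2, b3, b4, b5⟩ := I.bounds
  -- The summand for `i = 0` is `1`; hence the polynomial cost of reading the input is absorbed into
  -- the product.
  have hN : 1 ≤ chooseDown I.elements.length ((I.m - 1) * I.k / 2) := by
    rw [chooseDown, sum_range_succ']
    simp
  rw [← I.length_elements]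
  refine Tri.steps (Tri.seq (Tri.post (read_spec (E := I.env) (l := I.size) I.encode_eq b5
    I.m_pos (by simp) I.nodup_elements b1 b2 h2 (fun t ht => I.length_of_mem_tuples ht)
    (by rw [I.length_tuples]; exact b3)).frame ?_))
    (steps_le (by omega) (by rw [I.length_tuples]; omega) le_rfl (by omega) hN)
  rintro σ ⟨⟨w, hm, hk, hq, hW, hB, ht⟩, hf⟩
  have ho : σ .out 0 = 0 := by rw [hf _ (by decide)]
  rw [I.length_tuples] at hq hW ⊢
  refine Tri.ite (fun hk0 => Tri.ite (fun hkq => ?_) (fun hkq => ?_)) (fun hk0 => ?_)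
  · simp only [ev_rd, ev_lit, ev_sub, ev_add, ev_ofNat, hk, hq] at hk0 hkq
    refine I.solve_spec hk0 (by omega) w hm hk hq hW hB (fun c hc => ?_) hf
    obtain ⟨t1, t2⟩ := ht c _ (I.getElem?_tuples hc)
    refine ⟨t1, t2.trans (code_posSet ?_).symm⟩
    exact List.nodup_ofFn.2 (I.tuple_injective (I.tuple_mem hc))
  · simp only [ev_rd, ev_lit, ev_sub, ev_add, ev_ofNat, hk, hq] at hk0 hkq
    refine Tri.steps (Tri.skip ?_) (by omega)
    rw [ho, I.numMatchings_eq, card_okSets_of_lt _ _ (by omega)]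
  · simp only [ev_rd, ev_lit, hk] at hk0
    refine Tri.steps (Tri.set ?_ ?_) (by omega)
    · exact Nat.one_lt_two_pow (by have := I.env.one_le_bits; omega)
    · rw [I.numMatchings_eq, hk0, card_okSets_zero, ev_ofNat, upd_self, if_pos rfl, ev_ofNat]

end MatchingInstance

open Polynomial in
theorem mainTheorem6 :
    ∃ (prog : RAM.Program) (p : Polynomial ℕ), ∀ I : MatchingInstance,
      RAM.ComputesWithin prog I.encode I.numMatchings
        (p.eval (RAM.inputSize I.encode) *
          chooseDown I.numElements ((I.m - 1) * I.k / 2)) := by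
  refine ⟨KMatching.mainCmd.toProgram,
    -- At most `1000 * L ^ 4 * chooseDown` steps, each of cost at most `3 * K ^ 2 * (bits + 1)` with
    -- `bits = 3 * L + 8`; the constant `K` depends only on the program.
    C (3000 * (KMatching.mainCmd.maxSize + 1) ^ 2) * X ^ 4 * (C 3 * X + C 9), fun I => ?_⟩
  obtain ⟨M, t, h1, h2, -, h4⟩ := I.main_spec KMatching.mainCmd_wf (Nat.le_succ _)
    (fun _ => 0) rfl fun _ => Nat.two_pow_pos _
  refine ⟨M, t, h1, h4, h2.trans (le_of_eq ?_)⟩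
  simp only [eval_mul, eval_C, eval_pow, eval_X, eval_add]
  change _ * (3 * (KMatching.mainCmd.maxSize + 1) ^ 2 * (3 * I.size + 8 + 1)) = _
  ring
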